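/- **Proposition 3.2.** Let $\alpha\in(-1,1)\setminus\{0\}$ and $\delta\ge 0$. Let $a:(0,\infty)\to\mathbb C$ be smooth with $|a^{(N)}(r)|\le C_N r^{-N}$ for all $r>0$, $N\ge 0$. Let $\beta\in C_c^\infty([\tfrac38,\tfrac43])$ be real-valued and generate a dyadic partition of unity, $\sum_{k\in\mathbb Z}\beta(2^{-k}r)=1$ for $r>0$, and put $\beta_0(r)=1-\sum_{k\ge1}\beta(2^{-k}r)$. For $r_1,r_2> 0$ and $s\ge 0$ let $|\mathbf n_s|=\sqrt{r_1^2+r_2^2+2r_1r_2\cosh s}$, and for $\ell=1,2,3$ let $$K_D^\ell(r_1,r_2;\theta)=\int_0^\infty e^{i|\mathbf n_s|}(1+|\mathbf n_s|)^{-\frac32-\delta}\,a(|\mathbf n_s|)\,w_\ell(s,\theta)\,ds,$$ $$w_1=e^{-|\alpha|s},\qquad w_2=\frac{(e^{-s}-\cos(\theta+\pi))\sinh(\alpha s)}{\cosh s-\cos(\theta+\pi)},\qquad w_3=\frac{\sin(\theta+\pi)\cosh(\alpha s)}{\cosh s-\cos(\theta+\pi)}.$$ Let $K_D^{\ell,0}=\beta_0(r_1+r_2)K_D^\ell$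 and $K_D^{\ell,j}=\beta(2^{-j}(r_1+r_2))K_D^\ell$ for $j\ge1$, and let $T_D^{\ell,j}$ be the operator on functions on $\mathbb R^2$, written in polar coordinates, $$T_D^{\ell,j}f(r_1,\theta_1)=\int_0^\infty\int_0^{2\pi}K_D^{\ell,j}(r_1,r_2;\theta_1-\theta_2)f(r_2,\theta_2)\,d\theta_2\,r_2\,dr_2 .$$ Write $\delta_c(p,2)=\max\{0,\,2|\tfrac12-\tfrac1p|-\tfrac12\}$. Then the integrals defining $K_D^\ell$ converge absolutely for all $r_1,r_2>0$ and all $\theta$; for $p=2$ and for $4\le p\le\infty$ the operators $T_D^{\ell,j}$ are well defined on $L^p(\mathbb R^2)$, the integral defining $T_D^{\ell,j}f$ converging absolutely almost everywhere for $f\in L^p(\mathbb R^2)$; and for all $\ell\in\{1,2,3\}$ and all integers $j\ge0$ the following bounds hold, with constants $C$ independent of $j$: * $\|T_D^{\ell,j}\|_{L^2\to L^2}\le C\,2^{-j\delta}$, with $C$ depending only on $\alpha,\delta,a,\beta$; * for every $6\le p\le\infty$, $\|T_D^{\ell,j}\|_{L^p\to L^p}\le C\,2^{j[\delta_c(p,2)-\delta]}$,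 with $C$ depending only on $\alpha,\delta,a,\beta,p$; * for every $4\le p<6$ and every $\varepsilon'>0$, $\|T_D^{\ell,j}\|_{L^p\to L^p}\le C\,2^{j[\delta_c(p,2)-\delta]}\,2^{j\varepsilon'}$, with $C$ depending only on $\alpha,\delta,a,\beta,p,\varepsilon'$. -/

import Mathlib

open MeasureTheory Set
open scoped ENNReal ContDiff

noncomputable section

namespace DiffractiveBR

/-- The Euclidean plane. -/
abbrev Plane : Type := EuclideanSpace ℝ (Fin 2)

/-- The polar angle in `[0, 2π)` of a point of the plane. -/
def polarAngle (x : Plane) : ℝ :=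
  toIcoMod Real.two_pi_pos 0 (Complex.arg ⟨x 0, x 1⟩)

/-- The critical Bochner-Riesz index `δ_c(p, n) = max {0, n |1/2 - 1/p| - 1/2}`, `1 ≤ p ≤ ∞`,
with `1/∞ = 0`. -/
def criticalIndex (p : ℝ≥0∞) (n : ℕ) : ℝ :=
  max 0 ((n : ℝ) * |1 / 2 - (p⁻¹).toReal| - 1 / 2)

/-- Amplitudes: smooth `a : (0, ∞) → ℂ` with `|a^(N)(r)| ≤ C_N r^(-N)` for every `N ≥ 0`.
(Values of `a` outside `(0, ∞)` are irrelevant.) -/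
structure IsAmplitude (a : ℝ → ℂ) : Prop where
  smooth : ContDiffOn ℝ ∞ a (Ioi 0)
  bound : ∀ N : ℕ, ∃ C : ℝ, ∀ r : ℝ, 0 < r → ‖iteratedDeriv N a r‖ ≤ C * (r ^ N)⁻¹

/-- A function `β ∈ C_c^∞([3/8, 4/3])` generating a dyadic partition of unity on `(0, ∞)`. -/
structure IsDyadicPartition (β : ℝ → ℝ) : Prop where
  smooth : ContDiff ℝ ∞ β
  support : tsupport β ⊆ Icc (3 / 8) (4 / 3)
  sum_eq_one : ∀ r : ℝ, 0 < r → ∑' k : ℤ, β ((2 : ℝ) ^ (-k) * r) = 1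

/-- The dyadic cutoffs: `β_0(r) = 1 - ∑_{k ≥ 1} β(2^(-k) r)`, and `β(2^(-j) r)` for `j ≥ 1`. -/
def dyadicCutoff (β : ℝ → ℝ) : ℕ → ℝ → ℝ
  | 0, r => 1 - ∑' k : ℕ, β ((2 : ℝ) ^ (-((k : ℤ) + 1)) * r)
  | j + 1, r => β ((2 : ℝ) ^ (-((j : ℤ) + 1)) * r)

/-- `|n_s| = √(r₁² + r₂² + 2 r₁ r₂ cosh s)`, the length of
`n_s = (r₁ + r₂, √(2 r₁ r₂ (cosh s - 1)))`. -/
def diffDist (r₁ r₂ s : ℝ) : ℝ :=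
  Real.sqrt (r₁ ^ 2 + r₂ ^ 2 + 2 * r₁ * r₂ * Real.cosh s)

/-- The three weights (`ℓ = 1, 2, 3`) in the diffractive kernel, with `θ = θ₁ - θ₂`. -/
def diffWeight (α θ s : ℝ) : ℕ → ℝ
  | 1 => Real.exp (-|α| * s)
  | 2 => (Real.exp (-s) - Real.cos (θ + Real.pi)) * Real.sinh (α * s)
          / (Real.cosh s - Real.cos (θ + Real.pi))
  | 3 => Real.sin (θ + Real.pi) * Real.cosh (α * s)
          / (Real.cosh s - Real.cos (θ + Real.pi))
  | _ => 0

/-- The integrand of `K_D^ℓ(r₁, r₂; θ)`: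
`e^(i|n_s|) (1 + |n_s|)^(-3/2-δ) a(|n_s|)` times the `ℓ`-th weight. -/
def diffIntegrand (α δ : ℝ) (a : ℝ → ℂ) (ℓ : ℕ) (r₁ r₂ θ s : ℝ) : ℂ :=
  Complex.exp (Complex.I * (diffDist r₁ r₂ s : ℂ))
    * (((1 + diffDist r₁ r₂ s) ^ (-(3 / 2) - δ) : ℝ) : ℂ)
    * a (diffDist r₁ r₂ s)
    * (diffWeight α θ s ℓ : ℂ)

/-- The kernel `K_D^ℓ(r₁, r₂; θ)`. -/
def diffKernel (α δ : ℝ) (a : ℝ → ℂ) (ℓ : ℕ) (r₁ r₂ θ : ℝ) : ℂ :=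
  ∫ s in Ioi (0 : ℝ), diffIntegrand α δ a ℓ r₁ r₂ θ s

/-- The localized kernel `K_D^{ℓ,j}(r₁, r₂; θ)`. -/
def diffKernelPiece (α δ : ℝ) (a : ℝ → ℂ) (β : ℝ → ℝ) (ℓ j : ℕ) (r₁ r₂ θ : ℝ) : ℂ :=
  (dyadicCutoff β j (r₁ + r₂) : ℂ) * diffKernel α δ a ℓ r₁ r₂ θ

/-- A kernel `K(r₁, r₂; θ₁ - θ₂)` given in polar coordinates, as a function on
`ℝ² × ℝ²`, where `x = r₁ (cos θ₁, sin θ₁)` and `y = r₂ (cos θ₂, sin θ₂)`. -/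
def planeKernel (K : ℝ → ℝ → ℝ → ℂ) (x y : Plane) : ℂ :=
  K ‖x‖ ‖y‖ (polarAngle x - polarAngle y)

/-- The integral operator `T_k f(x) = ∫_{ℝ²} k(x, y) f(y) dy`; in polar coordinates
`dy = dθ₂ r₂ dr₂`. -/
def integralOperator (k : Plane → Plane → ℂ) (f : Plane → ℂ) (x : Plane) : ℂ :=
  ∫ y : Plane, k x y * f y

/-- `T_k` is a well-defined bounded operator on `L^p(ℝ²)` with operator norm at most `M`:
for each `f ∈ L^p` the integral defining `T_k f(x)` converges absolutely for almost every `x`,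
`T_k f ∈ L^p`, and `‖T_k f‖_p ≤ M ‖f‖_p`. -/
def LpNormBound (k : Plane → Plane → ℂ) (p : ℝ≥0∞) (M : ℝ) : Prop :=
  ∀ f : Plane → ℂ, MemLp f p volume →
    (∀ᵐ x : Plane, Integrable (fun y : Plane => k x y * f y) volume) ∧
    MemLp (integralOperator k f) p volume ∧
    eLpNorm (integralOperator k f) p volume ≤ ENNReal.ofReal M * eLpNorm f p volume

end DiffractiveBR

end

noncomputable section

namespace DiffractiveBR

/-! Size bounds on the kernel and Schur tests suffice; no cancellation in the radial variables is
used. Put L = 2^j and A = L^(-3/2-δ). The weights are integrable in s uniformly in θ, so the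
localized kernel is O(A), and it lives on r₁, r₂ ≤ 2L. The area L² times A is L^(1/2-δ), which is
the bound on L^∞.

The remaining gain is stationary phase at s = 0. On [0, ∞) the phase |n_s| is convex, and its second
derivative at 0 is r₁r₂/(r₁+r₂), comparable to min(r₁, r₂). Hence a nonincreasing weight of bounded
height and mass gains (1 + min(r₁, r₂))^(-1/2): see `norm_integral_exp_diffDist_le` and
`AmplitudeBound.norm_oscIntegral_le_decay`. The weight w₁ is of this kind and w₂ is a combination of
three such weights. The weight w₃ contains the conjugate Poisson kernel, whose mass is bounded but
whose height is 1/κ with κ = |cos(θ/2)|; its decay degenerates near θ = π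
(`exists_norm_oscIntegral_diffWeight_le`).

On L², the operator is a convolution in the angle, so by Parseval only Fourier coefficients matter.
The n-th coefficient of the conjugate Poisson kernel is a bounded multiple of e^(-|n|s), and it
vanishes for n = 0. As |α| < 1, e^(-|n|s) cosh(αs) is again a good weight, and the loss in κ
disappears (`AmplitudeBound.norm_integral_oscIntegral_three_le`). A radial Schur test with weight
r^(-1/2) against r dr then gives A L^(3/2) = L^(-δ) (`KernelBound.lpNormBound_two`).

On L^p, interpolating the two pointwise bounds gives A κ^(-2σ) (1 + min(r₁, r₂))^(-σ), with κ^(-2σ)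
integrable for σ < 1/2. Schur's test yields A (L^(2-2/p) + L^(2-σ)) once σp > 2
(`exists_lpNormBound` with η = 0). A σ with 2/p < σ < 1/2 exists exactly when p > 4, and then both
powers are at most L^(δ_c-δ); there is no loss for 4 < p < 6 either. At p = 4 the range of σ is
empty, and an arbitrarily small power of L is spent instead. -/

/-! ### Oscillatory integrals on an interval -/

/-- Bonnet's form of the second mean value theorem, as an inequality. -/
theorem norm_integral_mul_le_of_antitoneOn {e : ℝ → ℂ} {h : ℝ → ℝ} {a T M H : ℝ}
    (he : IntegrableOn e (Ioc a T)) (hM : ∀ t ∈ Icc a T, ‖∫ s in Ioc a t, e s‖ ≤ M)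
    (hh : AntitoneOn h (Ioc a T)) (h0 : ∀ s ∈ Ioc a T, 0 ≤ h s)
    (hH : ∀ s ∈ Ioc a T, h s ≤ H) (hH0 : 0 ≤ H) (haT : a ≤ T) :
    ‖∫ s in Ioc a T, e s * (h s : ℂ)‖ ≤ M * H := by
  -- Layer-cake formula: h(s) is the integral over u in (0, H] of the indicator of u < h(s). After
  -- Fubini, each superlevel set of the nonincreasing h is an interval starting at a, up to a null
  -- set, so the inner integral is one of the primitives bounded by M.
  have hlayer : ∀ s ∈ Ioc a T, e s * (h s : ℂ)
      = ∫ u in Ioc 0 H, indicator {p : ℝ × ℝ | p.2 < h p.1} (fun p => e p.1) (s, u) := by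
    intro s hs
    have h1 : ∀ u, indicator {p : ℝ × ℝ | p.2 < h p.1} (fun p => e p.1) (s, u)
        = (Iio (h s)).indicator (fun _ => e s) u := by
      intro u; simp [indicator]
    simp_rw [h1]
    rw [setIntegral_indicator measurableSet_Iio, setIntegral_const]
    have h2 : (Ioc 0 H ∩ Iio (h s) : Set ℝ) =ᵐ[volume] Ioc 0 (h s) := by
      have : (Ioc 0 H ∩ Iio (h s) : Set ℝ) =ᵐ[volume] Ioo 0 (h s) := by
        have : Ioc 0 H ∩ Iio (h s) = Ioo 0 (h s) := by
          ext u; have := hH s hs; simp only [mem_inter_iff, mem_Ioc, mem_Iio, mem_Ioo]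
          constructor
          · rintro ⟨⟨h1, h2⟩, h3⟩; exact ⟨h1, h3⟩
          · rintro ⟨h1, h3⟩; exact ⟨⟨h1, by linarith⟩, h3⟩
        rw [this]
        exact Filter.EventuallyEq.rfl
      exact this.trans Ioo_ae_eq_Ioc
    rw [measureReal_congr h2, Real.volume_real_Ioc_of_le (h0 s hs)]
    simp [mul_comm]
  rw [setIntegral_congr_fun measurableSet_Ioc hlayer]
  have hint : Integrable (indicator {p : ℝ × ℝ | p.2 < h p.1} (fun p => e p.1))
      ((volume.restrict (Ioc a T)).prod (volume.restrict (Ioc 0 H))) := by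
    refine Integrable.indicator₀ (Integrable.comp_fst he _) ?_
    exact nullMeasurableSet_lt measurable_snd.aemeasurable
      ((aemeasurable_restrict_of_antitoneOn measurableSet_Ioc hh).comp_fst)
  rw [integral_integral_swap (f := fun s u => indicator {p : ℝ × ℝ | p.2 < h p.1}
    (fun p => e p.1) (s, u)) hint]
  have hb : ∀ u ∈ Ioc 0 H, ‖∫ s in Ioc a T, indicator {p : ℝ × ℝ | p.2 < h p.1}
      (fun p => e p.1) (s, u)‖ ≤ M := by
    intro u _
    set S : Set ℝ := {s | s ∈ Ioc a T ∧ u < h s} with hS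
    -- Inserting a keeps the supremum meaningful, equal to a, when the superlevel set is empty.
    set t : ℝ := sSup (insert a S) with ht
    have hbdd : BddAbove (insert a S) := ⟨T, by
      rintro x (rfl | hx)
      · exact haT
      · exact hx.1.2⟩
    have hat : a ≤ t := le_csSup hbdd (mem_insert _ _)
    have htT : t ≤ T := csSup_le ⟨a, mem_insert _ _⟩ (by
      rintro x (rfl | hx)
      · exact haT
      · exact hx.1.2)
    have hsub1 : S ⊆ Ioc a t := fun s hs => ⟨hs.1.1, le_csSup hbdd (mem_insert_of_mem _ hs)⟩
    have hsub2 : Ioo a t ⊆ S := by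
      intro s hs
      obtain ⟨x, hx, hsx⟩ := exists_lt_of_lt_csSup ⟨a, mem_insert _ _⟩ hs.2
      rcases hx with rfl | hx
      · exact absurd hs.1 (not_lt.mpr hsx.le)
      · have hsI : s ∈ Ioc a T := ⟨hs.1, hsx.le.trans hx.1.2⟩
        exact ⟨hsI, hx.2.trans_le (hh hsI hx.1 hsx.le)⟩
    have hae : S =ᵐ[volume] Ioc a t := by
      refine (Filter.EventuallyLE.antisymm (Filter.Eventually.of_forall hsub1) ?_)
      exact (Ioo_ae_eq_Ioc (μ := volume) (a := a) (b := t)).symm.le.trans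
        (Filter.Eventually.of_forall hsub2)
    have heq : ∫ s in Ioc a T, indicator {p : ℝ × ℝ | p.2 < h p.1} (fun p => e p.1) (s, u)
        = ∫ s in S, e s := by
      have hSn : NullMeasurableSet S volume := measurableSet_Ioc.nullMeasurableSet.congr hae.symm
      have hST : S ⊆ Ioc a T := fun s hs => hs.1
      rw [setIntegral_congr_fun (g := S.indicator e) measurableSet_Ioc, integral_indicator₀
        (hSn.mono_ac Measure.restrict_le_self.absolutelyContinuous),
        Measure.restrict_restrict₀ (hSn.mono_ac Measure.restrict_le_self.absolutelyContinuous),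
        inter_eq_left.mpr hST]
      intro s hs
      by_cases hu : u < h s
      · have : s ∈ S := ⟨hs, hu⟩
        simp [indicator, hu, this]
      · have : s ∉ S := fun h => hu h.2
        simp [indicator, hu, this]
    rw [heq, setIntegral_congr_set hae]
    exact hM t ⟨hat, htT⟩
  have := norm_setIntegral_le_of_norm_le_const (μ := volume) (s := Ioc 0 H) (C := M)
    (by simp) hb
  simpa [Real.volume_real_Ioc_of_le hH0] using this

/-- Integration by parts against an amplitude whose variation is controlled by `-h'`. -/
theorem norm_integral_mul_le_of_hasDerivAt {e b b' : ℝ → ℂ} {h h' : ℝ → ℝ} {a T M : ℝ}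
    (he : Continuous e) (hM : ∀ t ∈ Icc a T, ‖∫ s in a..t, e s‖ ≤ M)
    (hb : ∀ s, HasDerivAt b (b' s) s) (hb' : Continuous b')
    (hh : ∀ s, HasDerivAt h (h' s) s) (hh' : Continuous h')
    (hle : ∀ s ∈ Icc a T, ‖b' s‖ ≤ -h' s) (hT : ‖b T‖ ≤ h T) (haT : a ≤ T) :
    ‖∫ s in a..T, e s * b s‖ ≤ M * h a := by
  have hE : ∀ t, HasDerivAt (fun t => ∫ s in a..t, e s) (e t) t := fun t =>
    intervalIntegral.integral_hasDerivAt_right (he.intervalIntegrable _ _)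
      he.aestronglyMeasurable.stronglyMeasurableAtFilter he.continuousAt
  have hEc : Continuous (fun t => ∫ s in a..t, e s) :=
    continuous_iff_continuousAt.mpr fun t => (hE t).continuousAt
  have hparts := intervalIntegral.integral_deriv_mul_eq_sub (a := a) (b := T)
    (u := fun t => ∫ s in a..t, e s) (v := b) (u' := e) (v' := b')
    (fun t _ => hE t) (fun t _ => hb t) (he.intervalIntegrable _ _) (hb'.intervalIntegrable _ _)
  have hbc : Continuous b := continuous_iff_continuousAt.mpr fun t => (hb t).continuousAt
  have hadd := intervalIntegral.integral_add (μ := volume) (f := fun s => e s * b s)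
    (g := fun t => (∫ s in a..t, e s) * b' t) ((he.mul hbc).intervalIntegrable a T)
    ((hEc.mul hb').intervalIntegrable a T)
  rw [hadd] at hparts
  simp only [intervalIntegral.integral_same, zero_mul, sub_zero] at hparts
  have hM0 : 0 ≤ M := (norm_nonneg _).trans (hM a ⟨le_rfl, haT⟩)
  -- The integral of -h' is h(a) - h(T), and the boundary term costs at most M h(T), so the total
  -- telescopes to M h(a).
  have h2 : ‖∫ t in a..T, (∫ s in a..t, e s) * b' t‖ ≤ ∫ t in a..T, M * (-h' t) := by
    refine intervalIntegral.norm_integral_le_of_norm_le haT ?_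
      ((continuous_const.mul hh'.neg).intervalIntegrable _ _)
    refine Filter.Eventually.of_forall fun t ht => ?_
    rw [norm_mul]
    exact mul_le_mul (hM t ⟨ht.1.le, ht.2⟩) (hle t ⟨ht.1.le, ht.2⟩) (norm_nonneg _) hM0
  have h3 : ∫ t in a..T, M * (-h' t) = M * (h a - h T) := by
    rw [intervalIntegral.integral_const_mul, intervalIntegral.integral_neg,
      intervalIntegral.integral_eq_sub_of_hasDerivAt (fun t _ => hh t)
        (hh'.intervalIntegrable _ _)]
    ring
  have h4 : ‖(∫ s in a..T, e s) * b T‖ ≤ M * h T := by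
    rw [norm_mul]
    exact mul_le_mul (hM T ⟨haT, le_rfl⟩) hT (norm_nonneg _) hM0
  have h5 : ∫ s in a..T, e s * b s
      = (∫ s in a..T, e s) * b T - ∫ t in a..T, (∫ s in a..t, e s) * b' t := by
    rw [← hparts]; ring
  rw [h5]
  calc _ ≤ M * h T + M * (h a - h T) := (norm_sub_le _ _).trans (add_le_add h4 (h2.trans h3.le))
    _ = M * h a := by ring

/-! ### The phase -/

theorem diffDist_sq {r₁ r₂ : ℝ} (h₁ : 0 ≤ r₁) (h₂ : 0 ≤ r₂) (s : ℝ) :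
    diffDist r₁ r₂ s ^ 2 = r₁ ^ 2 + r₂ ^ 2 + 2 * r₁ * r₂ * Real.cosh s := by
  unfold diffDist
  rw [Real.sq_sqrt]
  have := Real.cosh_pos s
  positivity

theorem add_le_diffDist {r₁ r₂ : ℝ} (h₁ : 0 ≤ r₁) (h₂ : 0 ≤ r₂) (s : ℝ) :
    r₁ + r₂ ≤ diffDist r₁ r₂ s := by
  apply Real.le_sqrt_of_sq_le
  nlinarith [Real.one_le_cosh s, mul_nonneg h₁ h₂]

theorem diffDist_pos {r₁ r₂ : ℝ} (h₁ : 0 < r₁) (h₂ : 0 < r₂) (s : ℝ) : 0 < diffDist r₁ r₂ s :=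
  (add_pos h₁ h₂).trans_le (add_le_diffDist h₁.le h₂.le s)

theorem hasDerivAt_diffDist {r₁ r₂ : ℝ} (h₁ : 0 < r₁) (h₂ : 0 < r₂) (s : ℝ) :
    HasDerivAt (diffDist r₁ r₂) (r₁ * r₂ * Real.sinh s / diffDist r₁ r₂ s) s := by
  have hpos := diffDist_pos h₁ h₂ s
  have hne : r₁ ^ 2 + r₂ ^ 2 + 2 * r₁ * r₂ * Real.cosh s ≠ 0 := by
    rw [← diffDist_sq h₁.le h₂.le]; positivity
  have h := (((Real.hasDerivAt_cosh s).const_mul (2 * r₁ * r₂)).const_add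
    (r₁ ^ 2 + r₂ ^ 2)).sqrt hne
  have h' : HasDerivAt (diffDist r₁ r₂) (2 * r₁ * r₂ * Real.sinh s /
    (2 * diffDist r₁ r₂ s)) s := h
  convert! h' using 1
  field_simp

theorem continuous_diffDist (r₁ r₂ : ℝ) : Continuous (diffDist r₁ r₂) := by
  unfold diffDist; fun_prop

theorem continuous_deriv_diffDist {r₁ r₂ : ℝ} (h₁ : 0 < r₁) (h₂ : 0 < r₂) :
    Continuous fun s => r₁ * r₂ * Real.sinh s / diffDist r₁ r₂ s :=
  (continuous_const.mul Real.continuous_sinh).div (continuous_diffDist r₁ r₂)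
    fun s => (diffDist_pos h₁ h₂ s).ne'

/-- This is convexity of the phase, needed so that 1/n' is nonincreasing. After squaring and
cross-multiplying, the difference of the two sides factors as cosh t - cosh s times a positive
quantity. -/
theorem monotoneOn_deriv_diffDist {r₁ r₂ : ℝ} (h₁ : 0 < r₁) (h₂ : 0 < r₂) :
    MonotoneOn (fun s => r₁ * r₂ * Real.sinh s / diffDist r₁ r₂ s) (Ici 0) := by
  intro s hs t ht hst
  have hns := diffDist_pos h₁ h₂ s
  have hnt := diffDist_pos h₁ h₂ t
  have hss : 0 ≤ Real.sinh s := Real.sinh_nonneg_iff.mpr hs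
  have hst' : 0 ≤ Real.sinh t := Real.sinh_nonneg_iff.mpr ht
  have hc : Real.cosh s ≤ Real.cosh t :=
    Real.cosh_le_cosh.mpr (by rwa [abs_of_nonneg hs, abs_of_nonneg ht])
  have key : Real.sinh s * diffDist r₁ r₂ t ≤ Real.sinh t * diffDist r₁ r₂ s := by
    apply le_of_sq_le_sq _ (by positivity)
    rw [mul_pow, mul_pow, diffDist_sq h₁.le h₂.le, diffDist_sq h₁.le h₂.le, Real.sinh_sq,
      Real.sinh_sq]
    have h1 := Real.one_le_cosh s
    have h2 := Real.one_le_cosh t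
    have e : (Real.cosh t ^ 2 - 1) * (r₁ ^ 2 + r₂ ^ 2 + 2 * r₁ * r₂ * Real.cosh s)
      - (Real.cosh s ^ 2 - 1) * (r₁ ^ 2 + r₂ ^ 2 + 2 * r₁ * r₂ * Real.cosh t)
      = (Real.cosh t - Real.cosh s) * ((r₁ ^ 2 + r₂ ^ 2) * (Real.cosh s + Real.cosh t)
        + 2 * r₁ * r₂ * (Real.cosh s * Real.cosh t + 1)) := by ring
    have : 0 ≤ (Real.cosh t - Real.cosh s) * ((r₁ ^ 2 + r₂ ^ 2) * (Real.cosh s + Real.cosh t)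
        + 2 * r₁ * r₂ * (Real.cosh s * Real.cosh t + 1)) := by
      apply mul_nonneg (by linarith)
      positivity
    linarith
  simp only
  rw [div_le_div_iff₀ hns hnt]
  nlinarith [mul_pos h₁ h₂]

/-- The exponential integral without amplitude has stationary phase decay. -/
theorem norm_integral_exp_diffDist_le {r₁ r₂ ρ : ℝ} (hρ : 1 ≤ ρ) (h₁ : ρ ≤ r₁) (h₂ : ρ ≤ r₂)
    {T : ℝ} (hT : 0 ≤ T) :
    ‖∫ s in (0 : ℝ)..T, Complex.exp (Complex.I * (diffDist r₁ r₂ s : ℂ))‖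
      ≤ 9 * ρ ^ (-(1 / 2) : ℝ) := by
  have hρ0 : 0 < ρ := by linarith
  have p₁ : 0 < r₁ := by linarith
  have p₂ : 0 < r₂ := by linarith
  set n := diffDist r₁ r₂ with hn
  set n' : ℝ → ℝ := fun s => r₁ * r₂ * Real.sinh s / n s with hn'
  -- The stationary region [0, τ] is bounded by its length. Beyond τ one has n' ≥ ρτ/4 = 1/(4τ),
  -- because ρτ² = 1; Bonnet's inequality with the weight 1/n' then gives 2 · 4τ. The sum is 9τ.
  set τ : ℝ := ρ ^ (-(1 / 2) : ℝ) with hτ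
  have hτ0 : 0 < τ := Real.rpow_pos_of_pos hρ0 _
  have hτ1 : τ ≤ 1 := Real.rpow_le_one_of_one_le_of_nonpos hρ (by norm_num)
  have hτsq : ρ * τ * τ = 1 := by
    rw [hτ, mul_assoc, ← Real.rpow_add hρ0]
    norm_num
    rw [Real.rpow_neg_one]; field_simp
  have hec : Continuous fun s => Complex.exp (Complex.I * (n s : ℂ)) := by
    have := continuous_diffDist r₁ r₂
    fun_prop
  have hnorm : ∀ s, ‖Complex.exp (Complex.I * (n s : ℂ))‖ = 1 := fun s => by
    rw [mul_comm]; exact Complex.norm_exp_ofReal_mul_I _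
  have htriv : ∀ a b : ℝ, a ≤ b → ‖∫ s in a..b, Complex.exp (Complex.I * (n s : ℂ))‖ ≤ b - a := by
    intro a b hab
    have := intervalIntegral.norm_integral_le_of_norm_le_const (a := a) (b := b) (C := 1)
      (f := fun s => Complex.exp (Complex.I * (n s : ℂ))) (fun s _ => (hnorm s).le)
    rwa [abs_of_nonneg (by linarith), one_mul] at this
  rcases le_total T τ with hTτ | hTτ
  · have := htriv 0 T hT
    linarith
  -- As τ ≤ 1, cosh τ ≤ 4 and hence n(τ) ≤ 2(r₁ + r₂), while r₁, r₂ ≥ ρ gives r₁r₂/(r₁ + r₂) ≥ ρ/2.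
  have hn'τ : ρ * τ / 4 ≤ n' τ := by
    have hcosh : Real.cosh τ ≤ 4 := by
      have h1 : Real.cosh τ ≤ Real.cosh 1 :=
        Real.cosh_le_cosh.mpr (by rwa [abs_of_pos hτ0, abs_one])
      have h2 : Real.cosh 1 ≤ 4 := by
        rw [Real.cosh_eq]
        have := Real.exp_one_lt_d9
        have h3 : Real.exp (-1) ≤ 1 := Real.exp_le_one_iff.mpr (by norm_num)
        linarith
      linarith
    have hnτ : n τ ≤ 2 * (r₁ + r₂) := by
      apply le_of_sq_le_sq _ (by positivity)
      rw [hn, diffDist_sq p₁.le p₂.le]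
      nlinarith [mul_pos p₁ p₂, sq_nonneg r₁, sq_nonneg r₂]
    have hsinh : τ ≤ Real.sinh τ := Real.self_le_sinh_iff.mpr hτ0.le
    have hpos : 0 < n τ := diffDist_pos p₁ p₂ τ
    rw [hn', le_div_iff₀ hpos]
    have h3 : ρ * (r₁ + r₂) ≤ 2 * (r₁ * r₂) := by nlinarith
    calc ρ * τ / 4 * n τ ≤ ρ * τ / 4 * (2 * (r₁ + r₂)) := by gcongr
      _ = (ρ * (r₁ + r₂)) * τ / 2 := by ring
      _ ≤ 2 * (r₁ * r₂) * τ / 2 := by gcongr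
      _ = r₁ * r₂ * τ := by ring
      _ ≤ r₁ * r₂ * Real.sinh τ := by gcongr
  have hn'pos : ∀ s ∈ Icc τ T, 0 < n' s := fun s hs =>
    (by positivity : 0 < ρ * τ / 4).trans_le (hn'τ.trans
      (monotoneOn_deriv_diffDist p₁ p₂ hτ0.le (hτ0.le.trans hs.1) hs.1))
  have hn'c : Continuous n' := continuous_deriv_diffDist p₁ p₂
  have hprim : ∀ t ∈ Icc τ T,
      -- The integrand has the primitive -i e^(in), of modulus 1.
      ‖∫ s in Ioc τ t, Complex.exp (Complex.I * (n s : ℂ)) * (n' s : ℂ)‖ ≤ 2 := by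
    intro t ht
    have hd : ∀ s, HasDerivAt (fun s => -Complex.I * Complex.exp (Complex.I * (n s : ℂ)))
        (Complex.exp (Complex.I * (n s : ℂ)) * (n' s : ℂ)) s := by
      intro s
      have h := ((((hasDerivAt_diffDist p₁ p₂ s).ofReal_comp).const_mul Complex.I).cexp).const_mul
        (-Complex.I)
      convert! h using 1
      linear_combination ((Complex.exp (Complex.I * (n s : ℂ)) * (n' s : ℂ))) * Complex.I_mul_I
    rw [← intervalIntegral.integral_of_le ht.1,
      intervalIntegral.integral_eq_sub_of_hasDerivAt (fun s _ => hd s)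
      ((hec.mul (Complex.continuous_ofReal.comp hn'c)).intervalIntegrable _ _)]
    refine (norm_sub_le _ _).trans ?_
    rw [norm_mul, norm_mul, hnorm, hnorm]
    norm_num
  have htail : ‖∫ s in τ..T, Complex.exp (Complex.I * (n s : ℂ))‖ ≤ 8 * τ := by
    have hB := norm_integral_mul_le_of_antitoneOn (a := τ) (T := T)
      (e := fun s => Complex.exp (Complex.I * (n s : ℂ)) * (n' s : ℂ)) (h := fun s => (n' s)⁻¹)
      (M := 2) (H := 4 * τ)
      ((hec.mul (Complex.continuous_ofReal.comp hn'c)).integrableOn_Ioc) hprim ?_ ?_ ?_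
      (by positivity) hTτ
    · rw [intervalIntegral.integral_of_le hTτ]
      rw [setIntegral_congr_fun (g := fun s => Complex.exp (Complex.I * (n s : ℂ)) * (n' s : ℂ)
        * (((n' s)⁻¹ : ℝ) : ℂ)) measurableSet_Ioc]
      · refine hB.trans (by linarith)
      · intro s hs
        have : (n' s : ℂ) ≠ 0 := by exact_mod_cast (hn'pos s ⟨hs.1.le, hs.2⟩).ne'
        simp only [Complex.ofReal_inv]
        field_simp
    · intro s hs t ht hst
      exact inv_anti₀ (hn'pos s ⟨hs.1.le, hs.2⟩)
        (monotoneOn_deriv_diffDist p₁ p₂ (hτ0.le.trans hs.1.le) (hτ0.le.trans ht.1.le) hst)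
    · intro s hs
      exact (inv_pos.mpr (hn'pos s ⟨hs.1.le, hs.2⟩)).le
    · intro s hs
      have h1 : n' τ ≤ n' s :=
        monotoneOn_deriv_diffDist p₁ p₂ hτ0.le (hτ0.le.trans hs.1.le) hs.1.le
      have h2 : (4 * τ)⁻¹ ≤ n' s := by
        have : (4 * τ)⁻¹ = ρ * τ / 4 := by
          field_simp; linarith
        linarith
      exact inv_le_of_inv_le₀ (by positivity) h2
  have hsplit := intervalIntegral.integral_add_adjacent_intervals (μ := volume)
    (hec.intervalIntegrable 0 τ) (hec.intervalIntegrable τ T)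
  rw [← hsplit]
  have := htriv 0 τ hτ0.le
  refine (norm_add_le _ _).trans ?_
  linarith

/-! ### The oscillating amplitude -/

/-- The factor of the integrand that does not depend on the weight, as a function of `|n_s|`. -/
def oscAmplitude (δ : ℝ) (a : ℝ → ℂ) (x : ℝ) : ℂ :=
  (((1 + x) ^ (-(3 / 2) - δ) : ℝ) : ℂ) * a x

theorem diffIntegrand_eq (α δ : ℝ) (a : ℝ → ℂ) (ℓ : ℕ) (r₁ r₂ θ s : ℝ) :
    diffIntegrand α δ a ℓ r₁ r₂ θ s
      = Complex.exp (Complex.I * (diffDist r₁ r₂ s : ℂ)) * oscAmplitude δ a (diffDist r₁ r₂ s)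
        * (diffWeight α θ s ℓ : ℂ) := by
  unfold diffIntegrand oscAmplitude; ring

/-- Symbol bounds for the amplitude, with a common constant. -/
structure AmplitudeBound (δ C : ℝ) (B B' : ℝ → ℂ) : Prop where
  pos : 0 < C
  norm_le : ∀ x, 0 < x → ‖B x‖ ≤ C * (1 + x) ^ (-(3 / 2) - δ)
  hasDerivAt : ∀ x, 0 < x → HasDerivAt B (B' x) x
  continuousOn : ContinuousOn B' (Ioi 0)
  norm_deriv_le : ∀ x, 1 ≤ x → ‖B' x‖ ≤ C * ((3 / 2 + δ) * (1 + x) ^ (-(3 / 2) - δ - 1))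

theorem IsAmplitude.exists_amplitudeBound {δ : ℝ} {a : ℝ → ℂ} (ha : IsAmplitude a) (hδ : 0 ≤ δ) :
    ∃ C B', AmplitudeBound δ C (oscAmplitude δ a) B' := by
  obtain ⟨C₀, hC₀⟩ := ha.bound 0
  obtain ⟨C₁, hC₁⟩ := ha.bound 1
  simp only [iteratedDeriv_zero, pow_zero, inv_one, mul_one] at hC₀
  simp only [iteratedDeriv_one, pow_one] at hC₁
  have hC₀0 : 0 ≤ C₀ := (norm_nonneg _).trans (hC₀ 1 one_pos)
  have hC₁0 : 0 ≤ C₁ := by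
    have := (norm_nonneg _).trans (hC₁ 1 one_pos); simpa using this
  have had : ∀ x, 0 < x → HasDerivAt a (deriv a x) x := fun x hx =>
    ((ha.smooth.differentiableOn (by simp)).differentiableAt (Ioi_mem_nhds hx)).hasDerivAt
  have hadc : ContinuousOn (deriv a) (Ioi 0) :=
    ha.smooth.continuousOn_deriv_of_isOpen isOpen_Ioi (by simp)
  -- The factor 2 comes from 1 + x ≤ 2x, which is why the derivative bound is restricted to x ≥ 1;
  -- the summand 1 makes the constant positive.
  refine ⟨C₀ + 2 * C₁ + 1, fun x => (((-(3 / 2) - δ) * (1 + x) ^ (-(3 / 2) - δ - 1) : ℝ) : ℂ) * a x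
    + (((1 + x) ^ (-(3 / 2) - δ) : ℝ) : ℂ) * deriv a x, by positivity, ?_, ?_, ?_, ?_⟩
  · intro x hx
    have hp : 0 < (1 + x) ^ (-(3 / 2) - δ) := Real.rpow_pos_of_pos (by linarith) _
    unfold oscAmplitude
    rw [norm_mul, Complex.norm_real, Real.norm_of_nonneg hp.le, mul_comm]
    gcongr
    linarith [hC₀ x hx]
  · intro x hx
    have h1 : HasDerivAt (fun y : ℝ => (1 + y) ^ (-(3 / 2) - δ))
        ((-(3 / 2) - δ) * (1 + x) ^ (-(3 / 2) - δ - 1)) x := by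
      have := ((hasDerivAt_id x).const_add 1).rpow_const (p := -(3 / 2) - δ)
        (Or.inl (by simp; linarith))
      simpa using this
    exact h1.ofReal_comp.mul (had x hx)
  · have hne : ∀ x ∈ Ioi (0 : ℝ), 1 + x ≠ 0 ∨ (0 : ℝ) ≤ -1 := fun x hx => by
      left; have := mem_Ioi.mp hx; linarith
    have hc : ∀ t : ℝ, ContinuousOn (fun x : ℝ => (1 + x) ^ t) (Ioi 0) := fun t =>
      ContinuousOn.rpow_const (by fun_prop) fun x hx => by
        left; have := mem_Ioi.mp hx; linarith
    have hac : ContinuousOn a (Ioi 0) := ha.smooth.continuousOn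
    refine ContinuousOn.add (ContinuousOn.mul ?_ hac) (ContinuousOn.mul ?_ hadc)
    · exact Complex.continuous_ofReal.comp_continuousOn (continuousOn_const.mul (hc _))
    · exact Complex.continuous_ofReal.comp_continuousOn (hc _)
  · intro x hx
    have hx0 : 0 < x := by linarith
    have hp : 0 < (1 + x) ^ (-(3 / 2) - δ - 1) := Real.rpow_pos_of_pos (by linarith) _
    have hq : 0 < (1 + x) ^ (-(3 / 2) - δ) := Real.rpow_pos_of_pos (by linarith) _
    have hpq : (1 + x) ^ (-(3 / 2) - δ) = (1 + x) ^ (-(3 / 2) - δ - 1) * (1 + x) := by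
      rw [← Real.rpow_add_one (by linarith)]; ring_nf
    refine (norm_add_le _ _).trans ?_
    rw [norm_mul, norm_mul, Complex.norm_real, Complex.norm_real, Real.norm_of_nonneg hq.le,
      norm_mul, Real.norm_of_nonneg hp.le, Real.norm_eq_abs,
      show |(-(3 / 2) - δ)| = 3 / 2 + δ by rw [abs_of_neg (by linarith)]; ring, hpq]
    set P := (1 + x) ^ (-(3 / 2) - δ - 1)
    have h1 : ‖deriv a x‖ * (1 + x) ≤ 2 * C₁ := by
      calc ‖deriv a x‖ * (1 + x) ≤ C₁ * x⁻¹ * (2 * x) := by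
            gcongr
            · exact hC₁ x hx0
            · linarith
        _ = 2 * C₁ := by field_simp
    have h2 := hC₀ x hx0
    calc (3 / 2 + δ) * P * ‖a x‖ + P * (1 + x) * ‖deriv a x‖
        = P * ((3 / 2 + δ) * ‖a x‖ + ‖deriv a x‖ * (1 + x)) := by ring
      _ ≤ P * ((3 / 2 + δ) * C₀ + (3 / 2 + δ) * (2 * C₁)) := by
          refine mul_le_mul_of_nonneg_left (add_le_add ?_ ?_) hp.le
          · gcongr
          · nlinarith
      _ ≤ (C₀ + 2 * C₁ + 1) * ((3 / 2 + δ) * P) := by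
          have : 0 ≤ (3 / 2 + δ) * P := by positivity
          nlinarith

namespace AmplitudeBound

variable {δ C : ℝ} {B B' : ℝ → ℂ}

theorem continuous_comp_diffDist (hB : AmplitudeBound δ C B B') {r₁ r₂ : ℝ} (h₁ : 0 < r₁)
    (h₂ : 0 < r₂) : Continuous fun s => B (diffDist r₁ r₂ s) :=
  continuous_iff_continuousAt.mpr fun s => ContinuousAt.comp (g := B)
    (hB.hasDerivAt _ (diffDist_pos h₁ h₂ s)).continuousAt (continuous_diffDist r₁ r₂).continuousAt

theorem continuous_osc (hB : AmplitudeBound δ C B B') {r₁ r₂ : ℝ} (h₁ : 0 < r₁)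
    (h₂ : 0 < r₂) : Continuous fun s =>
      Complex.exp (Complex.I * (diffDist r₁ r₂ s : ℂ)) * B (diffDist r₁ r₂ s) := by
  have := continuous_diffDist r₁ r₂
  exact Continuous.mul (by fun_prop) (hB.continuous_comp_diffDist h₁ h₂)

theorem norm_osc_le (hB : AmplitudeBound δ C B B') (hδ : 0 ≤ δ) {r₁ r₂ : ℝ} (h₁ : 0 < r₁)
    (h₂ : 0 < r₂) (s : ℝ) :
    ‖Complex.exp (Complex.I * (diffDist r₁ r₂ s : ℂ)) * B (diffDist r₁ r₂ s)‖
      ≤ C * (1 + (r₁ + r₂)) ^ (-(3 / 2) - δ) := by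
  rw [norm_mul, mul_comm Complex.I, Complex.norm_exp_ofReal_mul_I, one_mul]
  refine (hB.norm_le _ (diffDist_pos h₁ h₂ s)).trans ?_
  have := add_le_diffDist h₁.le h₂.le s
  exact mul_le_mul_of_nonneg_left (Real.rpow_le_rpow_of_nonpos (by linarith) (by linarith)
    (by linarith)) hB.pos.le

theorem integrableOn_osc_mul (hB : AmplitudeBound δ C B B') (hδ : 0 ≤ δ) {r₁ r₂ : ℝ}
    (h₁ : 0 < r₁) (h₂ : 0 < r₂) {w : ℝ → ℝ} (hw : IntegrableOn w (Ioi 0)) :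
    IntegrableOn (fun s => Complex.exp (Complex.I * (diffDist r₁ r₂ s : ℂ))
      * B (diffDist r₁ r₂ s) * (w s : ℂ)) (Ioi 0) :=
  Integrable.bdd_mul (hw.ofReal (𝕜 := ℂ)) (hB.continuous_osc h₁ h₂).aestronglyMeasurable
    (Filter.Eventually.of_forall fun s => hB.norm_osc_le hδ h₁ h₂ s)

theorem norm_integral_osc_mul_le (hB : AmplitudeBound δ C B B') (hδ : 0 ≤ δ) {r₁ r₂ : ℝ}
    (h₁ : 0 < r₁) (h₂ : 0 < r₂) {w : ℝ → ℝ} (hw : IntegrableOn w (Ioi 0)) :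
    ‖∫ s in Ioi (0 : ℝ), Complex.exp (Complex.I * (diffDist r₁ r₂ s : ℂ))
      * B (diffDist r₁ r₂ s) * (w s : ℂ)‖
      ≤ C * (1 + (r₁ + r₂)) ^ (-(3 / 2) - δ) * ∫ s in Ioi (0 : ℝ), |w s| := by
  rw [← integral_const_mul]
  refine norm_integral_le_of_norm_le (hw.norm.const_mul _) (Filter.Eventually.of_forall fun s => ?_)
  rw [norm_mul, Complex.norm_real, Real.norm_eq_abs]
  exact mul_le_mul_of_nonneg_right (hB.norm_osc_le hδ h₁ h₂ s) (abs_nonneg _)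

/-- The bound on `B'` is exactly minus the derivative of the majorant C(1 + x)^(-3/2-δ) of `B`, and
|n_s| increases with s. Integration by parts therefore telescopes, and the amplitude costs only its
majorant at s = 0, where |n_s| = r₁ + r₂. Uniformity in T is what Bonnet's inequality requires next.
-/
theorem norm_intervalIntegral_osc_le (hB : AmplitudeBound δ C B B') {r₁ r₂ ρ : ℝ} (hρ : 1 ≤ ρ) (h₁ : ρ ≤ r₁) (h₂ : ρ ≤ r₂) {T : ℝ} (hT : 0 ≤ T) :
    ‖∫ s in (0 : ℝ)..T, Complex.exp (Complex.I * (diffDist r₁ r₂ s : ℂ))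
      * B (diffDist r₁ r₂ s)‖
      ≤ 9 * ρ ^ (-(1 / 2) : ℝ) * (C * (1 + (r₁ + r₂)) ^ (-(3 / 2) - δ)) := by
  have p₁ : 0 < r₁ := by linarith
  have p₂ : 0 < r₂ := by linarith
  have hnc := continuous_diffDist r₁ r₂
  have hn1 : ∀ s, 1 ≤ diffDist r₁ r₂ s := fun s => by
    have := add_le_diffDist p₁.le p₂.le s
    linarith
  have hn'c := continuous_deriv_diffDist p₁ p₂
  have hpc : Continuous fun s => (1 + diffDist r₁ r₂ s) ^ (-(3 / 2) - δ - 1) :=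
    Continuous.rpow_const (by fun_prop) fun s => by left; linarith [hn1 s]
  have h := norm_integral_mul_le_of_hasDerivAt (a := 0) (T := T) (M := 9 * ρ ^ (-(1 / 2) : ℝ))
    (e := fun s => Complex.exp (Complex.I * (diffDist r₁ r₂ s : ℂ)))
    (b := fun s => B (diffDist r₁ r₂ s))
    (b' := fun s => (r₁ * r₂ * Real.sinh s / diffDist r₁ r₂ s) • B' (diffDist r₁ r₂ s))
    (h := fun s => C * (1 + diffDist r₁ r₂ s) ^ (-(3 / 2) - δ))
    (h' := fun s => C * (r₁ * r₂ * Real.sinh s / diffDist r₁ r₂ s * (-(3 / 2) - δ)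
      * (1 + diffDist r₁ r₂ s) ^ (-(3 / 2) - δ - 1)))
    (by fun_prop) (fun t ht => norm_integral_exp_diffDist_le hρ h₁ h₂ ht.1)
    (fun s => (hB.hasDerivAt _ (diffDist_pos p₁ p₂ s)).scomp s (hasDerivAt_diffDist p₁ p₂ s))
    (hn'c.smul (hB.continuousOn.comp_continuous hnc (fun s => diffDist_pos p₁ p₂ s)))
    (fun s => (((hasDerivAt_diffDist p₁ p₂ s).const_add 1).rpow_const
      (Or.inl (by linarith [hn1 s]))).const_mul C)
    (continuous_const.mul ((hn'c.mul continuous_const).mul hpc)) ?_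
    (hB.norm_le _ (diffDist_pos p₁ p₂ T)) hT
  · refine h.trans (le_of_eq ?_)
    have : diffDist r₁ r₂ 0 = r₁ + r₂ := by
      unfold diffDist
      rw [Real.cosh_zero, show r₁ ^ 2 + r₂ ^ 2 + 2 * r₁ * r₂ * 1 = (r₁ + r₂) ^ 2 by ring,
        Real.sqrt_sq (by linarith)]
    simp only [this]
  · intro s hs
    have hn'0 : 0 ≤ r₁ * r₂ * Real.sinh s / diffDist r₁ r₂ s := by
      have := Real.sinh_nonneg_iff.mpr hs.1
      have := diffDist_pos p₁ p₂ s
      positivity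
    rw [norm_smul, Real.norm_of_nonneg hn'0]
    calc _ ≤ r₁ * r₂ * Real.sinh s / diffDist r₁ r₂ s *
          (C * ((3 / 2 + δ) * (1 + diffDist r₁ r₂ s) ^ (-(3 / 2) - δ - 1))) := by
          gcongr
          exact hB.norm_deriv_le _ (hn1 s)
      _ = _ := by ring

/-- Stationary phase decay against a nonincreasing weight. -/
theorem norm_integral_osc_mul_le_of_antitoneOn (hB : AmplitudeBound δ C B B') (hδ : 0 ≤ δ)
    {r₁ r₂ ρ : ℝ} (hρ : 1 ≤ ρ) (h₁ : ρ ≤ r₁) (h₂ : ρ ≤ r₂) {w : ℝ → ℝ} {H : ℝ}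
    (hw : IntegrableOn w (Ioi 0)) (hanti : AntitoneOn w (Ioi 0)) (hw0 : ∀ s, 0 < s → 0 ≤ w s)
    (hwH : ∀ s, 0 < s → w s ≤ H) :
    ‖∫ s in Ioi (0 : ℝ), Complex.exp (Complex.I * (diffDist r₁ r₂ s : ℂ))
      * B (diffDist r₁ r₂ s) * (w s : ℂ)‖
      ≤ 9 * ρ ^ (-(1 / 2) : ℝ) * (C * (1 + (r₁ + r₂)) ^ (-(3 / 2) - δ)) * H := by
  have p₁ : 0 < r₁ := by linarith
  have p₂ : 0 < r₂ := by linarith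
  have hint := hB.integrableOn_osc_mul hδ p₁ p₂ hw
  -- Bonnet's inequality on (0, T] is uniform in T, so it passes to the limit.
  refine le_of_tendsto (intervalIntegral_tendsto_integral_Ioi 0 hint Filter.tendsto_id).norm ?_
  filter_upwards [Filter.eventually_ge_atTop 0] with T hT
  rw [id, intervalIntegral.integral_of_le hT]
  refine norm_integral_mul_le_of_antitoneOn (hB.continuous_osc p₁ p₂).integrableOn_Ioc ?_
    (hanti.mono fun s hs => hs.1) (fun s hs => hw0 s hs.1) (fun s hs => hwH s hs.1)
    ((hw0 1 one_pos).trans (hwH 1 one_pos)) hT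
  intro t ht
  rw [← intervalIntegral.integral_of_le ht.1]
  exact hB.norm_intervalIntegral_osc_le hρ h₁ h₂ ht.1

end AmplitudeBound

/-! ### Nonincreasing integrable weights -/

/-- Nonincreasing weights on `(0, ∞)` with values in `[0, H]` and integral at most `I`. -/
structure DecayingWeight (w : ℝ → ℝ) (H I : ℝ) : Prop where
  integrableOn : IntegrableOn w (Ioi 0)
  antitoneOn : AntitoneOn w (Ioi 0)
  nonneg : ∀ s, 0 < s → 0 ≤ w s
  le : ∀ s, 0 < s → w s ≤ H
  integral_le : ∫ s in Ioi (0 : ℝ), w s ≤ I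

theorem aestronglyMeasurable_of_antitoneOn {w : ℝ → ℝ} (h : AntitoneOn w (Ioi 0)) :
    AEStronglyMeasurable w (volume.restrict (Ioi 0)) :=
  (aemeasurable_restrict_of_antitoneOn measurableSet_Ioi h).aestronglyMeasurable

namespace DecayingWeight

variable {w v : ℝ → ℝ} {H I H' I' : ℝ}

theorem of_le (hv : IntegrableOn v (Ioi 0)) (hI : ∫ s in Ioi (0 : ℝ), v s ≤ I)
    (hanti : AntitoneOn w (Ioi 0)) (h0 : ∀ s, 0 < s → 0 ≤ w s) (hH : ∀ s, 0 < s → w s ≤ H)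
    (hle : ∀ s, 0 < s → w s ≤ v s) : DecayingWeight w H I := by
  have hint : IntegrableOn w (Ioi 0) := by
    refine Integrable.mono' hv (aestronglyMeasurable_of_antitoneOn hanti) ?_
    filter_upwards [ae_restrict_mem measurableSet_Ioi] with s hs
    rw [Real.norm_of_nonneg (h0 s hs)]
    exact hle s hs
  exact ⟨hint, hanti, h0, hH,
    (setIntegral_mono_on hint hv measurableSet_Ioi fun s hs => hle s hs).trans hI⟩

theorem setIntegral_abs (hw : DecayingWeight w H I) :
    ∫ s in Ioi (0 : ℝ), |w s| = ∫ s in Ioi (0 : ℝ), w s :=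
  setIntegral_congr_fun measurableSet_Ioi fun s hs => abs_of_nonneg (hw.nonneg s hs)

theorem bound_nonneg (hw : DecayingWeight w H I) : 0 ≤ H :=
  (hw.nonneg 1 one_pos).trans (hw.le 1 one_pos)

theorem integral_nonneg (hw : DecayingWeight w H I) : 0 ≤ ∫ s in Ioi (0 : ℝ), w s :=
  setIntegral_nonneg measurableSet_Ioi fun s hs => hw.nonneg s hs

end DecayingWeight

/-- For ρ ≥ 1 stationary phase costs the height H. For ρ ≤ 1 there is nothing to gain, since (1 +
ρ)^(-1/2) ≥ 1/2, and the absolute bound costs the mass I. Hence H + I, with 18 = 9 · 2. -/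
theorem AmplitudeBound.norm_integral_osc_mul_le_of_decayingWeight {δ C : ℝ} {B B' : ℝ → ℂ}
    (hB : AmplitudeBound δ C B B') (hδ : 0 ≤ δ) {r₁ r₂ ρ : ℝ} (hρ : 0 < ρ) (h₁ : ρ ≤ r₁)
    (h₂ : ρ ≤ r₂) {w : ℝ → ℝ} {H I : ℝ} (hw : DecayingWeight w H I) :
    ‖∫ s in Ioi (0 : ℝ), Complex.exp (Complex.I * (diffDist r₁ r₂ s : ℂ))
      * B (diffDist r₁ r₂ s) * (w s : ℂ)‖
      ≤ C * (1 + (r₁ + r₂)) ^ (-(3 / 2) - δ) * (1 + ρ) ^ (-(1 / 2) : ℝ) * (18 * (H + I)) := by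
  have hH := hw.bound_nonneg
  have hI : 0 ≤ I := hw.integral_nonneg.trans hw.integral_le
  have hP : 0 < (1 + (r₁ + r₂)) ^ (-(3 / 2) - δ) := Real.rpow_pos_of_pos (by linarith) _
  have hQ : 0 < (1 + ρ) ^ (-(1 / 2) : ℝ) := Real.rpow_pos_of_pos (by linarith) _
  have hC := hB.pos
  have h2 : (1 : ℝ) / 2 ≤ 2 ^ (-(1 / 2) : ℝ) := by
    rw [one_div, ← Real.rpow_neg_one]
    exact Real.rpow_le_rpow_of_exponent_le (by norm_num) (by norm_num)
  set P := (1 + (r₁ + r₂)) ^ (-(3 / 2) - δ)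
  set Q := (1 + ρ) ^ (-(1 / 2) : ℝ) with hQdef
  rcases le_total 1 ρ with hρ1 | hρ1
  · refine (hB.norm_integral_osc_mul_le_of_antitoneOn hδ hρ1 h₁ h₂ hw.integrableOn hw.antitoneOn
      hw.nonneg hw.le).trans ?_
    have hρQ : ρ ^ (-(1 / 2) : ℝ) ≤ 2 * Q := by
      have h3 : (2 * ρ) ^ (-(1 / 2) : ℝ) ≤ Q :=
        Real.rpow_le_rpow_of_nonpos (by linarith) (by linarith) (by norm_num)
      rw [Real.mul_rpow (by norm_num) hρ.le] at h3
      have h4 : 0 < ρ ^ (-(1 / 2) : ℝ) := Real.rpow_pos_of_pos hρ _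
      nlinarith
    calc 9 * ρ ^ (-(1 / 2) : ℝ) * (C * P) * H ≤ 9 * (2 * Q) * (C * P) * (H + I) := by
          gcongr
          linarith
      _ = _ := by ring
  · refine (hB.norm_integral_osc_mul_le hδ (by linarith) (by linarith) hw.integrableOn).trans ?_
    rw [hw.setIntegral_abs]
    have hQ2 : 1 ≤ 2 * Q := by
      have h3 : (2 : ℝ) ^ (-(1 / 2) : ℝ) ≤ Q :=
        Real.rpow_le_rpow_of_nonpos (by linarith) (by linarith) (by norm_num)
      linarith
    calc C * P * (∫ s in Ioi (0 : ℝ), w s) ≤ C * P * (2 * Q * (9 * (H + I))) := by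
          gcongr
          have := hw.integral_le
          nlinarith
      _ = _ := by ring

/-! ### Hyperbolic quotients -/

/-- The product-to-sum formula turns cosh(αt) cosh s ≤ cosh(αs) cosh t into a comparison of |αt ± s|
with |αs ± t|; for negative α the two terms on one side are exchanged. -/
theorem antitoneOn_cosh_div_cosh {α : ℝ} (hα : |α| < 1) :
    AntitoneOn (fun s => Real.cosh (α * s) / Real.cosh s) (Ici 0) := by
  intro s hs t ht hst
  obtain ⟨h1, h2⟩ := abs_lt.mp hα
  simp only [mem_Ici] at hs ht
  simp only
  rw [div_le_div_iff₀ (Real.cosh_pos _) (Real.cosh_pos _)]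
  have e1 : Real.cosh (α * t + s) + Real.cosh (α * t - s)
      ≤ Real.cosh (α * s + t) + Real.cosh (α * s - t) := by
    rcases le_total 0 α with h | h
    · refine add_le_add (Real.cosh_le_cosh.mpr ?_) (Real.cosh_le_cosh.mpr ?_)
      · rw [abs_of_nonneg (by positivity), abs_of_nonneg (by positivity)]; nlinarith
      · rw [abs_of_nonpos (a := α * s - t) (by nlinarith), abs_le]
        constructor <;> nlinarith
    · rw [add_comm (Real.cosh (α * t + s)), add_comm (Real.cosh (α * s + t))]
      refine add_le_add (Real.cosh_le_cosh.mpr ?_) (Real.cosh_le_cosh.mpr ?_)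
      · rw [abs_of_nonpos (by nlinarith), abs_of_nonpos (by nlinarith)]; nlinarith
      · rw [abs_of_nonneg (a := α * s + t) (by nlinarith), abs_le]
        constructor <;> nlinarith
  rw [Real.cosh_add, Real.cosh_add, Real.cosh_sub, Real.cosh_sub] at e1
  linarith

theorem cosh_div_cosh_le {α s : ℝ} (hs : 0 ≤ s) :
    Real.cosh (α * s) / Real.cosh s ≤ 2 * Real.exp (-(1 - |α|) * s) := by
  rw [div_le_iff₀ (Real.cosh_pos _)]
  have h1 : Real.cosh (α * s) ≤ Real.exp (|α| * s) := by
    rw [← Real.cosh_abs, abs_mul, abs_of_nonneg hs, Real.cosh_eq]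
    have : Real.exp (-(|α| * s)) ≤ Real.exp (|α| * s) :=
      Real.exp_le_exp.mpr (by have := mul_nonneg (abs_nonneg α) hs; linarith)
    linarith
  have h2 : Real.exp s ≤ 2 * Real.cosh s := by
    rw [Real.cosh_eq]; have := Real.exp_pos (-s); linarith
  calc Real.cosh (α * s) ≤ Real.exp (-(1 - |α|) * s) * Real.exp s := by
        rw [← Real.exp_add]; convert h1 using 2; ring
    _ ≤ Real.exp (-(1 - |α|) * s) * (2 * Real.cosh s) := by gcongr
    _ = _ := by ring

theorem cosh_div_cosh_le_one {α s : ℝ} (hα : |α| < 1) :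
    Real.cosh (α * s) / Real.cosh s ≤ 1 := by
  rw [div_le_one (Real.cosh_pos _), Real.cosh_le_cosh, abs_mul]
  have := abs_nonneg s
  nlinarith

/-- By the subtraction formula this is sinh((1 - α)s) ≥ 0. -/
theorem sinh_div_sinh_le_cosh_div_cosh {α s : ℝ} (h1 : α < 1) (hs : 0 < s) :
    Real.sinh (α * s) / Real.sinh s ≤ Real.cosh (α * s) / Real.cosh s := by
  rw [div_le_div_iff₀ (Real.sinh_pos_iff.mpr hs) (Real.cosh_pos _)]
  have : 0 ≤ Real.sinh (s - α * s) := Real.sinh_nonneg_iff.mpr (by nlinarith)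
  rw [Real.sinh_sub] at this
  linarith

/-- The numerator of the derivative vanishes at 0, and its own derivative is (α² - 1) sinh(αs) sinh
s ≤ 0. -/
theorem antitoneOn_sinh_div_sinh {α : ℝ} (h0 : 0 ≤ α) (h1 : α < 1) :
    AntitoneOn (fun s => Real.sinh (α * s) / Real.sinh s) (Ioi 0) := by
  have hD : AntitoneOn (fun s => α * Real.cosh (α * s) * Real.sinh s
      - Real.sinh (α * s) * Real.cosh s) (Ici 0) := by
    have hd : ∀ s, HasDerivAt (fun s => α * Real.cosh (α * s) * Real.sinh s
      - Real.sinh (α * s) * Real.cosh s) ((α ^ 2 - 1) * Real.sinh (α * s) * Real.sinh s) s := by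
      intro s
      have hl : HasDerivAt (fun s => α * s) α s := by simpa using (hasDerivAt_id s).const_mul α
      have hA := ((hl.cosh.const_mul α).mul (Real.hasDerivAt_sinh s)).sub
        (hl.sinh.mul (Real.hasDerivAt_cosh s))
      convert! hA using 1
      ring
    refine antitoneOn_of_deriv_nonpos (convex_Ici 0)
      (fun s _ => (hd s).continuousAt.continuousWithinAt)
      (fun s _ => (hd s).differentiableAt.differentiableWithinAt) fun s hs => ?_
    rw [interior_Ici] at hs
    rw [(hd s).deriv]
    have ha : 0 ≤ Real.sinh (α * s) := Real.sinh_nonneg_iff.mpr (mul_nonneg h0 (le_of_lt hs))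
    have hb : 0 < Real.sinh s := Real.sinh_pos_iff.mpr hs
    have : α ^ 2 - 1 ≤ 0 := by nlinarith
    exact mul_nonpos_of_nonpos_of_nonneg (mul_nonpos_of_nonpos_of_nonneg this ha) hb.le
  have hd : ∀ s ∈ Ioi (0 : ℝ), HasDerivAt (fun s => Real.sinh (α * s) / Real.sinh s)
      ((α * Real.cosh (α * s) * Real.sinh s - Real.sinh (α * s) * Real.cosh s)
        / Real.sinh s ^ 2) s := by
    intro s hs
    have hl : HasDerivAt (fun s => α * s) α s := by simpa using (hasDerivAt_id s).const_mul α
    have hA := hl.sinh.div (Real.hasDerivAt_sinh s) (Real.sinh_pos_iff.mpr hs).ne'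
    convert! hA using 1
    ring
  refine antitoneOn_of_deriv_nonpos (convex_Ioi 0)
    (fun s hs => (hd s hs).continuousAt.continuousWithinAt)
    (fun s hs => (hd s (interior_subset hs)).differentiableAt.differentiableWithinAt) fun s hs => ?_
  rw [interior_Ioi] at hs
  rw [(hd s hs).deriv]
  have := hD (mem_Ici.mpr le_rfl) (mem_Ici.mpr (le_of_lt hs)) (le_of_lt hs)
  simp only [mul_zero, Real.sinh_zero, zero_mul, sub_zero] at this
  exact div_nonpos_of_nonpos_of_nonneg this (by positivity)

/-- A common majorant for the hyperbolic quotients; its integrability is where |α| < 1 is decisive.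
-/
theorem integrableOn_two_mul_exp {α : ℝ} (hα : |α| < 1) :
    IntegrableOn (fun s => 2 * Real.exp (-(1 - |α|) * s)) (Ioi 0) :=
  (integrableOn_exp_mul_Ioi (by linarith) 0).const_mul 2

theorem integral_two_mul_exp {α : ℝ} (hα : |α| < 1) :
    ∫ s in Ioi (0 : ℝ), 2 * Real.exp (-(1 - |α|) * s) = 2 / (1 - |α|) := by
  rw [integral_const_mul, integral_exp_mul_Ioi (by linarith)]
  have : 1 - |α| ≠ 0 := by linarith
  simp only [mul_zero, Real.exp_zero]
  rw [show -(1 - |α|) = -1 * (1 - |α|) by ring]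
  field_simp

/-! ### The weights -/

theorem decayingWeight_exp {α : ℝ} (hα0 : α ≠ 0) :
    DecayingWeight (fun s => Real.exp (-|α| * s)) 1 (1 / |α|) := by
  have hp : 0 < |α| := abs_pos.mpr hα0
  refine DecayingWeight.of_le (v := fun s => Real.exp (-|α| * s))
    (integrableOn_exp_mul_Ioi (by linarith) 0) ?_ ?_ ?_ ?_ ?_
  · rw [integral_exp_mul_Ioi (by linarith)]; simp
  · intro s _ t _ hst
    exact Real.exp_le_exp.mpr (by nlinarith)
  · intro s _; positivity
  · intro s hs; exact Real.exp_le_one_iff.mpr (by nlinarith)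
  · intro s _; exact le_rfl

theorem decayingWeight_cosh_div_cosh {α : ℝ} (hα : |α| < 1) :
    DecayingWeight (fun s => Real.cosh (α * s) / Real.cosh s) 1 (2 / (1 - |α|)) :=
  DecayingWeight.of_le (integrableOn_two_mul_exp hα) (integral_two_mul_exp hα).le
    ((antitoneOn_cosh_div_cosh hα).mono Ioi_subset_Ici_self)
    (fun s _ => by have := Real.cosh_pos (α * s); have := Real.cosh_pos s; positivity)
    (fun s _ => cosh_div_cosh_le_one hα) (fun s hs => cosh_div_cosh_le hs.le)

theorem decayingWeight_sinh_div_sinh {α : ℝ} (hα : |α| < 1) :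
    DecayingWeight (fun s => Real.sinh (|α| * s) / Real.sinh s) 1 (2 / (1 - |α|)) := by
  have hle : ∀ s, 0 < s → Real.sinh (|α| * s) / Real.sinh s ≤ Real.cosh (α * s) / Real.cosh s := by
    intro s hs
    refine (sinh_div_sinh_le_cosh_div_cosh hα hs).trans (le_of_eq ?_)
    rw [← Real.cosh_abs (α * s), abs_mul, abs_of_pos hs]
  refine DecayingWeight.of_le (integrableOn_two_mul_exp hα) (integral_two_mul_exp hα).le
    (antitoneOn_sinh_div_sinh (abs_nonneg α) hα) (fun s hs => ?_)
    (fun s hs => (hle s hs).trans (cosh_div_cosh_le_one hα))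
    (fun s hs => (hle s hs).trans (cosh_div_cosh_le hs.le))
  exact div_nonneg (Real.sinh_nonneg_iff.mpr (by positivity)) (Real.sinh_nonneg_iff.mpr hs.le)

/-- Multiplying a decaying weight by a bounded nonincreasing function. -/
theorem DecayingWeight.mul {w v : ℝ → ℝ} {H I A : ℝ} (hw : DecayingWeight w H I)
    (hv : AntitoneOn v (Ioi 0)) (hv0 : ∀ s, 0 < s → 0 ≤ v s) (hvA : ∀ s, 0 < s → v s ≤ A) :
    DecayingWeight (fun s => w s * v s) (H * A) (I * A) := by
  have hA : 0 ≤ A := (hv0 1 one_pos).trans (hvA 1 one_pos)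
  refine DecayingWeight.of_le (v := fun s => w s * A) (hw.integrableOn.mul_const A) ?_ ?_ ?_ ?_ ?_
  · rw [integral_mul_const]
    exact mul_le_mul_of_nonneg_right hw.integral_le hA
  · intro s hs t ht hst
    exact mul_le_mul (hw.antitoneOn hs ht hst) (hv hs ht hst) (hv0 t ht) (hw.nonneg s hs)
  · intro s hs; exact mul_nonneg (hw.nonneg s hs) (hv0 s hs)
  · intro s hs
    exact mul_le_mul (hw.le s hs) (hvA s hs) (hv0 s hs) hw.bound_nonneg
  · intro s hs; exact mul_le_mul_of_nonneg_left (hvA s hs) (hw.nonneg s hs)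

theorem cosh_sub_pos {c s : ℝ} (hc : c ≤ 1) (hs : 0 < s) : 0 < Real.cosh s - c := by
  have := Real.one_lt_cosh.mpr hs.ne'
  linarith

theorem antitoneOn_inv_cosh_sub {c : ℝ} (hc : c ≤ 1) :
    AntitoneOn (fun s => (Real.cosh s - c)⁻¹) (Ioi 0) := by
  intro s hs t ht hst
  refine inv_anti₀ (cosh_sub_pos hc hs) (sub_le_sub_right (Real.cosh_le_cosh.mpr ?_) c)
  rwa [abs_of_pos hs, abs_of_pos ht]

/-- This weight appears in the Fourier coefficient of order ±n of the third kernel. Since n ≥ 1 >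
|α|, it is half the sum of two decreasing exponentials, with height and mass bounded independently
of n. For n = 0 it would grow. -/
theorem decayingWeight_exp_mul_cosh {α : ℝ} (hα : |α| < 1) {n : ℕ} (hn : n ≠ 0) :
    DecayingWeight (fun s => Real.exp (-(n : ℝ) * s) * Real.cosh (α * s)) 1 (2 / (1 - |α|)) := by
  have hn1 : (1 : ℝ) ≤ n := by exact_mod_cast Nat.one_le_iff_ne_zero.mpr hn
  have heq : ∀ s, Real.exp (-(n : ℝ) * s) * Real.cosh (α * s)
      = (Real.exp (-(n - |α|) * s) + Real.exp (-(n + |α|) * s)) / 2 := by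
    intro s
    have : Real.cosh (α * s) = Real.cosh (|α| * s) := by
      rw [← Real.cosh_abs, ← Real.cosh_abs (|α| * s), abs_mul, abs_mul, abs_abs]
    rw [this, Real.cosh_eq, mul_div_assoc', mul_add, ← Real.exp_add, ← Real.exp_add]
    ring_nf
  have h0 := abs_nonneg α
  have hmono : ∀ u v : ℝ, u ≤ v → ∀ s : ℝ, 0 ≤ s → Real.exp (-v * s) ≤ Real.exp (-u * s) :=
    fun u v huv s hs => Real.exp_le_exp.mpr (by nlinarith)
  have hle : ∀ s, 0 < s → Real.exp (-(n : ℝ) * s) * Real.cosh (α * s)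
      ≤ Real.exp (-(1 - |α|) * s) := by
    intro s hs
    rw [heq]
    have := hmono (1 - |α|) (n - |α|) (by linarith) s hs.le
    have := hmono (1 - |α|) (n + |α|) (by linarith) s hs.le
    linarith
  refine DecayingWeight.of_le (integrableOn_two_mul_exp hα) (integral_two_mul_exp hα).le
    ?_ ?_ ?_ ?_
  · intro s _ t _ hst
    simp only [heq]
    have hm : ∀ u : ℝ, 0 ≤ u → Real.exp (-u * t) ≤ Real.exp (-u * s) := fun u hu =>
      Real.exp_le_exp.mpr (by nlinarith)
    have := hm (n - |α|) (by linarith)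
    have := hm (n + |α|) (by linarith)
    linarith
  · intro s _
    have := Real.cosh_pos (α * s)
    positivity
  · intro s hs
    exact (hle s hs).trans (Real.exp_le_one_iff.mpr (by nlinarith))
  · intro s hs
    have := Real.exp_pos (-(1 - |α|) * s)
    linarith [hle s hs]

/-- The oscillatory integral of a weight `w` against `e^{i|n_s|} B(|n_s|)`. -/
def oscIntegral (B : ℝ → ℂ) (r₁ r₂ : ℝ) (w : ℝ → ℝ) : ℂ :=
  ∫ s in Ioi (0 : ℝ), Complex.exp (Complex.I * (diffDist r₁ r₂ s : ℂ))
      * B (diffDist r₁ r₂ s) * (w s : ℂ)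

theorem diffKernel_eq_oscIntegral (α δ : ℝ) (a : ℝ → ℂ) (ℓ : ℕ) (r₁ r₂ θ : ℝ) :
    diffKernel α δ a ℓ r₁ r₂ θ
      = oscIntegral (oscAmplitude δ a) r₁ r₂ (fun s => diffWeight α θ s ℓ) := by
  unfold diffKernel oscIntegral
  simp_rw [diffIntegrand_eq]

theorem oscIntegral_congr (B : ℝ → ℂ) (r₁ r₂ : ℝ) {w v : ℝ → ℝ} (h : ∀ s, 0 < s → w s = v s) :
    oscIntegral B r₁ r₂ w = oscIntegral B r₁ r₂ v :=
  setIntegral_congr_fun measurableSet_Ioi fun s hs => by simp only [h s hs]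

theorem oscIntegral_const_mul (B : ℝ → ℂ) (r₁ r₂ c : ℝ) (w : ℝ → ℝ) :
    oscIntegral B r₁ r₂ (fun s => c * w s) = c * oscIntegral B r₁ r₂ w := by
  unfold oscIntegral
  rw [← integral_const_mul]
  congr 1; ext s; push_cast; ring

namespace AmplitudeBound

variable {δ C : ℝ} {B B' : ℝ → ℂ} {r₁ r₂ : ℝ}

theorem oscIntegral_add (hB : AmplitudeBound δ C B B') (hδ : 0 ≤ δ) (h₁ : 0 < r₁) (h₂ : 0 < r₂)
    {w v : ℝ → ℝ} (hw : IntegrableOn w (Ioi 0)) (hv : IntegrableOn v (Ioi 0)) :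
    oscIntegral B r₁ r₂ (fun s => w s + v s)
      = oscIntegral B r₁ r₂ w + oscIntegral B r₁ r₂ v := by
  unfold oscIntegral
  rw [← integral_add (hB.integrableOn_osc_mul hδ h₁ h₂ hw) (hB.integrableOn_osc_mul hδ h₁ h₂ hv)]
  congr 1; ext s; push_cast; ring

theorem norm_oscIntegral_le (hB : AmplitudeBound δ C B B') (hδ : 0 ≤ δ) (h₁ : 0 < r₁)
    (h₂ : 0 < r₂) {w : ℝ → ℝ} {H I : ℝ} (hw : DecayingWeight w H I) :
    ‖oscIntegral B r₁ r₂ w‖ ≤ C * (1 + (r₁ + r₂)) ^ (-(3 / 2) - δ) * I := by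
  refine (hB.norm_integral_osc_mul_le hδ h₁ h₂ hw.integrableOn).trans ?_
  have := hB.pos
  rw [hw.setIntegral_abs]
  gcongr
  exact hw.integral_le

/-- Decay of the oscillatory integral for a decaying weight. -/
theorem norm_oscIntegral_le_decay (hB : AmplitudeBound δ C B B') (hδ : 0 ≤ δ) (h₁ : 0 < r₁)
    (h₂ : 0 < r₂) {w : ℝ → ℝ} {H I : ℝ} (hw : DecayingWeight w H I) :
    ‖oscIntegral B r₁ r₂ w‖ ≤ C * (1 + (r₁ + r₂)) ^ (-(3 / 2) - δ)
      * (1 + min r₁ r₂) ^ (-(1 / 2) : ℝ) * (18 * (H + I)) :=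
  hB.norm_integral_osc_mul_le_of_decayingWeight hδ (lt_min h₁ h₂) (min_le_left _ _)
    (min_le_right _ _) hw

end AmplitudeBound

/-! ### Decomposition of the weights -/

theorem antitoneOn_one_sub_sq_div {c : ℝ} (hc : |c| ≤ 1) :
    AntitoneOn (fun s => (1 - c ^ 2) * (Real.cosh s - c)⁻¹) (Ioi 0) := fun s hs t ht hst =>
  mul_le_mul_of_nonneg_left (antitoneOn_inv_cosh_sub (le_of_abs_le hc) hs ht hst)
    (by nlinarith [abs_nonneg c, sq_abs c])

/-- Since cosh s - c ≥ 1 - c, the factor 1 - c of 1 - c² absorbs the denominator and leaves 1 + c ≤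
2. -/
theorem one_sub_sq_div_le {c s : ℝ} (hc : |c| ≤ 1) (hs : 0 < s) :
    (1 - c ^ 2) * (Real.cosh s - c)⁻¹ ≤ 2 := by
  obtain ⟨h1, h2⟩ := abs_le.mp hc
  rw [← div_eq_mul_inv, div_le_iff₀ (cosh_sub_pos h2 hs)]
  nlinarith [Real.one_le_cosh s]

/-- With c = cos(θ + π), (e^(-s) - c) sinh s / (cosh s - c) equals -e^(-s) - c + (1 - c²)/(cosh s -
c). Multiplied by sinh(|α|s)/sinh s, each term is a constant times a nonincreasing weight bounded
uniformly in θ: the numerator e^(-s) - c cancels the singularity at s = 0, c = 1. The sign ε is that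
of α, as sinh is odd. -/
theorem diffWeight_two (α θ : ℝ) {s : ℝ} (hs : 0 < s) :
    ∃ ε : ℝ, (ε = if 0 ≤ α then 1 else -1) ∧ diffWeight α θ s 2 =
      ε * (-1 * (Real.sinh (|α| * s) / Real.sinh s * Real.exp (-s))
        + (-Real.cos (θ + Real.pi) * (Real.sinh (|α| * s) / Real.sinh s)
        + Real.sinh (|α| * s) / Real.sinh s
          * ((1 - Real.cos (θ + Real.pi) ^ 2) * (Real.cosh s - Real.cos (θ + Real.pi))⁻¹))) := by
  refine ⟨_, rfl, ?_⟩
  have hsign : Real.sinh (α * s) = (if 0 ≤ α then 1 else -1) * Real.sinh (|α| * s) := by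
    split_ifs with h
    · rw [abs_of_nonneg h, one_mul]
    · rw [abs_of_neg (not_le.mp h), neg_mul α s, Real.sinh_neg]; ring
  simp only [diffWeight]
  rw [hsign]
  set c := Real.cos (θ + Real.pi)
  have hpos : Real.cosh s - c ≠ 0 := (cosh_sub_pos (Real.cos_le_one _) hs).ne'
  have hsh : Real.sinh s ≠ 0 := (Real.sinh_pos_iff.mpr hs).ne'
  have he : Real.exp (-s) = Real.cosh s - Real.sinh s := by rw [Real.cosh_sub_sinh]
  have hsq : Real.cosh s ^ 2 = 1 + Real.sinh s ^ 2 := by linarith [Real.cosh_sq s]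
  rw [he]
  field_simp
  linear_combination Real.sinh (|α| * s) * hsq

/-- From 1/(cosh s - c) = 1/cosh s + c/(cosh s (cosh s - c)). Both pieces become products of
nonincreasing factors, the growing cosh(αs) occurring only in the quotient cosh(αs)/cosh s. -/
theorem diffWeight_three (α θ : ℝ) {s : ℝ} (hs : 0 < s) :
    diffWeight α θ s 3 = Real.sin (θ + Real.pi) * (Real.cosh (α * s) / Real.cosh s)
      + Real.cos (θ + Real.pi) * (Real.sin (θ + Real.pi) * (Real.cosh (α * s) / Real.cosh s
        * (Real.cosh s - Real.cos (θ + Real.pi))⁻¹)) := by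
  simp only [diffWeight]
  have hpos : Real.cosh s - Real.cos (θ + Real.pi) ≠ 0 :=
    (cosh_sub_pos (Real.cos_le_one _) hs).ne'
  have hch := (Real.cosh_pos s).ne'
  field_simp
  ring

/-- The quantity |cos(θ/2)| measures the distance from θ to the singular angle π modulo 2π; all
angular losses are expressed through it. -/
theorem cos_add_pi_eq (θ : ℝ) : Real.cos (θ + Real.pi) = 1 - 2 * Real.cos (θ / 2) ^ 2 := by
  rw [Real.cos_add_pi, show θ = 2 * (θ / 2) by ring, Real.cos_two_mul]; ring_nf

theorem abs_sin_add_pi_le (θ : ℝ) : |Real.sin (θ + Real.pi)| ≤ 2 * |Real.cos (θ / 2)| := by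
  rw [Real.sin_add_pi, abs_neg]
  conv_lhs => rw [show θ = 2 * (θ / 2) by ring, Real.sin_two_mul]
  rw [abs_mul, abs_mul, abs_two]
  have := Real.abs_sin_le_one (θ / 2)
  have := abs_nonneg (Real.cos (θ / 2))
  nlinarith

theorem one_add_sq_div_two_le_cosh {s : ℝ} (hs : 0 ≤ s) : 1 + s ^ 2 / 2 ≤ Real.cosh s := by
  have h1 : s / 2 ≤ Real.sinh (s / 2) := Real.self_le_sinh_iff.mpr (by linarith)
  have h2 : Real.cosh s = Real.cosh (s / 2) ^ 2 + Real.sinh (s / 2) ^ 2 := by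
    rw [← Real.cosh_two_mul]; ring_nf
  have h3 := Real.cosh_sq (s / 2)
  nlinarith

/-- By scaling, the mass does not depend on m. This keeps the size bound on the third kernel uniform
up to the singular angle. -/
theorem integrableOn_poisson {m : ℝ} (hm : 0 < m) :
    IntegrableOn (fun s => 2 * m / (s ^ 2 + m ^ 2)) (Ioi 0) ∧
      ∫ s in Ioi (0 : ℝ), 2 * m / (s ^ 2 + m ^ 2) = Real.pi := by
  have heq : (fun s => 2 * m / (s ^ 2 + m ^ 2))
      = fun s => 2 * m⁻¹ * (fun x : ℝ => (1 + x ^ 2)⁻¹) (m⁻¹ * s) := by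
    ext s
    have : s ^ 2 + m ^ 2 ≠ 0 := by positivity
    have : 1 + (m⁻¹ * s) ^ 2 ≠ 0 := by positivity
    simp only
    field_simp
    ring
  rw [heq]
  constructor
  · exact ((integrable_inv_one_add_sq.comp_mul_left' (inv_ne_zero hm.ne')).const_mul _).integrableOn
  · rw [integral_const_mul, integral_comp_mul_left_Ioi (fun x : ℝ => (1 + x ^ 2)⁻¹) 0
      (inv_pos.mpr hm), mul_zero, integral_Ioi_inv_one_add_sq]
    simp
    field_simp

/-- Let κ = |cos(θ/2)|. Then cosh s - cos(θ + π) ≥ s²/2 + 2κ² and |sin(θ + π)| ≤ 2κ, so the weight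
is dominated by the Poisson kernel 2m/(s² + m²) with m = 2κ, of mass π and height 2/m = 1/κ. -/
theorem decayingWeight_conjPoisson {α : ℝ} (hα : |α| < 1) {θ : ℝ} (hθ : Real.cos (θ / 2) ≠ 0) :
    DecayingWeight (fun s => |Real.sin (θ + Real.pi)| * (Real.cosh (α * s) / Real.cosh s
        * (Real.cosh s - Real.cos (θ + Real.pi))⁻¹)) (1 / |Real.cos (θ / 2)|) Real.pi := by
  have hκ : 0 < |Real.cos (θ / 2)| := abs_pos.mpr hθ
  have hm : 0 < 2 * |Real.cos (θ / 2)| := by positivity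
  obtain ⟨hp1, hp2⟩ := integrableOn_poisson hm
  have hq : ∀ s, 0 ≤ Real.cosh (α * s) / Real.cosh s := fun s =>
    div_nonneg (Real.cosh_pos _).le (Real.cosh_pos _).le
  have hd : ∀ s, 0 < s → 0 < Real.cosh s - Real.cos (θ + Real.pi) :=
    fun s hs => cosh_sub_pos (Real.cos_le_one _) hs
  have hle : ∀ s, 0 < s → |Real.sin (θ + Real.pi)| * (Real.cosh (α * s) / Real.cosh s
        * (Real.cosh s - Real.cos (θ + Real.pi))⁻¹)
      ≤ 2 * (2 * |Real.cos (θ / 2)|) / (s ^ 2 + (2 * |Real.cos (θ / 2)|) ^ 2) := by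
    intro s hs
    have h1 : (s ^ 2 + (2 * |Real.cos (θ / 2)|) ^ 2) / 2
        ≤ Real.cosh s - Real.cos (θ + Real.pi) := by
      rw [cos_add_pi_eq, mul_pow, sq_abs]
      have := one_add_sq_div_two_le_cosh hs.le
      linarith
    calc _ ≤ 2 * |Real.cos (θ / 2)| * (1 * ((s ^ 2 + (2 * |Real.cos (θ / 2)|) ^ 2) / 2)⁻¹) := by
          have := hd s hs
          gcongr
          · exact abs_sin_add_pi_le θ
          · exact cosh_div_cosh_le_one hα
      _ = _ := by field_simp
  refine DecayingWeight.of_le hp1 hp2.le ?_ ?_ ?_ hle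
  · intro s hs t ht hst
    refine mul_le_mul_of_nonneg_left ?_ (abs_nonneg _)
    exact mul_le_mul (antitoneOn_cosh_div_cosh hα (mem_Ici.mpr (le_of_lt hs)) (mem_Ici.mpr (le_of_lt ht)) hst)
      (antitoneOn_inv_cosh_sub (Real.cos_le_one _) hs ht hst) (inv_pos.mpr (hd t ht)).le (hq s)
  · intro s hs
    exact mul_nonneg (abs_nonneg _) (mul_nonneg (hq s) (inv_pos.mpr (hd s hs)).le)
  · intro s hs
    refine (hle s hs).trans ?_
    rw [div_le_div_iff₀ (by positivity) hκ]
    nlinarith [sq_nonneg s]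

theorem decayingWeight_two {α : ℝ} (hα : |α| < 1) (θ : ℝ) :
    DecayingWeight (fun s => Real.sinh (|α| * s) / Real.sinh s
      * ((1 - Real.cos (θ + Real.pi) ^ 2) * (Real.cosh s - Real.cos (θ + Real.pi))⁻¹))
      (1 * 2) (2 / (1 - |α|) * 2) := by
  refine (decayingWeight_sinh_div_sinh hα).mul
    (antitoneOn_one_sub_sq_div (Real.abs_cos_le_one _)) (fun s hs => ?_)
    (fun s hs => one_sub_sq_div_le (Real.abs_cos_le_one _) hs)
  have := cosh_sub_pos (Real.cos_le_one (θ + Real.pi)) hs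
  have := Real.cos_sq_le_one (θ + Real.pi)
  exact mul_nonneg (by linarith) (by positivity)

theorem decayingWeight_sinh_mul_exp {α : ℝ} (hα : |α| < 1) :
    DecayingWeight (fun s => Real.sinh (|α| * s) / Real.sinh s * Real.exp (-s))
      (1 * 1) (2 / (1 - |α|) * 1) :=
  (decayingWeight_sinh_div_sinh hα).mul
    (fun _ _ _ _ hst => Real.exp_le_exp.mpr (neg_le_neg hst)) (fun _ _ => (Real.exp_pos _).le)
    (fun _ hs => Real.exp_le_one_iff.mpr (neg_nonpos.mpr hs.le))

theorem sin_add_pi_eq_zero {θ : ℝ} (hθ : Real.cos (θ / 2) = 0) : Real.sin (θ + Real.pi) = 0 := by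
  have := abs_sin_add_pi_le θ
  rw [hθ, abs_zero, mul_zero] at this
  exact abs_eq_zero.mp (le_antisymm this (abs_nonneg _))

theorem integrableOn_conjPoisson {α : ℝ} (hα : |α| < 1) (θ : ℝ) :
    IntegrableOn (fun s => Real.sin (θ + Real.pi) * (Real.cosh (α * s) / Real.cosh s
        * (Real.cosh s - Real.cos (θ + Real.pi))⁻¹)) (Ioi 0) := by
  by_cases hθ : Real.cos (θ / 2) = 0
  · simp [sin_add_pi_eq_zero hθ]
  · have h := (decayingWeight_conjPoisson hα hθ).integrableOn
    rcases abs_choice (Real.sin (θ + Real.pi)) with h' | h' <;> rw [h'] at h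
    · exact h
    · simpa using h.neg

theorem integrableOn_diffWeight {α : ℝ} (hα : |α| < 1) (hα0 : α ≠ 0) (θ : ℝ) {ℓ : ℕ}
    (hℓ : ℓ ∈ Icc (1 : ℕ) 3) : IntegrableOn (fun s => diffWeight α θ s ℓ) (Ioi 0) := by
  obtain ⟨h1, h3⟩ := hℓ
  interval_cases ℓ
  · exact (decayingWeight_exp hα0).integrableOn
  · refine IntegrableOn.congr_fun ?_ (fun s hs => ?_) measurableSet_Ioi (f := fun s =>
      (if 0 ≤ α then 1 else -1) * (-1 * (Real.sinh (|α| * s) / Real.sinh s * Real.exp (-s))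
        + (-Real.cos (θ + Real.pi) * (Real.sinh (|α| * s) / Real.sinh s)
        + Real.sinh (|α| * s) / Real.sinh s
          * ((1 - Real.cos (θ + Real.pi) ^ 2) * (Real.cosh s - Real.cos (θ + Real.pi))⁻¹))))
    · exact (((decayingWeight_sinh_mul_exp hα).integrableOn.const_mul (-1)).add
        (((decayingWeight_sinh_div_sinh hα).integrableOn.const_mul _).add
          (decayingWeight_two hα θ).integrableOn)).const_mul _
    · obtain ⟨ε, hε, h⟩ := diffWeight_two α θ hs
      rw [h, hε]
  · exact IntegrableOn.congr_fun (((decayingWeight_cosh_div_cosh hα).integrableOn.const_mul _).add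
      ((integrableOn_conjPoisson hα θ).const_mul _))
      (fun s hs => (diffWeight_three α θ hs).symm) measurableSet_Ioi

/-! ### Pointwise kernel bounds -/

/-- Size `C (1 + r₁ + r₂)^{-3/2-δ}` and decay, degenerating where `cos (θ / 2) = 0` for the third
weight only. -/
theorem exists_norm_oscIntegral_diffWeight_le {α : ℝ} (hα : |α| < 1) (hα0 : α ≠ 0) :
    ∃ A : ℝ, 0 < A ∧ ∀ (δ C : ℝ) (B B' : ℝ → ℂ), AmplitudeBound δ C B B' → 0 ≤ δ →
      ∀ ℓ ∈ Icc (1 : ℕ) 3, ∀ r₁ r₂ θ : ℝ, 0 < r₁ → 0 < r₂ →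
        ‖oscIntegral B r₁ r₂ (fun s => diffWeight α θ s ℓ)‖
          ≤ C * (1 + (r₁ + r₂)) ^ (-(3 / 2) - δ) * A ∧
        |Real.cos (θ / 2)| * ‖oscIntegral B r₁ r₂ (fun s => diffWeight α θ s ℓ)‖
          ≤ C * (1 + (r₁ + r₂)) ^ (-(3 / 2) - δ) * (1 + min r₁ r₂) ^ (-(1 / 2) : ℝ) * A ∧
        (ℓ ≠ 3 → ‖oscIntegral B r₁ r₂ (fun s => diffWeight α θ s ℓ)‖
          ≤ C * (1 + (r₁ + r₂)) ^ (-(3 / 2) - δ) * (1 + min r₁ r₂) ^ (-(1 / 2) : ℝ) * A) := by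
  have hI : 0 < 2 / (1 - |α|) := div_pos two_pos (by linarith)
  have hα1 : 0 < 1 / |α| := by have := abs_pos.mpr hα0; positivity
  have hπ := Real.pi_pos
  -- The number 72 is dictated by the second weight: its three pieces contribute 18(1 + I), 18(1 +
  -- I) and 18(2 + 2I).
  refine ⟨72 * (1 + 2 / (1 - |α|) + 1 / |α| + Real.pi), by positivity, ?_⟩
  intro δ C B B' hB hδ ℓ hℓ r₁ r₂ θ h₁ h₂
  have hC := hB.pos
  have hP : 0 < (1 + (r₁ + r₂)) ^ (-(3 / 2) - δ) := Real.rpow_pos_of_pos (by linarith) _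
  have hmin : 0 < min r₁ r₂ := lt_min h₁ h₂
  have hQ : 0 < (1 + min r₁ r₂) ^ (-(1 / 2) : ℝ) := Real.rpow_pos_of_pos (by linarith) _
  have hQ1 : (1 + min r₁ r₂) ^ (-(1 / 2) : ℝ) ≤ 1 :=
    Real.rpow_le_one_of_one_le_of_nonpos (by linarith) (by norm_num)
  have hdecay := fun (w : ℝ → ℝ) (H I : ℝ) (hw : DecayingWeight w H I) =>
    hB.norm_oscIntegral_le_decay hδ h₁ h₂ hw
  have htriv := fun (w : ℝ → ℝ) (H I : ℝ) (hw : DecayingWeight w H I) =>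
    hB.norm_oscIntegral_le hδ h₁ h₂ hw
  have hadd := fun (w v : ℝ → ℝ) hw hv =>
    hB.oscIntegral_add hδ h₁ h₂ (w := w) (v := v) hw hv
  set D := C * (1 + (r₁ + r₂)) ^ (-(3 / 2) - δ) with hD
  have hD0 : 0 < D := mul_pos hC hP
  set Q := (1 + min r₁ r₂) ^ (-(1 / 2) : ℝ)
  set I := 2 / (1 - |α|) with hIdef
  set κ := |Real.cos (θ / 2)| with hκ
  have hκ0 : 0 ≤ κ := abs_nonneg _
  have hκ1 : κ ≤ 1 := Real.abs_cos_le_one _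
  have hDQ : 0 < D * Q := mul_pos hD0 hQ
  obtain ⟨hℓ1, hℓ3⟩ := hℓ
  have hgood : ∀ J : ℝ, 0 ≤ J → J ≤ D * Q * (72 * (1 + I + 1 / |α| + Real.pi)) →
      J ≤ D * (72 * (1 + I + 1 / |α| + Real.pi)) ∧
      κ * J ≤ D * Q * (72 * (1 + I + 1 / |α| + Real.pi)) := by
    intro J hJ0 hJ
    have : D * Q ≤ D * 1 := by gcongr
    exact ⟨hJ.trans (by gcongr; linarith), by nlinarith⟩
  interval_cases ℓ
  · have h : ‖oscIntegral B r₁ r₂ (fun s => diffWeight α θ s 1)‖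
        ≤ D * Q * (72 * (1 + I + 1 / |α| + Real.pi)) :=
      (hdecay _ _ _ (decayingWeight_exp hα0)).trans
        (mul_le_mul_of_nonneg_left (by linarith) hDQ.le)
    exact ⟨(hgood _ (norm_nonneg _) h).1, (hgood _ (norm_nonneg _) h).2, fun _ => h⟩
  · have h : ‖oscIntegral B r₁ r₂ (fun s => diffWeight α θ s 2)‖
        ≤ D * Q * (72 * (1 + I + 1 / |α| + Real.pi)) := by
      have hw : ∀ s, 0 < s → diffWeight α θ s 2 = (if 0 ≤ α then 1 else -1) * (-1 *
          (Real.sinh (|α| * s) / Real.sinh s * Real.exp (-s))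
          + (-Real.cos (θ + Real.pi) * (Real.sinh (|α| * s) / Real.sinh s)
          + Real.sinh (|α| * s) / Real.sinh s
            * ((1 - Real.cos (θ + Real.pi) ^ 2) * (Real.cosh s - Real.cos (θ + Real.pi))⁻¹))) := by
        intro s hs
        obtain ⟨ε, hε, h⟩ := diffWeight_two α θ hs
        rw [h, hε]
      have hd1 := decayingWeight_sinh_mul_exp hα
      have hd2 := decayingWeight_sinh_div_sinh hα
      have hd3 := decayingWeight_two hα θ
      have hint : IntegrableOn (fun s => -Real.cos (θ + Real.pi)
          * (Real.sinh (|α| * s) / Real.sinh s) + Real.sinh (|α| * s) / Real.sinh s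
            * ((1 - Real.cos (θ + Real.pi) ^ 2) * (Real.cosh s - Real.cos (θ + Real.pi))⁻¹))
          (Ioi 0) := (hd2.integrableOn.const_mul _).add hd3.integrableOn
      rw [oscIntegral_congr B r₁ r₂ hw, oscIntegral_const_mul,
        hadd _ _ (hd1.integrableOn.const_mul _) hint, oscIntegral_const_mul,
        hadd _ _ (hd2.integrableOn.const_mul _) hd3.integrableOn, oscIntegral_const_mul,
        norm_mul, Complex.norm_real]
      have hε : ‖(if 0 ≤ α then 1 else -1 : ℝ)‖ = 1 := by split_ifs <;> simp
      rw [hε, one_mul]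
      have e1 := hdecay _ _ _ hd1
      have e2 := hdecay _ _ _ hd2
      have e3 := hdecay _ _ _ hd3
      refine (norm_add_le _ _).trans ((add_le_add le_rfl (norm_add_le _ _)).trans ?_)
      rw [norm_mul, norm_mul, Complex.norm_real, Complex.norm_real, norm_neg, norm_neg, norm_one,
        one_mul, Real.norm_eq_abs]
      have hc := Real.abs_cos_le_one (θ + Real.pi)
      have e2' : |Real.cos (θ + Real.pi)| * ‖oscIntegral B r₁ r₂
          (fun s => Real.sinh (|α| * s) / Real.sinh s)‖ ≤ D * Q * (18 * (1 + I)) :=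
        (mul_le_of_le_one_left (norm_nonneg _) hc).trans e2
      calc _ ≤ D * Q * (18 * (1 * 1 + I * 1)) + (D * Q * (18 * (1 + I))
            + D * Q * (18 * (1 * 2 + I * 2))) := add_le_add e1 (add_le_add e2' e3)
        _ = D * Q * (72 * (1 + I)) := by ring
        _ ≤ _ := mul_le_mul_of_nonneg_left (by linarith) hDQ.le
    exact ⟨(hgood _ (norm_nonneg _) h).1, (hgood _ (norm_nonneg _) h).2, fun _ => h⟩
  -- At the singular angle sin(θ + π) = 0, so the third weight, and with it the kernel, vanishes
  -- identically.
  · by_cases hθ : Real.cos (θ / 2) = 0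
    · have h0 : oscIntegral B r₁ r₂ (fun s => diffWeight α θ s 3) = 0 := by
        rw [oscIntegral_congr B r₁ r₂ (v := fun s => 0 * (0 : ℝ)), oscIntegral_const_mul]
        · simp
        · intro s hs
          rw [diffWeight_three α θ hs, sin_add_pi_eq_zero hθ]; ring
      rw [h0, norm_zero, mul_zero]
      exact ⟨by positivity, by positivity, by simp⟩
    have hd1 := decayingWeight_cosh_div_cosh hα
    have hd2 := decayingWeight_conjPoisson hα hθ
    have hbd : ‖oscIntegral B r₁ r₂ (fun s => diffWeight α θ s 3)‖
        ≤ ‖oscIntegral B r₁ r₂ (fun s => Real.cosh (α * s) / Real.cosh s)‖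
        + ‖oscIntegral B r₁ r₂ (fun s => |Real.sin (θ + Real.pi)| * (Real.cosh (α * s)
          / Real.cosh s * (Real.cosh s - Real.cos (θ + Real.pi))⁻¹))‖ := by
      rw [oscIntegral_congr B r₁ r₂ fun s hs => diffWeight_three α θ hs,
        hadd _ _ (hd1.integrableOn.const_mul _) ((integrableOn_conjPoisson hα θ).const_mul _),
        oscIntegral_const_mul, oscIntegral_const_mul, oscIntegral_const_mul, oscIntegral_const_mul]
      refine (norm_add_le _ _).trans (add_le_add ?_ ?_)
      · rw [norm_mul, Complex.norm_real]
        exact mul_le_of_le_one_left (norm_nonneg _) (Real.abs_sin_le_one _)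
      · rw [norm_mul, norm_mul, norm_mul, Complex.norm_real, Complex.norm_real, Complex.norm_real,
          Real.norm_eq_abs |_|, abs_abs]
        exact mul_le_of_le_one_left (by positivity) (Real.abs_cos_le_one _)
    have hκpos : 0 < κ := abs_pos.mpr hθ
    refine ⟨hbd.trans ?_, ?_, by simp⟩
    · calc _ ≤ D * I + D * Real.pi := add_le_add (htriv _ _ _ hd1) (htriv _ _ _ hd2)
        _ = D * (I + Real.pi) := by ring
        _ ≤ _ := by gcongr; linarith
    · calc _ ≤ κ * (D * Q * (18 * (1 + I)) + D * Q * (18 * (1 / κ + Real.pi))) :=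
            mul_le_mul_of_nonneg_left
              (hbd.trans (add_le_add (hdecay _ _ _ hd1) (hdecay _ _ _ hd2))) hκ0
        -- The factor κ cancels the height 1/κ of the conjugate Poisson weight.
        _ = D * Q * (18 * (κ * (1 + I + Real.pi) + 1)) := by field_simp; ring
        _ ≤ D * Q * (72 * (1 + I + 1 / |α| + Real.pi)) := by
            have : κ * (1 + I + Real.pi) ≤ 1 * (1 + I + Real.pi) := by gcongr
            exact mul_le_mul_of_nonneg_left (by linarith) hDQ.le

/-! ### Fourier coefficients of the third kernel -/

theorem integral_exp_int_mul (k : ℤ) :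
    ∫ θ in (-Real.pi)..Real.pi, Complex.exp ((k : ℂ) * Complex.I * θ)
      = if k = 0 then 2 * (Real.pi : ℂ) else 0 := by
  split_ifs with h
  · subst h
    simp only [Int.cast_zero, zero_mul, Complex.exp_zero, intervalIntegral.integral_const]
    simp; ring
  · have hk : (k : ℂ) * Complex.I ≠ 0 := mul_ne_zero (by exact_mod_cast h) Complex.I_ne_zero
    rw [integral_exp_mul_complex hk, div_eq_zero_iff, sub_eq_zero]
    left
    have e : (k : ℂ) * Complex.I * (Real.pi : ℝ)
        = (k : ℂ) * Complex.I * ((-Real.pi : ℝ) : ℂ) + (k : ℂ) * (2 * Real.pi * Complex.I) := by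
      push_cast; ring
    rw [e, Complex.exp_add, Complex.exp_int_mul_two_pi_mul_I, mul_one]

/-- The conjugate Poisson kernel as the imaginary part of a geometric series. -/
theorem hasSum_conjPoisson {s : ℝ} (hs : 0 < s) (θ : ℝ) :
    HasSum (fun m : ℕ => -Complex.I * ((-(Real.exp (-s) : ℂ) * Complex.exp (Complex.I * θ)) ^ (m + 1)
        - (-(Real.exp (-s) : ℂ) * Complex.exp (-Complex.I * θ)) ^ (m + 1)))
      ((Real.sin (θ + Real.pi) / (Real.cosh s - Real.cos (θ + Real.pi)) : ℝ) : ℂ) := by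
  have hx : Real.exp (-s) < 1 := Real.exp_lt_one_iff.mpr (by linarith)
  have hn : ∀ u : ℂ, ‖Complex.exp u‖ = 1 → ‖-(Real.exp (-s) : ℂ) * Complex.exp u‖ < 1 := by
    intro u hu
    rw [norm_mul, norm_neg, hu, mul_one, Complex.norm_real, Real.norm_of_nonneg (Real.exp_pos _).le]
    exact hx
  have hu1 : ‖Complex.exp (Complex.I * θ)‖ = 1 := by
    rw [mul_comm]; exact Complex.norm_exp_ofReal_mul_I _
  have hu2 : ‖Complex.exp (-Complex.I * θ)‖ = 1 := by
    have := Complex.norm_exp_ofReal_mul_I (-θ)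
    rwa [show ((-θ : ℝ) : ℂ) * Complex.I = -Complex.I * θ by push_cast; ring] at this
  have key : ∀ z : ℂ, ‖z‖ < 1 → HasSum (fun m : ℕ => z ^ (m + 1)) (z * (1 - z)⁻¹) := by
    intro z hz
    simp_rw [pow_succ']
    exact (hasSum_geometric_of_norm_lt_one hz).mul_left z
  have hne : ∀ z : ℂ, ‖z‖ < 1 → 1 - z ≠ 0 := fun z hz h => by
    rw [← sub_eq_zero.mp h, norm_one] at hz; exact lt_irrefl _ hz
  convert! ((key _ (hn _ hu1)).sub (key _ (hn _ hu2))).mul_left (-Complex.I) using 1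
  have n1 := hne _ (hn _ hu1)
  have n2 := hne _ (hn _ hu2)
  have hmul : Complex.exp (Complex.I * θ) * Complex.exp (-Complex.I * θ) = 1 := by
    rw [← Complex.exp_add]; simp
  have hsin : Complex.sin θ = (Complex.exp (-Complex.I * θ) - Complex.exp (Complex.I * θ))
      * Complex.I / 2 := by
    unfold Complex.sin; ring_nf
  have hcos : Complex.cos θ = (Complex.exp (Complex.I * θ) + Complex.exp (-Complex.I * θ)) / 2 := by
    unfold Complex.cos; ring_nf
  have hE : (Real.exp (-s) : ℂ) * Real.exp s = 1 := by
    rw [← Complex.ofReal_mul, ← Real.exp_add]; simp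
  have hcosh : (Real.cosh s : ℂ) = (Real.exp s + Real.exp (-s)) / 2 := by
    rw [Real.cosh_eq]; push_cast; ring
  have hden : ((Real.cosh s - Real.cos (θ + Real.pi) : ℝ) : ℂ) ≠ 0 := by
    exact_mod_cast (cosh_sub_pos (Real.cos_le_one _) hs).ne'
  rw [Complex.ofReal_div, div_eq_iff hden, Complex.ofReal_sub, Real.sin_add_pi, Real.cos_add_pi,
    Complex.ofReal_neg, Complex.ofReal_neg, Complex.ofReal_sin, Complex.ofReal_cos, hsin, hcos,
    hcosh]
  set E : ℂ := (Real.exp (-s) : ℂ)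
  set F : ℂ := (Real.exp s : ℂ)
  set U := Complex.exp (Complex.I * θ)
  set V := Complex.exp (-Complex.I * θ)
  -- Here EF = UV = 1, and F + E + U + V = 2(cosh s + cos θ) is twice the denominator of the kernel.
  have hD : (1 - -E * U) * (1 - -E * V) = E * (F + E + (U + V)) := by
    linear_combination E ^ 2 * hmul - hE
  have hS : E * (F + E + (U + V)) ≠ 0 := hD ▸ mul_ne_zero n1 n2
  have hfrac : -E * U * (1 - -E * U)⁻¹ - -E * V * (1 - -E * V)⁻¹
      = (-E * U - -E * V) / (E * (F + E + (U + V))) := by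
    rw [← hD, ← div_eq_mul_inv, ← div_eq_mul_inv, div_sub_div _ _ n1 n2]
    congr 1; ring
  rw [hfrac]
  have hE0 := left_ne_zero_of_mul hS
  have hS0 := right_ne_zero_of_mul hS
  field_simp
  ring

/-- Fourier coefficients of the conjugate Poisson kernel. -/
theorem integral_conjPoisson_mul_exp {s : ℝ} (hs : 0 < s) (n : ℤ) :
    ∫ θ in (-Real.pi)..Real.pi,
      ((Real.sin (θ + Real.pi) / (Real.cosh s - Real.cos (θ + Real.pi)) : ℝ) : ℂ)
        * Complex.exp (((-n : ℤ) : ℂ) * Complex.I * θ)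
      = -Complex.I * (-1) ^ n.natAbs * (2 * Real.pi) * n.sign * (Real.exp (-(n.natAbs : ℝ) * s)) := by
  set E : ℂ := (Real.exp (-s) : ℂ) with hE
  have hEn : ‖E‖ = Real.exp (-s) := by
    rw [hE, Complex.norm_real, Real.norm_of_nonneg (Real.exp_pos _).le]
  have hE1 : Real.exp (-s) < 1 := Real.exp_lt_one_iff.mpr (by linarith)
  let F : ℕ → C(ℝ, ℂ) := fun m =>
    { toFun := fun θ => (-Complex.I * ((-E * Complex.exp (Complex.I * θ)) ^ (m + 1)
        - (-E * Complex.exp (-Complex.I * θ)) ^ (m + 1)))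
          * Complex.exp (((-n : ℤ) : ℂ) * Complex.I * θ)
      continuous_toFun := by fun_prop }
  have hnorm : ∀ (k : ℤ) (θ : ℝ), ‖Complex.exp ((k : ℂ) * Complex.I * θ)‖ = 1 := by
    intro k θ
    have := Complex.norm_exp_ofReal_mul_I (k * θ)
    rwa [show ((k * θ : ℝ) : ℂ) * Complex.I = (k : ℂ) * Complex.I * θ by push_cast; ring] at this
  have hFle : ∀ m θ, ‖F m θ‖ ≤ 2 * Real.exp (-s) ^ (m + 1) := by
    intro m θ
    simp only [F, ContinuousMap.coe_mk]
    rw [norm_mul, hnorm, mul_one, norm_mul, norm_neg, Complex.norm_I, one_mul]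
    refine (norm_sub_le _ _).trans ?_
    have e1 := hnorm 1 θ
    have e2 := hnorm (-1) θ
    simp only [Int.cast_one, one_mul, Int.cast_neg, neg_mul] at e1 e2
    rw [norm_pow, norm_pow, norm_mul, norm_mul, norm_neg, hEn, neg_mul, e1, e2, mul_one]
    linarith
  have hsum : HasSum (fun m => ∫ θ in (-Real.pi)..Real.pi, F m θ)
      (∫ θ in (-Real.pi)..Real.pi,
      ((Real.sin (θ + Real.pi) / (Real.cosh s - Real.cos (θ + Real.pi)) : ℝ) : ℂ)
        * Complex.exp (((-n : ℤ) : ℂ) * Complex.I * θ)) := by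
    refine intervalIntegral.hasSum_integral_of_dominated_convergence
      (fun m _ => 2 * Real.exp (-s) ^ (m + 1)) (fun m => (F m).continuous.aestronglyMeasurable)
      (fun m => Filter.Eventually.of_forall fun θ _ => hFle m θ)
      (Filter.Eventually.of_forall fun θ _ => ?_) ?_
      (Filter.Eventually.of_forall fun θ _ => (hasSum_conjPoisson hs θ).mul_right _)
    · have := (summable_geometric_of_lt_one (Real.exp_pos (-s)).le hE1).mul_left
        (2 * Real.exp (-s))
      refine this.congr fun m => ?_
      rw [pow_succ]; ring
    · exact _root_.intervalIntegrable_const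
  have hterm : ∀ m, ∫ θ in (-Real.pi)..Real.pi, F m θ = -Complex.I * (-E) ^ (m + 1)
      * ((if (m + 1 : ℤ) - n = 0 then 2 * (Real.pi : ℂ) else 0)
        - (if -(m + 1 : ℤ) - n = 0 then 2 * (Real.pi : ℂ) else 0)) := by
    intro m
    rw [← integral_exp_int_mul, ← integral_exp_int_mul, ← intervalIntegral.integral_sub
      (Continuous.intervalIntegrable (by fun_prop) _ _)
      (Continuous.intervalIntegrable (by fun_prop) _ _), ← intervalIntegral.integral_const_mul]
    congr 1
    ext θ
    simp only [F, ContinuousMap.coe_mk]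
    rw [mul_pow, mul_pow, ← Complex.exp_nat_mul, ← Complex.exp_nat_mul]
    have e1 : Complex.exp ((((m + 1 : ℤ) - n : ℤ) : ℂ) * Complex.I * θ)
        = Complex.exp (((m + 1 : ℕ) : ℂ) * (Complex.I * θ))
          * Complex.exp (((-n : ℤ) : ℂ) * Complex.I * θ) := by
      rw [← Complex.exp_add]; congr 1; push_cast; ring
    have e2 : Complex.exp (((-(m + 1 : ℤ) - n : ℤ) : ℂ) * Complex.I * θ)
        = Complex.exp (((m + 1 : ℕ) : ℂ) * (-Complex.I * θ))
          * Complex.exp (((-n : ℤ) : ℂ) * Complex.I * θ) := by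
      rw [← Complex.exp_add]; congr 1; push_cast; ring
    rw [e1, e2]
    ring
  -- Only the term with m + 1 = |n| can survive. For n = 0 the truncated subtraction selects m = 0,
  -- whose integral is zero, in agreement with the sign of 0.
  have hval : -Complex.I * (-1) ^ n.natAbs * (2 * Real.pi) * n.sign
      * (Real.exp (-(n.natAbs : ℝ) * s)) = ∫ θ in (-Real.pi)..Real.pi, F (n.natAbs - 1) θ := by
    have hpow : ∀ k : ℕ, (-E) ^ k = (-1) ^ k * (Real.exp (-(k : ℝ) * s) : ℂ) := by
      intro k
      rw [neg_pow, hE, ← Complex.ofReal_pow, ← Real.exp_nat_mul]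
      congr 3; ring
    rw [hterm]
    rcases lt_trichotomy n 0 with h | h | h
    · have h1 : n.natAbs - 1 + 1 = n.natAbs := by omega
      have h2 : ((n.natAbs - 1 : ℕ) : ℤ) + 1 = -n := by omega
      rw [h1, h2, hpow, Int.sign_eq_neg_one_of_neg h, if_neg (by omega), if_pos (by omega)]
      push_cast; ring
    · subst h
      simp
    · have h1 : n.natAbs - 1 + 1 = n.natAbs := by omega
      have h2 : ((n.natAbs - 1 : ℕ) : ℤ) + 1 = n := by omega
      rw [h1, h2, hpow, Int.sign_eq_one_of_pos h, if_pos (by omega), if_neg (by omega)]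
      push_cast; ring
  rw [hval]
  refine hsum.unique (hasSum_single _ fun m hm => ?_)
  rw [hterm, if_neg (by omega), if_neg (by omega), sub_zero, mul_zero]

/-- A mass bound uniform in θ, which justifies exchanging the θ and s integrals in the Fourier
coefficients. -/
theorem integral_abs_diffWeight_three_le {α : ℝ} (hα : |α| < 1) (θ : ℝ) :
    ∫ s in Ioi (0 : ℝ), |diffWeight α θ s 3| ≤ 2 / (1 - |α|) + Real.pi := by
  have hI : 0 < 2 / (1 - |α|) := div_pos two_pos (by linarith)
  by_cases hθ : Real.cos (θ / 2) = 0
  · have : ∀ s ∈ Ioi (0 : ℝ), |diffWeight α θ s 3| = 0 := fun s hs => by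
      rw [diffWeight_three α θ hs, sin_add_pi_eq_zero hθ]; simp
    rw [setIntegral_congr_fun measurableSet_Ioi this]
    simp only [integral_zero]
    have := Real.pi_pos
    linarith
  have hd1 := decayingWeight_cosh_div_cosh hα
  have hd2 := decayingWeight_conjPoisson hα hθ
  refine le_trans ?_ (add_le_add hd1.integral_le hd2.integral_le)
  rw [← integral_add hd1.integrableOn hd2.integrableOn]
  refine integral_mono_of_nonneg (Filter.Eventually.of_forall fun s => abs_nonneg _)
    (hd1.integrableOn.add hd2.integrableOn) ?_
  filter_upwards [ae_restrict_mem measurableSet_Ioi] with s hs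
  rw [diffWeight_three α θ hs]
  have hq := hd1.nonneg s hs
  have hp := (cosh_sub_pos (Real.cos_le_one (θ + Real.pi)) hs).le
  refine (abs_add_le _ _).trans (add_le_add ?_ ?_)
  · rw [abs_mul, abs_of_nonneg hq]
    exact mul_le_of_le_one_left hq (Real.abs_sin_le_one _)
  · rw [abs_mul, abs_mul, abs_of_nonneg (mul_nonneg hq (inv_nonneg.mpr hp))]
    exact mul_le_of_le_one_left (mul_nonneg (abs_nonneg _) (mul_nonneg hq (inv_nonneg.mpr hp)))
      (Real.abs_cos_le_one _)

/-- The Fourier coefficients of the third kernel decay without angular loss. -/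
theorem AmplitudeBound.norm_integral_oscIntegral_three_le {δ C : ℝ} {B B' : ℝ → ℂ}
    (hB : AmplitudeBound δ C B B') (hδ : 0 ≤ δ) {α : ℝ} (hα : |α| < 1) (hα0 : α ≠ 0) {r₁ r₂ : ℝ}
    (h₁ : 0 < r₁) (h₂ : 0 < r₂) (n : ℤ) :
    ‖∫ θ in (-Real.pi)..Real.pi, oscIntegral B r₁ r₂ (fun s => diffWeight α θ s 3)
        * Complex.exp (((-n : ℤ) : ℂ) * Complex.I * θ)‖
      ≤ C * (1 + (r₁ + r₂)) ^ (-(3 / 2) - δ) * (1 + min r₁ r₂) ^ (-(1 / 2) : ℝ)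
        * (36 * Real.pi * (1 + 2 / (1 - |α|))) := by
  have hI : 0 < 2 / (1 - |α|) := div_pos two_pos (by linarith)
  have hπ := Real.pi_pos
  set o : ℝ → ℂ := fun s => Complex.exp (Complex.I * (diffDist r₁ r₂ s : ℂ))
    * B (diffDist r₁ r₂ s) with ho
  have hoc : Continuous o := hB.continuous_osc h₁ h₂
  set f : ℝ → ℝ → ℂ := fun θ s => o s * (diffWeight α θ s 3 : ℂ)
    * Complex.exp (((-n : ℤ) : ℂ) * Complex.I * θ) with hf
  have hnorm : ∀ (k : ℤ) (θ : ℝ), ‖Complex.exp ((k : ℂ) * Complex.I * θ)‖ = 1 := by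
    intro k θ
    have := Complex.norm_exp_ofReal_mul_I (k * θ)
    rwa [show ((k * θ : ℝ) : ℂ) * Complex.I = (k : ℂ) * Complex.I * θ by push_cast; ring] at this
  have hwm : Measurable fun p : ℝ × ℝ => diffWeight α p.1 p.2 3 := by
    simp only [diffWeight]; fun_prop
  have hfm : Measurable (Function.uncurry f) := by
    have hom := hoc.measurable
    have e : Function.uncurry f = fun p : ℝ × ℝ => o p.2 * (diffWeight α p.1 p.2 3 : ℂ)
      * Complex.exp (((-n : ℤ) : ℂ) * Complex.I * p.1) := rfl
    rw [e]
    fun_prop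
  have hfn : ∀ θ s, ‖f θ s‖ ≤ C * (1 + (r₁ + r₂)) ^ (-(3 / 2) - δ) * |diffWeight α θ s 3| := by
    intro θ s
    simp only [hf]
    rw [norm_mul, hnorm, mul_one, norm_mul, Complex.norm_real, Real.norm_eq_abs]
    exact mul_le_mul_of_nonneg_right (hB.norm_osc_le hδ h₁ h₂ s) (abs_nonneg _)
  have hwint : ∀ θ, IntegrableOn (fun s => diffWeight α θ s 3) (Ioi 0) := fun θ =>
    integrableOn_diffWeight hα hα0 θ (by simp)
  have hC := hB.pos
  have hP : 0 < (1 + (r₁ + r₂)) ^ (-(3 / 2) - δ) := Real.rpow_pos_of_pos (by linarith) _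
  have hfi : ∀ θ, IntegrableOn (f θ) (Ioi 0) := fun θ =>
    Integrable.mono' ((hwint θ).norm.const_mul _)
      (hfm.comp measurable_prodMk_left).aestronglyMeasurable
      (Filter.Eventually.of_forall fun s => hfn θ s)
  have hprod : Integrable (Function.uncurry f)
      ((volume.restrict (Ioc (-Real.pi) Real.pi)).prod (volume.restrict (Ioi 0))) := by
    rw [integrable_prod_iff hfm.aestronglyMeasurable]
    refine ⟨Filter.Eventually.of_forall fun θ => hfi θ, ?_⟩
    refine Integrable.mono' (g := fun _ => C * (1 + (r₁ + r₂)) ^ (-(3 / 2) - δ)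
      * (2 / (1 - |α|) + Real.pi)) (integrable_const _)
      hfm.norm.stronglyMeasurable.integral_prod_right'.aestronglyMeasurable
      (Filter.Eventually.of_forall fun θ => ?_)
    rw [Real.norm_of_nonneg (integral_nonneg fun s => norm_nonneg _)]
    refine (integral_mono (hfi θ).norm ((hwint θ).norm.const_mul _) fun s => hfn θ s).trans ?_
    rw [integral_const_mul]
    exact mul_le_mul_of_nonneg_left (integral_abs_diffWeight_three_le hα θ) (by positivity)
  -- Integrating in θ first replaces the conjugate Poisson kernel, of height 1/κ, by a multiple of
  -- e^(-|n|s), of height 1.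
  have hswap : ∫ θ in (-Real.pi)..Real.pi, oscIntegral B r₁ r₂ (fun s => diffWeight α θ s 3)
        * Complex.exp (((-n : ℤ) : ℂ) * Complex.I * θ)
      = -Complex.I * (-1) ^ n.natAbs * (2 * Real.pi) * n.sign * oscIntegral B r₁ r₂
        (fun s => Real.exp (-(n.natAbs : ℝ) * s) * Real.cosh (α * s)) := by
    rw [intervalIntegral.integral_of_le (by linarith)]
    have e1 : ∀ θ : ℝ, oscIntegral B r₁ r₂ (fun s => diffWeight α θ s 3)
        * Complex.exp (((-n : ℤ) : ℂ) * Complex.I * θ) = ∫ s in Ioi (0 : ℝ), f θ s := by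
      intro θ
      simp only [hf, oscIntegral]
      rw [integral_mul_const]
    simp_rw [e1]
    rw [integral_integral_swap hprod]
    unfold oscIntegral
    rw [← integral_const_mul]
    refine setIntegral_congr_fun measurableSet_Ioi fun s hs => ?_
    have hc := integral_conjPoisson_mul_exp hs n
    rw [intervalIntegral.integral_of_le (by linarith)] at hc
    have e2 : ∀ θ : ℝ, f θ s = o s * Real.cosh (α * s) *
        (((Real.sin (θ + Real.pi) / (Real.cosh s - Real.cos (θ + Real.pi)) : ℝ) : ℂ)
        * Complex.exp (((-n : ℤ) : ℂ) * Complex.I * θ)) := by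
      intro θ
      simp only [hf, diffWeight]
      push_cast; ring
    simp_rw [e2]
    rw [integral_const_mul, hc]
    simp only [ho]
    push_cast; ring
  rw [hswap]
  have hQ : 0 < (1 + min r₁ r₂) ^ (-(1 / 2) : ℝ) :=
    Real.rpow_pos_of_pos (by have := lt_min h₁ h₂; linarith) _
  by_cases hn : n = 0
  · subst hn
    simp only [Int.sign_zero, Int.cast_zero, mul_zero, zero_mul, norm_zero]
    positivity
  · have hd := hB.norm_oscIntegral_le_decay hδ h₁ h₂
      (decayingWeight_exp_mul_cosh hα (Int.natAbs_ne_zero.mpr hn))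
    have hsign : ‖((n.sign : ℤ) : ℂ)‖ = 1 := by
      rcases Int.lt_or_gt_of_ne hn with h | h
      · simp [Int.sign_eq_neg_one_of_neg h]
      · simp [Int.sign_eq_one_of_pos h]
    rw [norm_mul, norm_mul, norm_mul, norm_mul, hsign, norm_neg, Complex.norm_I, norm_pow, norm_neg,
      norm_one, one_pow, norm_mul, Complex.norm_real, Real.norm_of_nonneg hπ.le]
    simp only [Complex.norm_ofNat, one_mul, mul_one]
    calc _ ≤ 2 * Real.pi * _ := mul_le_mul_of_nonneg_left hd (by positivity)
      _ = _ := by ring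

/-! ### Convolution on the circle -/

instance fact_two_pi_pos : Fact (0 < 2 * Real.pi) := ⟨Real.two_pi_pos⟩

/-- The function descends to the circle, whose Haar measure is invariant under x ↦ θ - x. -/
theorem lintegral_Ioc_comp_sub {ψ : ℝ → ℝ≥0∞} (hψ : Function.Periodic ψ (2 * Real.pi)) (θ : ℝ) :
    ∫⁻ φ in Ioc (-Real.pi) Real.pi, ψ (θ - φ) = ∫⁻ φ in Ioc (-Real.pi) Real.pi, ψ φ := by
  have e : Real.pi = -Real.pi + 2 * Real.pi := by ring
  have h1 := AddCircle.lintegral_preimage (2 * Real.pi) (-Real.pi) hψ.lift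
  have h2 := AddCircle.lintegral_preimage (2 * Real.pi) (-Real.pi)
    (fun x => hψ.lift ((θ : AddCircle (2 * Real.pi)) - x))
  rw [lintegral_sub_left_eq_self, ← h1, ← e] at h2
  have h3 : ∀ φ : ℝ, hψ.lift ((θ : AddCircle (2 * Real.pi)) - (φ : AddCircle (2 * Real.pi)))
      = ψ (θ - φ) := fun φ => by rw [← AddCircle.coe_sub, hψ.lift_coe]
  simpa only [h3, hψ.lift_coe] using h2

theorem fourierCoeffOn_neg_pi_pi (f : ℝ → ℂ) (n : ℤ) (h : -Real.pi < Real.pi) :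
    fourierCoeffOn h f n = (2 * Real.pi : ℝ)⁻¹ * ∫ θ in (-Real.pi)..Real.pi,
      f θ * Complex.exp (((-n : ℤ) : ℂ) * Complex.I * θ) := by
  rw [fourierCoeffOn_eq_integral, show Real.pi - -Real.pi = 2 * Real.pi by ring, one_div,
    Complex.real_smul]
  congr 1
  refine intervalIntegral.integral_congr fun θ _ => ?_
  simp only [fourier_coe_apply, smul_eq_mul]
  rw [mul_comm]
  congr 2
  have : (Real.pi : ℂ) ≠ 0 := by exact_mod_cast Real.pi_ne_zero
  push_cast
  field_simp

theorem norm_exp_int_mul (k : ℤ) (θ : ℝ) : ‖Complex.exp ((k : ℂ) * Complex.I * θ)‖ = 1 := by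
  have := Complex.norm_exp_ofReal_mul_I (k * θ)
  rwa [show ((k * θ : ℝ) : ℂ) * Complex.I = (k : ℂ) * Complex.I * θ by push_cast; ring] at this

theorem periodic_exp_int_mul (k : ℤ) :
    Function.Periodic (fun θ : ℝ => Complex.exp ((k : ℂ) * Complex.I * θ)) (2 * Real.pi) := by
  intro θ
  have e : (k : ℂ) * Complex.I * ((θ + 2 * Real.pi : ℝ) : ℂ)
      = (k : ℂ) * Complex.I * θ + (k : ℂ) * (2 * Real.pi * Complex.I) := by push_cast; ring
  simp only [e, Complex.exp_add, Complex.exp_int_mul_two_pi_mul_I, mul_one]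

/-- A convolution operator on the circle is bounded on `L²` by the supremum of the Fourier
coefficients of its kernel. -/
theorem lintegral_enorm_convolution_sq_le {k F : ℝ → ℂ} {A M : ℝ} (hk : Measurable k)
    (hper : Function.Periodic k (2 * Real.pi)) (hA : ∀ θ, ‖k θ‖ ≤ A) (hM0 : 0 < M)
    (hM : ∀ n : ℤ, ‖∫ θ in (-Real.pi)..Real.pi,
      k θ * Complex.exp (((-n : ℤ) : ℂ) * Complex.I * θ)‖ ≤ M)
    (hF : Measurable F) :
    ∫⁻ θ in Ioc (-Real.pi) Real.pi, ‖∫ φ in Ioc (-Real.pi) Real.pi, k (θ - φ) * F φ‖ₑ ^ 2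
      ≤ ENNReal.ofReal M ^ 2 * ∫⁻ φ in Ioc (-Real.pi) Real.pi, ‖F φ‖ₑ ^ 2 := by
  have hlt : -Real.pi < Real.pi := by linarith [Real.pi_pos]
  have hπ2 : (0 : ℝ) < 2 * Real.pi := Real.two_pi_pos
  set μ := volume.restrict (Ioc (-Real.pi) Real.pi) with hμ
  -- When F is not square integrable the right side is infinite, because M > 0.
  by_cases hfin : ∫⁻ φ, ‖F φ‖ₑ ^ 2 ∂μ = ⊤
  · rw [hfin, ENNReal.mul_top (by positivity)]
    exact le_top
  have hF2 : MemLp F 2 μ := by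
    refine ⟨hF.aestronglyMeasurable, ?_⟩
    rw [eLpNorm_lt_top_iff_lintegral_rpow_enorm_lt_top two_ne_zero ENNReal.ofNat_ne_top]
    simpa using lt_top_iff_ne_top.mpr hfin
  have hF1 : Integrable F μ := hF2.integrable (by norm_num)
  set u : ℝ → ℂ := fun θ => ∫ φ, k (θ - φ) * F φ ∂μ with hu
  have hjm : Measurable fun p : ℝ × ℝ => k (p.1 - p.2) * F p.2 := by fun_prop
  have hum : StronglyMeasurable u := hjm.stronglyMeasurable.integral_prod_right'
  have hub : ∀ θ, ‖u θ‖ ≤ A * ∫ φ, ‖F φ‖ ∂μ := by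
    intro θ
    rw [← integral_const_mul]
    refine norm_integral_le_of_norm_le (hF1.norm.const_mul _)
      (Filter.Eventually.of_forall fun φ => ?_)
    rw [norm_mul]
    exact mul_le_mul_of_nonneg_right (hA _) (norm_nonneg _)
  have hu2 : MemLp u 2 μ := MemLp.of_bound hum.aestronglyMeasurable _
    (Filter.Eventually.of_forall hub)
  -- The coefficients of u and F carry the same normalization 1/(2π), so the multiplier is the
  -- unnormalized coefficient of k, which M bounds.
  have hcoeff : ∀ n : ℤ, fourierCoeffOn hlt u n
      = (∫ θ in (-Real.pi)..Real.pi, k θ * Complex.exp (((-n : ℤ) : ℂ) * Complex.I * θ))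
        * fourierCoeffOn hlt F n := by
    intro n
    rw [fourierCoeffOn_neg_pi_pi, fourierCoeffOn_neg_pi_pi, mul_left_comm]
    congr 1
    set e : ℝ → ℂ := fun θ => Complex.exp (((-n : ℤ) : ℂ) * Complex.I * θ) with he
    have hem : Measurable e := by fun_prop
    have hadd : ∀ θ φ : ℝ, e θ = e (θ - φ) * e φ := by
      intro θ φ
      simp only [he]
      rw [← Complex.exp_add]; congr 1; push_cast; ring
    change (∫ θ in (-Real.pi)..Real.pi, u θ * e θ)
      = (∫ θ in (-Real.pi)..Real.pi, k θ * e θ) * ∫ θ in (-Real.pi)..Real.pi, F θ * e θ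
    rw [intervalIntegral.integral_of_le hlt.le,
      intervalIntegral.integral_of_le hlt.le (f := fun θ => F θ * e θ)]
    have h1 : ∀ θ, u θ * e θ = ∫ φ, k (θ - φ) * F φ * e θ ∂μ := fun θ => by
      rw [integral_mul_const]
    simp_rw [h1]
    rw [integral_integral_swap]
    · rw [← integral_const_mul]
      refine integral_congr_ae (Filter.Eventually.of_forall fun φ => ?_)
      have h2 : ∀ θ, k (θ - φ) * F φ * e θ = (k (θ - φ) * e (θ - φ)) * (F φ * e φ) := fun θ => by
        rw [hadd θ φ]; ring
      simp_rw [h2]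
      rw [integral_mul_const]
      congr 1
      rw [← intervalIntegral.integral_of_le hlt.le,
        intervalIntegral.integral_comp_sub_right (fun t => k t * e t) φ]
      have hp : Function.Periodic (fun t => k t * e t) (2 * Real.pi) :=
        hper.mul (periodic_exp_int_mul (-n))
      have := hp.intervalIntegral_add_eq (-Real.pi - φ) (-Real.pi)
      rwa [show -Real.pi - φ + 2 * Real.pi = Real.pi - φ by ring,
        show -Real.pi + 2 * Real.pi = Real.pi by ring] at this
    · refine Integrable.mono' (g := fun p : ℝ × ℝ => A * ‖F p.2‖)
        ((hF1.norm.const_mul A).comp_snd _) (by fun_prop) (Filter.Eventually.of_forall fun p => ?_)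
      simp only [Function.uncurry]
      rw [norm_mul, norm_mul, norm_exp_int_mul, mul_one]
      exact mul_le_mul_of_nonneg_right (hA _) (norm_nonneg _)
  have hsu := hasSum_sq_fourierCoeffOn hlt hu2
  have hsF := hasSum_sq_fourierCoeffOn hlt hF2
  have hle := hasSum_le (fun n : ℤ => ?_) hsu (hsF.mul_left (M ^ 2))
  rotate_left
  · rw [hcoeff, norm_mul, mul_pow]
    gcongr
    exact hM n
  rw [intervalIntegral.integral_of_le hlt.le, intervalIntegral.integral_of_le hlt.le, smul_eq_mul,
    smul_eq_mul, mul_left_comm] at hle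
  have hle' := le_of_mul_le_mul_left hle (inv_pos.mpr (by linarith))
  have hconv : ∀ g : ℝ → ℂ, MemLp g 2 μ →
      ∫⁻ θ, ‖g θ‖ₑ ^ 2 ∂μ = ENNReal.ofReal (∫ θ, ‖g θ‖ ^ 2 ∂μ) := by
    intro g hg
    rw [ofReal_integral_eq_lintegral_ofReal (hg.integrable_norm_pow two_ne_zero)
      (Filter.Eventually.of_forall fun θ => by positivity)]
    refine lintegral_congr fun θ => ?_
    rw [ENNReal.ofReal_pow (norm_nonneg _), ofReal_norm]
  rw [hconv u hu2, hconv F hF2, ← ENNReal.ofReal_pow hM0.le, ← ENNReal.ofReal_mul (by positivity)]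
  exact ENNReal.ofReal_le_ofReal hle'

/-! ### Polar coordinates in the plane -/

/-- The point of the plane with polar coordinates `(r, φ)`. -/
def polarPoint (r φ : ℝ) : Plane := !₂[r * Real.cos φ, r * Real.sin φ]

/-- The measure `r dr` on `(0, ∞)`. -/
def radialMeasure : Measure ℝ := (volume.restrict (Ioi 0)).withDensity ENNReal.ofReal

/-- Lebesgue measure on `(-π, π]`. -/
def angularMeasure : Measure ℝ := volume.restrict (Ioc (-Real.pi) Real.pi)

instance : IsFiniteMeasure angularMeasure := by unfold angularMeasure; infer_instance

instance : SFinite radialMeasure := by unfold radialMeasure; infer_instance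

theorem ae_radialMeasure_pos : ∀ᵐ r ∂radialMeasure, 0 < r :=
  (withDensity_absolutelyContinuous _ _).ae_le (ae_restrict_mem measurableSet_Ioi)

theorem ae_angularMeasure_mem : ∀ᵐ φ ∂angularMeasure, φ ∈ Ioc (-Real.pi) Real.pi :=
  ae_restrict_mem measurableSet_Ioc

theorem lintegral_radialMeasure {f : ℝ → ℝ≥0∞} (hf : Measurable f) :
    ∫⁻ r, f r ∂radialMeasure = ∫⁻ r in Ioi (0 : ℝ), ENNReal.ofReal r * f r :=
  lintegral_withDensity_eq_lintegral_mul _ ENNReal.measurable_ofReal hf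

theorem measurePreserving_polarCoord_symm :
    MeasurePreserving polarCoord.symm (radialMeasure.prod angularMeasure)
      (volume : Measure (ℝ × ℝ)) := by
  refine ⟨continuous_polarCoord_symm.measurable, ?_⟩
  ext s hs
  rw [Measure.map_apply continuous_polarCoord_symm.measurable hs, ← lintegral_indicator_one hs,
    ← lintegral_comp_polarCoord_symm, radialMeasure, angularMeasure,
    prod_withDensity_left ENNReal.measurable_ofReal, Measure.prod_restrict,
    withDensity_apply _ (continuous_polarCoord_symm.measurable hs),
    ← lintegral_indicator (continuous_polarCoord_symm.measurable hs), polarCoord_target]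
  -- The polar chart omits the ray φ = π, which is a null set.
  have hset : (Ioi (0 : ℝ) ×ˢ Ioc (-Real.pi) Real.pi : Set (ℝ × ℝ))
      =ᵐ[(volume : Measure ℝ).prod volume] (Ioi (0 : ℝ) ×ˢ Ioo (-Real.pi) Real.pi : Set (ℝ × ℝ)) :=
    Measure.set_prod_ae_eq Filter.EventuallyEq.rfl Ioo_ae_eq_Ioc.symm
  rw [Measure.restrict_congr_set hset]
  refine lintegral_congr fun p => ?_
  by_cases h : polarCoord.symm p ∈ s
  · have : p ∈ polarCoord.symm ⁻¹' s := h
    rw [indicator_of_mem this, indicator_of_mem h]; simp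
  · have : p ∉ polarCoord.symm ⁻¹' s := h
    rw [indicator_of_notMem this, indicator_of_notMem h]; simp

theorem measurePreserving_polarPoint :
    MeasurePreserving (fun p : ℝ × ℝ => polarPoint p.1 p.2)
      (radialMeasure.prod angularMeasure) volume := by
  have h := (PiLp.volume_preserving_toLp (Fin 2)).comp
    (((volume_preserving_finTwoArrow ℝ).symm).comp measurePreserving_polarCoord_symm)
  convert! h using 1

theorem measurable_polarPoint : Measurable fun p : ℝ × ℝ => polarPoint p.1 p.2 :=
  measurePreserving_polarPoint.measurable

theorem lintegral_plane {F : Plane → ℝ≥0∞} (hF : Measurable F) :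
    ∫⁻ x, F x = ∫⁻ r, ∫⁻ φ, F (polarPoint r φ) ∂angularMeasure ∂radialMeasure := by
  rw [← measurePreserving_polarPoint.lintegral_comp hF,
    lintegral_prod (fun p : ℝ × ℝ => F (polarPoint p.1 p.2))
      (hF.comp measurable_polarPoint).aemeasurable]

theorem integral_plane {F : Plane → ℂ} (hF : Integrable F) :
    ∫ x, F x = ∫ r, ∫ φ, F (polarPoint r φ) ∂angularMeasure ∂radialMeasure := by
  have hmap := measurePreserving_polarPoint.map_eq
  rw [← hmap, integral_map measurable_polarPoint.aemeasurable (hmap ▸ hF.aestronglyMeasurable)]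
  exact integral_prod _ ((measurePreserving_polarPoint.integrable_comp
    hF.aestronglyMeasurable).mpr hF)

theorem norm_polarPoint {r : ℝ} (hr : 0 < r) (φ : ℝ) : ‖polarPoint r φ‖ = r := by
  rw [polarPoint, EuclideanSpace.norm_eq, Fin.sum_univ_two]
  simp only [Real.norm_eq_abs, sq_abs]
  have : (!₂[r * Real.cos φ, r * Real.sin φ] : Plane) 0 ^ 2
      + (!₂[r * Real.cos φ, r * Real.sin φ] : Plane) 1 ^ 2 = r ^ 2 := by
    simp only [Matrix.cons_val_zero, Matrix.cons_val_one]
    linear_combination r ^ 2 * Real.cos_sq_add_sin_sq φ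
  rw [this, Real.sqrt_sq hr.le]

theorem polarAngle_polarPoint {r φ : ℝ} (hr : 0 < r) (hφ : φ ∈ Ioc (-Real.pi) Real.pi) :
    ∃ n : ℤ, polarAngle (polarPoint r φ) = φ - n * (2 * Real.pi) := by
  have h : Complex.arg ⟨(polarPoint r φ) 0, (polarPoint r φ) 1⟩ = φ := by
    refine Eq.trans (congrArg Complex.arg ?_) (Complex.arg_mul_cos_add_sin_mul_I hr hφ)
    apply Complex.ext <;> simp [polarPoint, Complex.cos_ofReal_re, Complex.sin_ofReal_re]
  refine ⟨toIcoDiv Real.two_pi_pos 0 φ, ?_⟩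
  rw [polarAngle, h, toIcoMod, zsmul_eq_mul]

theorem measurable_polarAngle : Measurable polarAngle := by
  have h : polarAngle = fun x => 0 + Int.fract ((Complex.arg ⟨x 0, x 1⟩ - 0) / (2 * Real.pi))
      * (2 * Real.pi) := by
    ext x
    rw [polarAngle, toIcoMod_eq_add_fract_mul]
  rw [h]
  have h1 : Measurable fun x : Plane => Complex.arg ⟨x 0, x 1⟩ := by
    have h2 : Measurable fun x : Plane => (x 0, x 1) := by fun_prop
    exact Complex.measurable_arg.comp
      (Complex.measurableEquivRealProd.symm.measurable.comp h2)
  fun_prop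

/-- `polarAngle` takes values in [0, 2π) whereas `angularMeasure` lives on (-π, π]; the discrepancy
is a multiple of 2π, invisible to periodic functions. -/
theorem comp_polarAngle_sub {β : Type*} {g : ℝ → β} (hg : Function.Periodic g (2 * Real.pi))
    (θ : ℝ) {r φ : ℝ} (hr : 0 < r) (hφ : φ ∈ Ioc (-Real.pi) Real.pi) :
    g (θ - polarAngle (polarPoint r φ)) = g (θ - φ) := by
  obtain ⟨n, hn⟩ := polarAngle_polarPoint hr hφ
  rw [hn, show θ - (φ - n * (2 * Real.pi)) = θ - φ + n * (2 * Real.pi) by ring]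
  exact hg.int_mul n _

theorem comp_polarAngle_sub' {β : Type*} {g : ℝ → β} (hg : Function.Periodic g (2 * Real.pi))
    (θ : ℝ) {r φ : ℝ} (hr : 0 < r) (hφ : φ ∈ Ioc (-Real.pi) Real.pi) :
    g (polarAngle (polarPoint r φ) - θ) = g (φ - θ) := by
  obtain ⟨n, hn⟩ := polarAngle_polarPoint hr hφ
  rw [hn, show φ - n * (2 * Real.pi) - θ = φ - θ - n * (2 * Real.pi) by ring]
  exact hg.sub_int_mul_eq n

theorem ae_ne_zero_plane : ∀ᵐ x : Plane, x ≠ 0 :=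
  compl_mem_ae_iff.mpr (measure_singleton (0 : Plane))

/-! ### Kernels in polar coordinates -/

/-- Bounds on a kernel `k (r₁, r₂, θ)`, `2π`-periodic in `θ` and supported in `r₁, r₂ ≤ 2 L`. -/
structure KernelBound (k : ℝ → ℝ → ℝ → ℂ) (L A : ℝ) : Prop where
  one_le : 1 ≤ L
  pos : 0 < A
  measurable : Measurable fun p : ℝ × ℝ × ℝ => k p.1 p.2.1 p.2.2
  periodic : ∀ r₁ r₂, Function.Periodic (k r₁ r₂) (2 * Real.pi)
  norm_le : ∀ r₁ r₂ θ, 0 < r₁ → 0 < r₂ → ‖k r₁ r₂ θ‖ ≤ A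
  support : ∀ r₁ r₂ θ, 0 < r₁ → 0 < r₂ → k r₁ r₂ θ ≠ 0 → r₁ ≤ 2 * L ∧ r₂ ≤ 2 * L
  cos_mul_norm_le : ∀ r₁ r₂ θ, 0 < r₁ → 0 < r₂ →
    |Real.cos (θ / 2)| * ‖k r₁ r₂ θ‖ ≤ A * (1 + min r₁ r₂) ^ (-(1 / 2) : ℝ)
  fourier_le : ∀ r₁ r₂, 0 < r₁ → 0 < r₂ → ∀ n : ℤ,
    ‖∫ θ in (-Real.pi)..Real.pi, k r₁ r₂ θ * Complex.exp (((-n : ℤ) : ℂ) * Complex.I * θ)‖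
      ≤ A * (1 + min r₁ r₂) ^ (-(1 / 2) : ℝ)

namespace KernelBound

variable {k : ℝ → ℝ → ℝ → ℂ} {L A : ℝ}

theorem measurable_planeKernel (hk : KernelBound k L A) :
    Measurable fun p : Plane × Plane => planeKernel k p.1 p.2 := by
  have := measurable_polarAngle
  have h : Measurable fun p : Plane × Plane =>
      (‖p.1‖, ‖p.2‖, polarAngle p.1 - polarAngle p.2) := by fun_prop
  exact hk.measurable.comp h

theorem norm_planeKernel_le (hk : KernelBound k L A) {x y : Plane} (hx : x ≠ 0) (hy : y ≠ 0) :
    ‖planeKernel k x y‖ ≤ (Metric.closedBall (0 : Plane) (2 * L)).indicator (fun _ => A) y := by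
  have h := hk.support ‖x‖ ‖y‖ (polarAngle x - polarAngle y) (norm_pos_iff.mpr hx)
    (norm_pos_iff.mpr hy)
  by_cases h0 : planeKernel k x y = 0
  · rw [h0, norm_zero]
    exact indicator_nonneg (fun _ _ => hk.pos.le) _
  · rw [indicator_of_mem (by simpa using (h h0).2)]
    exact hk.norm_le _ _ _ (norm_pos_iff.mpr hx) (norm_pos_iff.mpr hy)

theorem integrable_planeKernel_mul (hk : KernelBound k L A) {p : ℝ≥0∞} (hp : 1 ≤ p) {f : Plane → ℂ}
    (hf : MemLp f p volume) {x : Plane} (hx : x ≠ 0) :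
    Integrable fun y => planeKernel k x y * f y := by
  have hf1 : IntegrableOn f (Metric.closedBall (0 : Plane) (2 * L)) := by
    have : IsFiniteMeasure (volume.restrict (Metric.closedBall (0 : Plane) (2 * L))) :=
      isFiniteMeasure_restrict.mpr measure_closedBall_lt_top.ne
    exact (hf.restrict _).integrable hp
  refine Integrable.mono' (g := (Metric.closedBall (0 : Plane) (2 * L)).indicator
    fun y => A * ‖f y‖) ?_ ?_ ?_
  · exact IntegrableOn.integrable_indicator (f := fun y => A * ‖f y‖) (hf1.norm.const_mul A)
      measurableSet_closedBall
  · exact ((hk.measurable_planeKernel.comp measurable_prodMk_left).aestronglyMeasurable).mul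
      hf.aestronglyMeasurable
  · filter_upwards [ae_ne_zero_plane] with y hy
    rw [norm_mul]
    refine (mul_le_mul_of_nonneg_right (hk.norm_planeKernel_le hx hy) (norm_nonneg _)).trans
      (le_of_eq ?_)
    by_cases h : y ∈ Metric.closedBall (0 : Plane) (2 * L)
    · rw [indicator_of_mem h, indicator_of_mem h]
    · rw [indicator_of_notMem h, indicator_of_notMem h, zero_mul]

/-- It suffices to bound the operator on strongly measurable functions. -/
theorem lpNormBound (hk : KernelBound k L A) {p : ℝ≥0∞} (hp : 1 ≤ p) {M : ℝ}
    (h : ∀ f : Plane → ℂ, StronglyMeasurable f → MemLp f p volume →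
      eLpNorm (integralOperator (planeKernel k) f) p volume
        ≤ ENNReal.ofReal M * eLpNorm f p volume) :
    LpNormBound (planeKernel k) p M := by
  intro f hf
  have hint : ∀ᵐ x : Plane, Integrable (fun y : Plane => planeKernel k x y * f y) volume := by
    filter_upwards [ae_ne_zero_plane] with x hx
    exact hk.integrable_planeKernel_mul hp hf hx
  set g := hf.aestronglyMeasurable.mk f with hg
  have hfg : f =ᵐ[volume] g := hf.aestronglyMeasurable.ae_eq_mk
  have hgm : StronglyMeasurable g := hf.aestronglyMeasurable.stronglyMeasurable_mk
  have hop : integralOperator (planeKernel k) f = integralOperator (planeKernel k) g := by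
    ext x
    refine integral_congr_ae ?_
    filter_upwards [hfg] with y hy
    rw [hy]
  have hgL : MemLp g p volume := (memLp_congr_ae hfg).mp hf
  have hbd := h g hgm hgL
  have hmeas : StronglyMeasurable (integralOperator (planeKernel k) g) :=
    (hk.measurable_planeKernel.stronglyMeasurable.mul
      (hgm.comp_measurable measurable_snd)).integral_prod_right'
  rw [hop, eLpNorm_congr_ae hfg]
  exact ⟨hint, ⟨hmeas.aestronglyMeasurable, hbd.trans_lt
    (ENNReal.mul_lt_top ENNReal.ofReal_lt_top hgL.2)⟩, hbd⟩

/-- The trivial bound on `L^∞`. -/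
theorem lpNormBound_top (hk : KernelBound k L A) :
    LpNormBound (planeKernel k) ⊤
      (4 * (volume (Metric.ball (0 : Plane) 1)).toReal * (A * L ^ 2)) := by
  refine hk.lpNormBound le_top fun f hfm hf => ?_
  have hA := hk.pos
  have hL := hk.one_le
  have hfin : eLpNormEssSup f volume ≠ ⊤ := by
    have := hf.2.ne; rwa [eLpNorm_exponent_top] at this
  rw [eLpNorm_exponent_top, eLpNorm_exponent_top]
  refine essSup_le_of_ae_le _ ?_
  filter_upwards [ae_ne_zero_plane] with x hx
  have hball : volume (Metric.closedBall (0 : Plane) (2 * L))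
      = ENNReal.ofReal (4 * L ^ 2 * (volume (Metric.ball (0 : Plane) 1)).toReal) := by
    rw [Measure.addHaar_closedBall _ _ (by positivity), ENNReal.ofReal_mul (by positivity),
      ENNReal.ofReal_toReal measure_ball_lt_top.ne]
    congr 2
    rw [finrank_euclideanSpace_fin]; ring
  calc ‖integralOperator (planeKernel k) f x‖ₑ
      ≤ ∫⁻ y, ‖planeKernel k x y * f y‖ₑ := enorm_integral_le_lintegral_enorm _
    _ ≤ ∫⁻ y, (Metric.closedBall (0 : Plane) (2 * L)).indicator
          (fun _ => ENNReal.ofReal A * eLpNormEssSup f volume) y := by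
        refine lintegral_mono_ae ?_
        filter_upwards [ae_ne_zero_plane, enorm_ae_le_eLpNormEssSup f volume] with y hy hfy
        have h1 := hk.norm_planeKernel_le hx hy
        rw [enorm_mul]
        by_cases h : y ∈ Metric.closedBall (0 : Plane) (2 * L)
        · rw [indicator_of_mem h] at h1 ⊢
          refine mul_le_mul' ?_ hfy
          rw [← ofReal_norm]
          exact ENNReal.ofReal_le_ofReal h1
        · rw [indicator_of_notMem h] at h1 ⊢
          rw [norm_le_zero_iff.mp h1]; simp
    _ = ENNReal.ofReal A * eLpNormEssSup f volume
          * volume (Metric.closedBall (0 : Plane) (2 * L)) := by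
        rw [lintegral_indicator measurableSet_closedBall, setLIntegral_const]
    _ = _ := by
        rw [hball, mul_right_comm, ← ENNReal.ofReal_mul hA.le]
        congr 2; ring

end KernelBound

/-! ### The bound on `L²` -/

/-- Cauchy–Schwarz for U = W^(1/2) · W^(-1/2) U. -/
theorem sq_lintegral_le_mul {Ω : Type*} [MeasurableSpace Ω] {μ : Measure Ω} {U W : Ω → ℝ≥0∞}
    (hU : AEMeasurable U μ) (hW : AEMeasurable W μ) (h0 : ∀ᵐ x ∂μ, W x ≠ 0 ∧ W x ≠ ⊤) :
    (∫⁻ x, U x ∂μ) ^ 2 ≤ (∫⁻ x, W x ∂μ) * ∫⁻ x, (W x)⁻¹ * U x ^ 2 ∂μ := by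
  have hq : (2 : ℝ).HolderConjugate 2 := Real.HolderConjugate.two_two
  have h := ENNReal.lintegral_mul_le_Lp_mul_Lq μ hq (f := fun x => W x ^ (1 / 2 : ℝ))
    (g := fun x => (W x)⁻¹ ^ (1 / 2 : ℝ) * U x) (hW.pow_const _) ((hW.inv.pow_const _).mul hU)
  have e1 : ∫⁻ x, ((fun x => W x ^ (1 / 2 : ℝ)) * fun x => (W x)⁻¹ ^ (1 / 2 : ℝ) * U x) x ∂μ
      = ∫⁻ x, U x ∂μ := by
    refine lintegral_congr_ae ?_
    filter_upwards [h0] with x hx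
    simp only [Pi.mul_apply]
    rw [← mul_assoc, ← ENNReal.mul_rpow_of_nonneg _ _ (by norm_num),
      ENNReal.mul_inv_cancel hx.1 hx.2, ENNReal.one_rpow, one_mul]
  have e2 : ∀ x, (W x ^ (1 / 2 : ℝ)) ^ (2 : ℝ) = W x := fun x => by
    rw [← ENNReal.rpow_mul]; norm_num
  have e3 : ∀ x, ((W x)⁻¹ ^ (1 / 2 : ℝ) * U x) ^ (2 : ℝ) = (W x)⁻¹ * U x ^ 2 := fun x => by
    rw [ENNReal.mul_rpow_of_nonneg _ _ (by norm_num), ← ENNReal.rpow_mul]; norm_num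
  rw [e1] at h
  simp_rw [e2, e3] at h
  calc (∫⁻ x, U x ∂μ) ^ 2 ≤ ((∫⁻ x, W x ∂μ) ^ (1 / 2 : ℝ)
        * (∫⁻ x, (W x)⁻¹ * U x ^ 2 ∂μ) ^ (1 / 2 : ℝ)) ^ 2 := by gcongr
    _ = _ := by
      rw [mul_pow, ← ENNReal.rpow_natCast, ← ENNReal.rpow_natCast, ← ENNReal.rpow_mul,
        ← ENNReal.rpow_mul]
      norm_num

theorem eLpNorm_le_mul_of_lintegral_le {Ω : Type*} [MeasurableSpace Ω] {μ : Measure Ω}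
    {f g : Ω → ℂ} {p : ℝ≥0∞} (hp0 : p ≠ 0) (hp : p ≠ ⊤) {D : ℝ≥0∞}
    (h : ∫⁻ x, ‖g x‖ₑ ^ p.toReal ∂μ ≤ D ^ p.toReal * ∫⁻ x, ‖f x‖ₑ ^ p.toReal ∂μ) :
    eLpNorm g p μ ≤ D * eLpNorm f p μ := by
  have hpos : 0 < p.toReal := ENNReal.toReal_pos hp0 hp
  rw [eLpNorm_eq_lintegral_rpow_enorm_toReal hp0 hp, eLpNorm_eq_lintegral_rpow_enorm_toReal hp0 hp]
  calc _ ≤ (D ^ p.toReal * ∫⁻ x, ‖f x‖ₑ ^ p.toReal ∂μ) ^ (1 / p.toReal) := by gcongr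
    _ = _ := by
      rw [ENNReal.mul_rpow_of_nonneg _ _ (by positivity), ← ENNReal.rpow_mul,
        mul_one_div_cancel hpos.ne', ENNReal.rpow_one]

/-- The weight `r^{-1/2}` used in the Schur test on `L²`. -/
def schurWeight (r : ℝ) : ℝ≥0∞ := ENNReal.ofReal (r ^ (-(1 / 2) : ℝ))

theorem measurable_schurWeight : Measurable schurWeight := by unfold schurWeight; fun_prop

theorem schurWeight_ne_zero {r : ℝ} (hr : 0 < r) : schurWeight r ≠ 0 := by
  have := Real.rpow_pos_of_pos hr (-(1 / 2) : ℝ)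
  simpa [schurWeight] using this

theorem schurWeight_ne_top (r : ℝ) : schurWeight r ≠ ⊤ := ENNReal.ofReal_ne_top

/-- Against r dr the two terms of the integrand are r₁^(-1/2) r^(1/2) and 1. Each is at most R^(1/2)
r₁^(-1/2), the second because r₁ ≤ R; the interval has length R. The weight is thus reproduced with
constant 2R^(3/2), a gain of R^(1/2) over the area. -/
theorem lintegral_schurWeight_le {R r₁ : ℝ} (h₁ : 0 < r₁) (h₁R : r₁ ≤ R) :
    ∫⁻ r in Iic R, (schurWeight r₁ + schurWeight r) * schurWeight r ∂radialMeasure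
      ≤ ENNReal.ofReal (2 * R ^ (3 / 2 : ℝ)) * schurWeight r₁ := by
  have hR : 0 < R := h₁.trans_le h₁R
  have hm := measurable_schurWeight
  rw [← lintegral_indicator measurableSet_Iic, lintegral_radialMeasure
    (Measurable.indicator (by fun_prop) measurableSet_Iic)]
  have hb : ∀ r ∈ Ioi (0 : ℝ), ENNReal.ofReal r * (Iic R).indicator
      (fun r => (schurWeight r₁ + schurWeight r) * schurWeight r) r
      ≤ (Iic R).indicator (fun _ => ENNReal.ofReal (2 * R ^ (1 / 2 : ℝ)) * schurWeight r₁) r := by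
    intro r hr
    have hr0 : 0 < r := hr
    by_cases h : r ∈ Iic R
    · rw [indicator_of_mem h, indicator_of_mem h]
      have p1 : 0 < r₁ ^ (-(1 / 2) : ℝ) := Real.rpow_pos_of_pos h₁ _
      have p2 : 0 < r ^ (-(1 / 2) : ℝ) := Real.rpow_pos_of_pos hr0 _
      have p3 : 0 < R ^ (1 / 2 : ℝ) := Real.rpow_pos_of_pos hR _
      unfold schurWeight
      rw [← ENNReal.ofReal_add p1.le p2.le, ← ENNReal.ofReal_mul (by positivity),
        ← ENNReal.ofReal_mul hr0.le, ← ENNReal.ofReal_mul (by positivity)]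
      refine ENNReal.ofReal_le_ofReal ?_
      have e1 : r * r ^ (-(1 / 2) : ℝ) * r ^ (-(1 / 2) : ℝ) = 1 := by
        nth_rewrite 1 [← Real.rpow_one r]
        rw [← Real.rpow_add hr0, ← Real.rpow_add hr0]; norm_num
      have e2 : r * r ^ (-(1 / 2) : ℝ) = r ^ (1 / 2 : ℝ) := by
        nth_rewrite 1 [← Real.rpow_one r]
        rw [← Real.rpow_add hr0]; norm_num
      have e3 : r ^ (1 / 2 : ℝ) ≤ R ^ (1 / 2 : ℝ) :=
        Real.rpow_le_rpow hr0.le h (by norm_num)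
      have e4 : 1 ≤ R ^ (1 / 2 : ℝ) * r₁ ^ (-(1 / 2) : ℝ) := by
        have h5 : r₁ ^ (1 / 2 : ℝ) ≤ R ^ (1 / 2 : ℝ) := Real.rpow_le_rpow h₁.le h₁R (by norm_num)
        have h6 : r₁ ^ (1 / 2 : ℝ) * r₁ ^ (-(1 / 2) : ℝ) = 1 := by
          rw [← Real.rpow_add h₁]; norm_num
        exact h6.symm.le.trans (mul_le_mul_of_nonneg_right h5 p1.le)
      calc r * ((r₁ ^ (-(1 / 2) : ℝ) + r ^ (-(1 / 2) : ℝ)) * r ^ (-(1 / 2) : ℝ))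
          = (r * r ^ (-(1 / 2) : ℝ)) * r₁ ^ (-(1 / 2) : ℝ)
            + r * r ^ (-(1 / 2) : ℝ) * r ^ (-(1 / 2) : ℝ) := by ring
        _ ≤ R ^ (1 / 2 : ℝ) * r₁ ^ (-(1 / 2) : ℝ) + R ^ (1 / 2 : ℝ) * r₁ ^ (-(1 / 2) : ℝ) := by
            rw [e1, e2]
            gcongr
        _ = _ := by ring
    · rw [indicator_of_notMem h, mul_zero]; exact zero_le
  refine (setLIntegral_mono_ae' measurableSet_Ioi (Filter.Eventually.of_forall hb)).trans ?_
  rw [lintegral_indicator measurableSet_Iic, setLIntegral_const,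
    Measure.restrict_apply measurableSet_Iic, inter_comm, Ioi_inter_Iic, Real.volume_Ioc, sub_zero,
    mul_right_comm, ← ENNReal.ofReal_mul (by positivity), mul_assoc]
  have : R ^ (1 / 2 : ℝ) * R = R ^ (3 / 2 : ℝ) := by
    nth_rewrite 2 [← Real.rpow_one R]
    rw [← Real.rpow_add hR]; norm_num
  rw [this]

theorem one_add_min_rpow_le {r₁ r₂ σ : ℝ} (h₁ : 0 < r₁) (h₂ : 0 < r₂) :
    (1 + min r₁ r₂) ^ (-σ) ≤ (1 + r₁) ^ (-σ) + (1 + r₂) ^ (-σ) := by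
  have p1 : 0 < (1 + r₁) ^ (-σ) := Real.rpow_pos_of_pos (by linarith) _
  have p2 : 0 < (1 + r₂) ^ (-σ) := Real.rpow_pos_of_pos (by linarith) _
  rcases min_choice r₁ r₂ with h | h <;> rw [h] <;> linarith

theorem one_add_min_rpow_le_rpow {r₁ r₂ : ℝ} (h₁ : 0 < r₁) (h₂ : 0 < r₂) :
    (1 + min r₁ r₂) ^ (-(1 / 2) : ℝ) ≤ r₁ ^ (-(1 / 2) : ℝ) + r₂ ^ (-(1 / 2) : ℝ) :=
  (one_add_min_rpow_le h₁ h₂).trans (add_le_add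
    (Real.rpow_le_rpow_of_nonpos h₁ (by linarith) (by norm_num))
    (Real.rpow_le_rpow_of_nonpos h₂ (by linarith) (by norm_num)))

namespace KernelBound

variable {k : ℝ → ℝ → ℝ → ℂ} {L A : ℝ}

theorem integralOperator_polarPoint (hk : KernelBound k L A) {f : Plane → ℂ}
    (hf : MemLp f 2 volume) {r₁ θ : ℝ} (h₁ : 0 < r₁) (hθ : θ ∈ Ioc (-Real.pi) Real.pi) :
    integralOperator (planeKernel k) f (polarPoint r₁ θ)
      = ∫ r₂, ∫ φ, k r₁ r₂ (θ - φ) * f (polarPoint r₂ φ) ∂angularMeasure ∂radialMeasure := by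
  have hne : polarPoint r₁ θ ≠ 0 := by
    rw [← norm_pos_iff, norm_polarPoint h₁]; exact h₁
  unfold integralOperator
  rw [integral_plane (hk.integrable_planeKernel_mul (by norm_num) hf hne)]
  refine integral_congr_ae ?_
  filter_upwards [ae_radialMeasure_pos] with r₂ h₂
  refine integral_congr_ae ?_
  filter_upwards [ae_angularMeasure_mem] with φ hφ
  unfold planeKernel
  rw [norm_polarPoint h₁, norm_polarPoint h₂, comp_polarAngle_sub (hk.periodic r₁ r₂) _ h₂ hφ,
    comp_polarAngle_sub' (hk.periodic r₁ r₂) _ h₁ hθ]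

/-- The bound on `L²`: Parseval in the angular variable and the Schur test in the radial one. -/
theorem lpNormBound_two (hk : KernelBound k L A) :
    LpNormBound (planeKernel k) 2 (A * (2 * (2 * L) ^ (3 / 2 : ℝ))) := by
  refine hk.lpNormBound (by norm_num) fun f hfm hf => ?_
  have hA := hk.pos
  have hL := hk.one_le
  refine eLpNorm_le_mul_of_lintegral_le two_ne_zero ENNReal.ofNat_ne_top ?_
  simp only [ENNReal.toReal_ofNat, ENNReal.rpow_ofNat]
  set R := 2 * L with hR
  set T := integralOperator (planeKernel k) f with hT
  have hTm : StronglyMeasurable T :=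
    (hk.measurable_planeKernel.stronglyMeasurable.mul
      (hfm.comp_measurable measurable_snd)).integral_prod_right'
  have hw := measurable_schurWeight
  set D : ℝ≥0∞ := ENNReal.ofReal (A * (2 * R ^ (3 / 2 : ℝ))) with hD
  -- M(r₁, r₂) bounds the L² norm on the circle of convolution with k(r₁, r₂, ·); it is symmetric,
  -- so one Schur estimate serves both variables.
  set M : ℝ → ℝ → ℝ≥0∞ := fun r₁ r₂ => ENNReal.ofReal A * (schurWeight r₁ + schurWeight r₂) with hM
  set G : ℝ → ℝ≥0∞ := fun r => ∫⁻ φ, ‖f (polarPoint r φ)‖ₑ ^ 2 ∂angularMeasure with hG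
  set U : ℝ → ℝ → ℝ → ℝ≥0∞ := fun r₁ θ r₂ =>
    ‖∫ φ, k r₁ r₂ (θ - φ) * f (polarPoint r₂ φ) ∂angularMeasure‖ₑ with hU
  have hFm : Measurable fun p : ℝ × ℝ => f (polarPoint p.1 p.2) :=
    hfm.measurable.comp measurable_polarPoint
  have hGm : Measurable G := by
    have : Measurable fun p : ℝ × ℝ => ‖f (polarPoint p.1 p.2)‖ₑ ^ 2 := hFm.enorm.pow_const 2
    exact this.lintegral_prod_right'
  have hUm : ∀ r₁, Measurable fun p : ℝ × ℝ => U r₁ p.1 p.2 := by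
    intro r₁
    have h1 : Measurable fun q : (ℝ × ℝ) × ℝ => k r₁ q.1.2 (q.1.1 - q.2) := by
      have h2 : Measurable fun q : (ℝ × ℝ) × ℝ => (r₁, q.1.2, q.1.1 - q.2) := by fun_prop
      exact hk.measurable.comp h2
    have h3 : Measurable fun q : (ℝ × ℝ) × ℝ => f (polarPoint q.1.2 q.2) := by
      have h4 : Measurable fun q : (ℝ × ℝ) × ℝ => (q.1.2, q.2) := by fun_prop
      exact hFm.comp h4
    exact (h1.mul h3).stronglyMeasurable.integral_prod_right'.measurable.enorm
  have hDw : ∀ r₁, 0 < r₁ → r₁ ≤ R →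
      ∫⁻ r in Iic R, M r₁ r * schurWeight r ∂radialMeasure ≤ D * schurWeight r₁ := by
    intro r₁ h₁ h₁R
    simp only [hM, mul_assoc]
    rw [lintegral_const_mul _ (by fun_prop), hD, ENNReal.ofReal_mul hA.le, mul_assoc]
    exact mul_le_mul' le_rfl (lintegral_schurWeight_le h₁ h₁R)
  have hposR : ∀ᵐ r ∂(radialMeasure.restrict (Iic R)), 0 < r ∧ r ≤ R := by
    filter_upwards [ae_restrict_of_ae ae_radialMeasure_pos, ae_restrict_mem measurableSet_Iic]
      with r h1 h2 using ⟨h1, h2⟩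
  have hM0 : ∀ r₁ r₂, 0 < r₁ → M r₁ r₂ ≠ 0 := by
    intro r₁ r₂ h₁
    simp only [hM]
    refine mul_ne_zero (by simpa using hA) ?_
    simp [schurWeight_ne_zero h₁]
  have hMt : ∀ r₁ r₂, M r₁ r₂ ≠ ⊤ := fun r₁ r₂ =>
    ENNReal.mul_ne_top ENNReal.ofReal_ne_top
      (ENNReal.add_ne_top.mpr ⟨schurWeight_ne_top _, schurWeight_ne_top _⟩)
  have hcirc : ∀ r₁ r₂, 0 < r₁ → 0 < r₂ →
      ∫⁻ θ, U r₁ θ r₂ ^ 2 ∂angularMeasure ≤ M r₁ r₂ ^ 2 * G r₂ := by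
    intro r₁ r₂ h₁ h₂
    have p1 : 0 < r₁ ^ (-(1 / 2) : ℝ) := Real.rpow_pos_of_pos h₁ _
    have p2 : 0 < r₂ ^ (-(1 / 2) : ℝ) := Real.rpow_pos_of_pos h₂ _
    have hkm : Measurable (k r₁ r₂) := by
      have h2 : Measurable fun θ : ℝ => (r₁, r₂, θ) := by fun_prop
      exact hk.measurable.comp h2
    have h := lintegral_enorm_convolution_sq_le (k := k r₁ r₂) (F := fun φ => f (polarPoint r₂ φ))
      (M := A * (r₁ ^ (-(1 / 2) : ℝ) + r₂ ^ (-(1 / 2) : ℝ))) hkm (hk.periodic r₁ r₂)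
      (fun θ => hk.norm_le r₁ r₂ θ h₁ h₂) (by positivity)
      (fun n => (hk.fourier_le r₁ r₂ h₁ h₂ n).trans
        (mul_le_mul_of_nonneg_left (one_add_min_rpow_le_rpow h₁ h₂) hA.le))
      (hFm.comp measurable_prodMk_left)
    rw [ENNReal.ofReal_mul hA.le, ENNReal.ofReal_add p1.le p2.le] at h
    exact h
  -- Cauchy–Schwarz in r₂ with weight M w, where w is the Schur weight, produces (M w)⁻¹ U².
  -- Integrating in θ bounds U² by M² G, leaving M w⁻¹ G. The final integration in r₁ uses the Schur
  -- estimate a second time.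
  have hmain : ∀ r₁, 0 < r₁ → ∫⁻ θ, ‖T (polarPoint r₁ θ)‖ₑ ^ 2 ∂angularMeasure
      ≤ (Iic R).indicator (fun r₁ => D * schurWeight r₁ *
        ∫⁻ r₂ in Iic R, M r₁ r₂ * (schurWeight r₂)⁻¹ * G r₂ ∂radialMeasure) r₁ := by
    intro r₁ h₁
    have hTU : ∀ θ ∈ Ioc (-Real.pi) Real.pi, ‖T (polarPoint r₁ θ)‖ₑ
        ≤ ∫⁻ r₂ in Iic R, U r₁ θ r₂ ∂radialMeasure := by
      intro θ hθ
      rw [hT, hk.integralOperator_polarPoint hf h₁ hθ]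
      refine (enorm_integral_le_lintegral_enorm _).trans ?_
      rw [← lintegral_indicator measurableSet_Iic]
      refine lintegral_mono_ae ?_
      filter_upwards [ae_radialMeasure_pos] with r₂ h₂
      by_cases h : r₂ ∈ Iic R
      · rw [indicator_of_mem h]
      · have h0 : ∀ φ, k r₁ r₂ (θ - φ) = 0 := fun φ => by
          by_contra hne; exact h (hk.support _ _ _ h₁ h₂ hne).2
        simp [h0]
    by_cases hr : r₁ ∈ Iic R
    · rw [indicator_of_mem hr]
      calc ∫⁻ θ, ‖T (polarPoint r₁ θ)‖ₑ ^ 2 ∂angularMeasure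
          ≤ ∫⁻ θ, (D * schurWeight r₁) * ∫⁻ r₂ in Iic R, (M r₁ r₂ * schurWeight r₂)⁻¹
              * U r₁ θ r₂ ^ 2 ∂radialMeasure ∂angularMeasure := by
            refine lintegral_mono_ae ?_
            filter_upwards [ae_angularMeasure_mem] with θ hθ
            refine (pow_le_pow_left' (hTU θ hθ) 2).trans
              ((sq_lintegral_le_mul (W := fun r₂ => M r₁ r₂ * schurWeight r₂) ?_ ?_ ?_).trans ?_)
            · exact ((hUm r₁).comp measurable_prodMk_left).aemeasurable
            · exact (by fun_prop : Measurable fun r₂ => M r₁ r₂ * schurWeight r₂).aemeasurable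
            · filter_upwards [hposR] with r₂ h₂
              exact ⟨mul_ne_zero (hM0 _ _ h₁) (schurWeight_ne_zero h₂.1),
                ENNReal.mul_ne_top (hMt _ _) (schurWeight_ne_top _)⟩
            · exact mul_le_mul' (hDw r₁ h₁ hr) le_rfl
        _ = (D * schurWeight r₁) * ∫⁻ r₂ in Iic R, (M r₁ r₂ * schurWeight r₂)⁻¹
              * ∫⁻ θ, U r₁ θ r₂ ^ 2 ∂angularMeasure ∂radialMeasure := by
            have hm := hUm r₁
            have hm2 : Measurable fun p : ℝ × ℝ => (M r₁ p.2 * schurWeight p.2)⁻¹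
              * U r₁ p.1 p.2 ^ 2 := by fun_prop
            rw [lintegral_const_mul _ hm2.lintegral_prod_right', lintegral_lintegral_swap
              hm2.aemeasurable]
            congr 1
            refine lintegral_congr fun r₂ => ?_
            have hm3 : Measurable fun θ => U r₁ θ r₂ :=
              hm.comp (measurable_prodMk_right (y := r₂))
            exact lintegral_const_mul (μ := angularMeasure) ((M r₁ r₂ * schurWeight r₂)⁻¹)
              (hm3.pow_const 2)
        _ ≤ _ := by
            refine mul_le_mul' le_rfl (lintegral_mono_ae ?_)
            filter_upwards [hposR] with r₂ h₂
            refine (mul_le_mul' le_rfl (hcirc r₁ r₂ h₁ h₂.1)).trans (le_of_eq ?_)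
            rw [ENNReal.mul_inv (Or.inl (hM0 _ _ h₁)) (Or.inl (hMt _ _)), sq]
            calc (M r₁ r₂)⁻¹ * (schurWeight r₂)⁻¹ * (M r₁ r₂ * M r₁ r₂ * G r₂)
                = ((M r₁ r₂)⁻¹ * M r₁ r₂) * (M r₁ r₂ * (schurWeight r₂)⁻¹ * G r₂) := by ring
              _ = _ := by rw [ENNReal.inv_mul_cancel (hM0 _ _ h₁) (hMt _ _), one_mul]
    · rw [indicator_of_notMem hr]
      refine le_of_eq (lintegral_eq_zero_of_ae_eq_zero ?_)
      filter_upwards [ae_angularMeasure_mem] with θ hθ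
      have h0 : T (polarPoint r₁ θ) = 0 := by
        rw [hT, hk.integralOperator_polarPoint hf h₁ hθ]
        refine integral_eq_zero_of_ae ?_
        filter_upwards [ae_radialMeasure_pos] with r₂ h₂
        have h0 : ∀ φ, k r₁ r₂ (θ - φ) = 0 := fun φ => by
          by_contra hne; exact hr (hk.support _ _ _ h₁ h₂ hne).1
        simp [h0]
      simp [h0]
  have hTm' : Measurable fun x => ‖T x‖ₑ ^ 2 := hTm.measurable.enorm.pow_const 2
  have hfm' : Measurable fun x => ‖f x‖ₑ ^ 2 := hfm.measurable.enorm.pow_const 2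
  have hMm : Measurable fun p : ℝ × ℝ => M p.1 p.2 := by fun_prop
  rw [lintegral_plane hTm', lintegral_plane hfm']
  calc ∫⁻ r, ∫⁻ φ, ‖T (polarPoint r φ)‖ₑ ^ 2 ∂angularMeasure ∂radialMeasure
      ≤ ∫⁻ r₁, (Iic R).indicator (fun r₁ => D * schurWeight r₁ *
        ∫⁻ r₂ in Iic R, M r₁ r₂ * (schurWeight r₂)⁻¹ * G r₂ ∂radialMeasure) r₁
          ∂radialMeasure := by
        refine lintegral_mono_ae ?_
        filter_upwards [ae_radialMeasure_pos] with r₁ h₁ using hmain r₁ h₁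
    _ = ∫⁻ r₁ in Iic R, ∫⁻ r₂ in Iic R, D * schurWeight r₁ * (M r₁ r₂ * (schurWeight r₂)⁻¹ * G r₂)
          ∂radialMeasure ∂radialMeasure := by
        rw [lintegral_indicator measurableSet_Iic]
        refine lintegral_congr fun r₁ => ?_
        rw [lintegral_const_mul _ (by fun_prop)]
    _ = ∫⁻ r₂ in Iic R, D * (schurWeight r₂)⁻¹ * G r₂ * ∫⁻ r₁ in Iic R, M r₂ r₁ * schurWeight r₁
          ∂radialMeasure ∂radialMeasure := by
        rw [lintegral_lintegral_swap (by fun_prop)]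
        refine lintegral_congr fun r₂ => ?_
        rw [← lintegral_const_mul _ (by fun_prop)]
        refine lintegral_congr fun r₁ => ?_
        simp only [hM, add_comm (schurWeight r₂)]
        ring
    _ ≤ ∫⁻ r₂ in Iic R, D ^ 2 * G r₂ ∂radialMeasure := by
        refine lintegral_mono_ae ?_
        filter_upwards [hposR] with r₂ h₂
        refine (mul_le_mul' le_rfl (hDw r₂ h₂.1 h₂.2)).trans (le_of_eq ?_)
        calc D * (schurWeight r₂)⁻¹ * G r₂ * (D * schurWeight r₂)
            = D ^ 2 * G r₂ * ((schurWeight r₂)⁻¹ * schurWeight r₂) := by ring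
          _ = _ := by
            rw [ENNReal.inv_mul_cancel (schurWeight_ne_zero h₂.1) (schurWeight_ne_top _), mul_one]
    _ ≤ ∫⁻ r₂, D ^ 2 * G r₂ ∂radialMeasure := lintegral_mono' Measure.restrict_le_self le_rfl
    _ = _ := by rw [lintegral_const_mul _ hGm]

end KernelBound

/-! ### The bounds on `L^p` -/

/-- Schur's test for a kernel `g(x) c(x, y) h(y)`. -/
theorem lintegral_schur_rpow_le {X Y : Type*} [MeasurableSpace X] [MeasurableSpace Y]
    {μ : Measure X} {ν : Measure Y} [SFinite μ] [SFinite ν] {p q : ℝ} (hpq : p.HolderConjugate q)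
    {c : X → Y → ℝ≥0∞} {g : X → ℝ≥0∞} {h f : Y → ℝ≥0∞}
    (hc : Measurable fun z : X × Y => c z.1 z.2) (hg : Measurable g) (hh : Measurable h)
    (hf : Measurable f) {H G : ℝ≥0∞} (hH : ∀ x, ∫⁻ y, c x y * h y ^ q ∂ν ≤ H)
    (hG : ∀ y, ∫⁻ x, c x y * g x ^ p ∂μ ≤ G) :
    (∫⁻ x, (g x * ∫⁻ y, c x y * (h y * f y) ∂ν) ^ p ∂μ) ^ (1 / p)
      ≤ H ^ (1 / q) * G ^ (1 / p) * (∫⁻ y, f y ^ p ∂ν) ^ (1 / p) := by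
  have hp0 : 0 < p := hpq.pos
  have hq0 : 0 < q := hpq.symm.pos
  have hp1 : 0 ≤ 1 / p := by positivity
  have hq1 : 0 ≤ 1 / q := by positivity
  have hcx : ∀ x, Measurable (c x) := fun x => hc.comp measurable_prodMk_left
  have hcy : ∀ y, Measurable fun x => c x y := fun y => hc.comp measurable_prodMk_right
  -- Hölder for c = c^(1/q) c^(1/p), with h attached to the first factor and f to the second.
  have hholder : ∀ x, ∫⁻ y, c x y * (h y * f y) ∂ν
      ≤ H ^ (1 / q) * (∫⁻ y, c x y * f y ^ p ∂ν) ^ (1 / p) := by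
    intro x
    have hx := hcx x
    have h1 := ENNReal.lintegral_mul_le_Lp_mul_Lq ν hpq.symm
      (f := fun y => c x y ^ (1 / q) * h y) (g := fun y => c x y ^ (1 / p) * f y)
      (by fun_prop) (by fun_prop)
    have e1 : ∀ y, ((fun y => c x y ^ (1 / q) * h y) * fun y => c x y ^ (1 / p) * f y) y
        = c x y * (h y * f y) := fun y => by
      have : c x y ^ (1 / q) * c x y ^ (1 / p) = c x y := by
        rw [← ENNReal.rpow_add_of_nonneg _ _ hq1 hp1, one_div, one_div, hpq.symm.inv_add_inv_eq_one,
          ENNReal.rpow_one]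
      simp only [Pi.mul_apply]
      calc c x y ^ (1 / q) * h y * (c x y ^ (1 / p) * f y)
          = c x y ^ (1 / q) * c x y ^ (1 / p) * (h y * f y) := by ring
        _ = _ := by rw [this]
    have e2 : ∀ y, (c x y ^ (1 / q) * h y) ^ q = c x y * h y ^ q := fun y => by
      rw [ENNReal.mul_rpow_of_nonneg _ _ hq0.le, ← ENNReal.rpow_mul, one_div_mul_cancel hq0.ne',
        ENNReal.rpow_one]
    have e3 : ∀ y, (c x y ^ (1 / p) * f y) ^ p = c x y * f y ^ p := fun y => by
      rw [ENNReal.mul_rpow_of_nonneg _ _ hp0.le, ← ENNReal.rpow_mul, one_div_mul_cancel hp0.ne',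
        ENNReal.rpow_one]
    simp_rw [e1, e2, e3] at h1
    refine h1.trans (mul_le_mul' (ENNReal.rpow_le_rpow (hH x) hq1) le_rfl)
  have hcf : Measurable fun z : X × Y => c z.1 z.2 * f z.2 ^ p := by fun_prop
  have hcg : Measurable fun z : X × Y => g z.1 ^ p * (c z.1 z.2 * f z.2 ^ p) := by fun_prop
  have hint : ∫⁻ x, (g x * ∫⁻ y, c x y * (h y * f y) ∂ν) ^ p ∂μ
      ≤ (H ^ (1 / q)) ^ p * (G * ∫⁻ y, f y ^ p ∂ν) := by
    calc ∫⁻ x, (g x * ∫⁻ y, c x y * (h y * f y) ∂ν) ^ p ∂μ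
        ≤ ∫⁻ x, (H ^ (1 / q)) ^ p * (g x ^ p * ∫⁻ y, c x y * f y ^ p ∂ν) ∂μ := by
          refine lintegral_mono fun x => ?_
          refine (ENNReal.rpow_le_rpow (mul_le_mul' le_rfl (hholder x)) hp0.le).trans (le_of_eq ?_)
          rw [ENNReal.mul_rpow_of_nonneg _ _ hp0.le, ENNReal.mul_rpow_of_nonneg _ _ hp0.le,
            ← ENNReal.rpow_mul (∫⁻ y, c x y * f y ^ p ∂ν), one_div_mul_cancel hp0.ne',
            ENNReal.rpow_one]
          ring
      _ = (H ^ (1 / q)) ^ p * ∫⁻ x, ∫⁻ y, g x ^ p * (c x y * f y ^ p) ∂ν ∂μ := by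
          have hm : Measurable fun x => ∫⁻ y, c x y * f y ^ p ∂ν := hcf.lintegral_prod_right'
          rw [lintegral_const_mul _ (by fun_prop)]
          congr 1
          refine lintegral_congr fun x => ?_
          have hx := hcx x
          rw [lintegral_const_mul _ (by fun_prop)]
      _ = (H ^ (1 / q)) ^ p * ∫⁻ y, f y ^ p * ∫⁻ x, c x y * g x ^ p ∂μ ∂ν := by
          rw [lintegral_lintegral_swap hcg.aemeasurable]
          congr 1
          refine lintegral_congr fun y => ?_
          have hy := hcy y
          rw [← lintegral_const_mul _ (by fun_prop)]
          refine lintegral_congr fun x => by ring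
      _ ≤ (H ^ (1 / q)) ^ p * ∫⁻ y, f y ^ p * G ∂ν := by
          refine mul_le_mul' le_rfl (lintegral_mono fun y => mul_le_mul' le_rfl (hG y))
      _ = _ := by rw [lintegral_mul_const _ (by fun_prop), mul_comm G]
  refine (ENNReal.rpow_le_rpow hint hp1).trans (le_of_eq ?_)
  rw [ENNReal.mul_rpow_of_nonneg _ _ hp1, ENNReal.mul_rpow_of_nonneg _ _ hp1, ← ENNReal.rpow_mul,
    mul_one_div_cancel hp0.ne', ENNReal.rpow_one, mul_assoc]

/-- The angular singularity `|cos (θ / 2)|^{-2σ}`. -/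
def angularWeight (σ θ : ℝ) : ℝ≥0∞ := ENNReal.ofReal |Real.cos (θ / 2)| ^ (-(2 * σ))

theorem measurable_angularWeight (σ : ℝ) : Measurable (angularWeight σ) := by
  unfold angularWeight; fun_prop

theorem periodic_angularWeight (σ : ℝ) : Function.Periodic (angularWeight σ) (2 * Real.pi) := by
  intro θ
  unfold angularWeight
  rw [show (θ + 2 * Real.pi) / 2 = θ / 2 + Real.pi by ring, Real.cos_add_pi, abs_neg]

theorem angularWeight_neg (σ θ : ℝ) : angularWeight σ (-θ) = angularWeight σ θ := by
  unfold angularWeight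
  rw [neg_div, Real.cos_neg]

/-- Concavity of the cosine on [0, π/2] gives |cos(θ/2)| ≥ (π - |θ|)/π, and the resulting endpoint
singularities have exponent 2σ < 1. -/
theorem lintegral_angularWeight_lt_top {σ : ℝ} (h0 : 0 < σ) (h1 : σ < 1 / 2) :
    ∫⁻ θ, angularWeight σ θ ∂angularMeasure < ⊤ := by
  have hπ := Real.pi_pos
  have hπp : 0 < Real.pi ^ (-(2 * σ)) := Real.rpow_pos_of_pos hπ _
  set v : ℝ → ℝ := fun θ => (Real.pi - θ) ^ (-(2 * σ)) / Real.pi ^ (-(2 * σ))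
    + (Real.pi + θ) ^ (-(2 * σ)) / Real.pi ^ (-(2 * σ)) with hv
  have hbound : ∀ θ ∈ Ioo (-Real.pi) Real.pi, angularWeight σ θ ≤ ENNReal.ofReal (v θ) := by
    intro θ hθ
    have hm : 0 < (Real.pi - |θ|) / Real.pi :=
      div_pos (by have := abs_lt.mpr hθ; linarith) hπ
    have hcos : (Real.pi - |θ|) / Real.pi ≤ |Real.cos (θ / 2)| := by
      have h2 := Real.one_sub_mul_le_cos (x := |θ| / 2) (by positivity)
        (by have := abs_lt.mpr hθ; linarith)
      have h3 : Real.cos (|θ| / 2) = Real.cos (θ / 2) := by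
        rw [← Real.cos_abs (θ / 2), abs_div, abs_two]
      rw [h3] at h2
      refine le_trans (le_of_eq ?_) (h2.trans (le_abs_self _))
      field_simp
    have p1 : 0 < (Real.pi - θ) ^ (-(2 * σ)) / Real.pi ^ (-(2 * σ)) :=
      div_pos (Real.rpow_pos_of_pos (by linarith [hθ.2]) _) hπp
    have p2 : 0 < (Real.pi + θ) ^ (-(2 * σ)) / Real.pi ^ (-(2 * σ)) :=
      div_pos (Real.rpow_pos_of_pos (by linarith [hθ.1]) _) hπp
    unfold angularWeight
    rw [ENNReal.ofReal_rpow_of_pos (hm.trans_le hcos)]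
    refine ENNReal.ofReal_le_ofReal
      ((Real.rpow_le_rpow_of_nonpos hm hcos (by linarith)).trans ?_)
    simp only [hv]
    rw [Real.div_rpow (by have := abs_lt.mpr hθ; linarith) hπ.le]
    rcases abs_choice θ with h | h <;> rw [h]
    · linarith
    · rw [sub_neg_eq_add]; linarith
  have hint : IntervalIntegrable v volume (-Real.pi) Real.pi := by
    have hr : IntervalIntegrable (fun x : ℝ => x ^ (-(2 * σ))) volume 0 (2 * Real.pi) :=
      intervalIntegral.intervalIntegrable_rpow' (by linarith)
    refine IntervalIntegrable.add (IntervalIntegrable.div_const ?_ _)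
      (IntervalIntegrable.div_const ?_ _)
    · have := (hr.comp_sub_left Real.pi).symm
      rwa [sub_zero, show Real.pi - 2 * Real.pi = -Real.pi by ring] at this
    · have := hr.comp_add_left Real.pi
      rwa [zero_sub, show 2 * Real.pi - Real.pi = Real.pi by ring] at this
  have hle : ∫⁻ θ, angularWeight σ θ ∂angularMeasure ≤ ∫⁻ θ, ENNReal.ofReal (v θ) ∂angularMeasure := by
    unfold angularMeasure
    rw [← Measure.restrict_congr_set Ioo_ae_eq_Ioc]
    exact setLIntegral_mono_ae' measurableSet_Ioo (Filter.Eventually.of_forall hbound)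
  refine hle.trans_lt ?_
  have := (intervalIntegrable_iff_integrableOn_Ioc_of_le (by linarith)).mp hint
  exact this.lintegral_lt_top

/-- The integrand splits in polar coordinates, and translation invariance on the circle removes the
dependence on the angle of x. -/
theorem lintegral_angularWeight_mul (σ : ℝ) (x : Plane) {H : ℝ → ℝ≥0∞} (hH : Measurable H) :
    ∫⁻ y : Plane, angularWeight σ (polarAngle x - polarAngle y) * H ‖y‖
      = (∫⁻ θ, angularWeight σ θ ∂angularMeasure) * ∫⁻ r, H r ∂radialMeasure := by
  have hw := measurable_angularWeight σ
  have hpa := measurable_polarAngle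
  rw [lintegral_plane (by fun_prop), ← lintegral_const_mul _ hH]
  refine lintegral_congr_ae ?_
  filter_upwards [ae_radialMeasure_pos] with r hr
  have : ∫⁻ φ, angularWeight σ (polarAngle x - polarAngle (polarPoint r φ)) * H ‖polarPoint r φ‖
      ∂angularMeasure = ∫⁻ φ, angularWeight σ (polarAngle x - φ) * H r ∂angularMeasure := by
    refine lintegral_congr_ae ?_
    filter_upwards [ae_angularMeasure_mem] with φ hφ
    rw [norm_polarPoint hr, comp_polarAngle_sub (periodic_angularWeight σ) _ hr hφ]
  rw [this, lintegral_mul_const _ (by fun_prop)]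
  congr 1
  exact lintegral_Ioc_comp_sub (periodic_angularWeight σ) _

theorem lintegral_angularWeight_mul' (σ : ℝ) (y : Plane) {H : ℝ → ℝ≥0∞} (hH : Measurable H) :
    ∫⁻ x : Plane, angularWeight σ (polarAngle x - polarAngle y) * H ‖x‖
      = (∫⁻ θ, angularWeight σ θ ∂angularMeasure) * ∫⁻ r, H r ∂radialMeasure := by
  rw [← lintegral_angularWeight_mul σ y hH]
  refine lintegral_congr fun x => ?_
  rw [← angularWeight_neg, neg_sub]

/-! ### Radial integrals -/

theorem lintegral_radial_rpow_le {L s : ℝ} (hL : 1 ≤ L) (hs1 : s ≤ 1) :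
    ∫⁻ r, (Iic (2 * L)).indicator (fun r => ENNReal.ofReal ((1 + r) ^ (-s))) r ∂radialMeasure
      ≤ ENNReal.ofReal ((3 * L) ^ (2 - s)) := by
  rw [lintegral_radialMeasure (Measurable.indicator (by fun_prop) measurableSet_Iic)]
  have hb : ∀ r ∈ Ioi (0 : ℝ), ENNReal.ofReal r * (Iic (2 * L)).indicator
      (fun r => ENNReal.ofReal ((1 + r) ^ (-s))) r
      ≤ (Iic (2 * L)).indicator (fun _ => ENNReal.ofReal ((3 * L) ^ (1 - s))) r := by
    intro r hr
    have hr0 : 0 < r := hr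
    by_cases h : r ∈ Iic (2 * L)
    · rw [indicator_of_mem h, indicator_of_mem h, ← ENNReal.ofReal_mul hr0.le]
      refine ENNReal.ofReal_le_ofReal ?_
      have h' : r ≤ 2 * L := h
      have hp : 0 < (1 + r) ^ (-s) := Real.rpow_pos_of_pos (by linarith) _
      calc r * (1 + r) ^ (-s) ≤ (1 + r) * (1 + r) ^ (-s) := by gcongr; linarith
        _ = (1 + r) ^ (1 - s) := by
          nth_rewrite 1 [← Real.rpow_one (1 + r)]
          rw [← Real.rpow_add (by linarith)]; ring_nf
        _ ≤ (3 * L) ^ (1 - s) :=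
          Real.rpow_le_rpow (by linarith) (by linarith) (by linarith)
    · rw [indicator_of_notMem h, mul_zero]; exact zero_le
  refine (setLIntegral_mono_ae' measurableSet_Ioi (Filter.Eventually.of_forall hb)).trans ?_
  have hp : 0 < (3 * L) ^ (1 - s) := Real.rpow_pos_of_pos (by linarith) _
  rw [lintegral_indicator measurableSet_Iic, setLIntegral_const,
    Measure.restrict_apply measurableSet_Iic, inter_comm, Ioi_inter_Iic, Real.volume_Ioc, sub_zero,
    ← ENNReal.ofReal_mul hp.le]
  refine ENNReal.ofReal_le_ofReal ?_
  calc (3 * L) ^ (1 - s) * (2 * L) ≤ (3 * L) ^ (1 - s) * (3 * L) := by gcongr; norm_num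
    _ = (3 * L) ^ (2 - s) := by
      rw [← Real.rpow_add_one (by positivity)]; ring_nf

theorem lintegral_radial_tail_lt_top {u : ℝ} (hu : 2 < u) :
    ∫⁻ r in Ioi (0 : ℝ), ENNReal.ofReal ((1 + r) ^ (1 - u)) < ⊤ := by
  have h : IntegrableOn (fun r : ℝ => (1 + r) ^ (1 - u)) (Ioi 0) := by
    have := integrableOn_add_rpow_Ioi_of_lt (a := 1 - u) (c := 0) (m := 1) (by linarith)
      (by norm_num)
    simpa [add_comm] using this
  exact h.lintegral_lt_top

/-- On the support (1 + r)^t ≤ (3L)^t, so a power of L can buy convergence at infinity when s ≤ 2.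
With t = 0 nothing is lost. -/
theorem lintegral_radial_rpow_le_tail {L s t : ℝ} (hL : 1 ≤ L) (ht : 0 ≤ t) :
    ∫⁻ r, (Iic (2 * L)).indicator (fun r => ENNReal.ofReal ((1 + r) ^ (-s))) r ∂radialMeasure
      ≤ ENNReal.ofReal ((3 * L) ^ t)
        * ∫⁻ r in Ioi (0 : ℝ), ENNReal.ofReal ((1 + r) ^ (1 - (s + t))) := by
  rw [lintegral_radialMeasure (Measurable.indicator (by fun_prop) measurableSet_Iic),
    ← lintegral_const_mul _ (by fun_prop)]
  refine setLIntegral_mono_ae' measurableSet_Ioi (Filter.Eventually.of_forall fun r hr => ?_)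
  have hr0 : 0 < r := hr
  by_cases h : r ∈ Iic (2 * L)
  · have hq : 0 < (3 * L) ^ t := Real.rpow_pos_of_pos (by linarith) _
    rw [indicator_of_mem h, ← ENNReal.ofReal_mul hr0.le, ← ENNReal.ofReal_mul hq.le]
    refine ENNReal.ofReal_le_ofReal ?_
    have h' : r ≤ 2 * L := h
    have hp : 0 < (1 + r) ^ (-s) := Real.rpow_pos_of_pos (by linarith) _
    have hp' : 0 < (1 + r) ^ (1 - (s + t)) := Real.rpow_pos_of_pos (by linarith) _
    calc r * (1 + r) ^ (-s) ≤ (1 + r) * (1 + r) ^ (-s) := by gcongr; linarith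
      _ = (1 + r) ^ t * (1 + r) ^ (1 - (s + t)) := by
        nth_rewrite 1 [← Real.rpow_one (1 + r)]
        rw [← Real.rpow_add (by linarith), ← Real.rpow_add (by linarith)]; ring_nf
      _ ≤ (3 * L) ^ t * (1 + r) ^ (1 - (s + t)) := by
        gcongr; linarith
  · rw [indicator_of_notMem h, mul_zero]; exact zero_le

theorem min_one_le_rpow {t s : ℝ} (ht : 0 < t) (hs0 : 0 ≤ s) (hs1 : s ≤ 1) : min 1 t ≤ t ^ s := by
  rcases le_total 1 t with h | h
  · exact (min_le_left _ _).trans (Real.one_le_rpow h hs0)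
  · refine (min_le_right _ _).trans ?_
    conv_lhs => rw [← Real.rpow_one t]
    exact Real.rpow_le_rpow_of_exponent_ge ht h hs1

namespace KernelBound

variable {k : ℝ → ℝ → ℝ → ℂ} {L A : ℝ}

/-- Interpolating the trivial bound with the decay in the smaller radius. -/
theorem enorm_planeKernel_le (hk : KernelBound k L A) {σ : ℝ} (h0 : 0 < σ) (h1 : σ ≤ 1 / 2)
    {x y : Plane} (hx : x ≠ 0) (hy : y ≠ 0) :
    ‖planeKernel k x y‖ₑ ≤ angularWeight σ (polarAngle x - polarAngle y) * (ENNReal.ofReal A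
      * ((Iic (2 * L)).indicator (fun r => ENNReal.ofReal ((1 + r) ^ (-σ))) ‖x‖
          * (Iic (2 * L)).indicator 1 ‖y‖
        + (Iic (2 * L)).indicator 1 ‖x‖
          * (Iic (2 * L)).indicator (fun r => ENNReal.ofReal ((1 + r) ^ (-σ))) ‖y‖)) := by
  have hA := hk.pos
  have h₁ : 0 < ‖x‖ := norm_pos_iff.mpr hx
  have h₂ : 0 < ‖y‖ := norm_pos_iff.mpr hy
  set θ := polarAngle x - polarAngle y with hθ
  have hdef : planeKernel k x y = k ‖x‖ ‖y‖ θ := rfl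
  by_cases hne : k ‖x‖ ‖y‖ θ = 0
  · rw [hdef, hne]; simp
  obtain ⟨hxR, hyR⟩ := hk.support _ _ _ h₁ h₂ hne
  have p1 : 0 < (1 + ‖x‖) ^ (-σ) := Real.rpow_pos_of_pos (by linarith) _
  have p2 : 0 < (1 + ‖y‖) ^ (-σ) := Real.rpow_pos_of_pos (by linarith) _
  rw [indicator_of_mem (mem_Iic.mpr hxR), indicator_of_mem (mem_Iic.mpr hyR),
    indicator_of_mem (mem_Iic.mpr hxR), indicator_of_mem (mem_Iic.mpr hyR), Pi.one_apply,
    Pi.one_apply, mul_one, one_mul, ← ENNReal.ofReal_add p1.le p2.le, ← ENNReal.ofReal_mul hA.le,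
    hdef]
  -- At the singular angle the angular weight is ∞ and the right side is infinite.
  by_cases hκ : Real.cos (θ / 2) = 0
  · unfold angularWeight
    rw [hκ, abs_zero, ENNReal.ofReal_zero, ENNReal.zero_rpow_of_neg (by linarith),
      ENNReal.top_mul (by simp only [ne_eq, ENNReal.ofReal_eq_zero, not_le]; positivity)]
    exact le_top
  · have hκ0 : 0 < |Real.cos (θ / 2)| := abs_pos.mpr hκ
    set κ := |Real.cos (θ / 2)| with hκdef
    have hκp : 0 < κ ^ (-(2 * σ)) := Real.rpow_pos_of_pos hκ0 _
    unfold angularWeight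
    rw [ENNReal.ofReal_rpow_of_pos hκ0, ← ENNReal.ofReal_mul hκp.le, ← ofReal_norm]
    refine ENNReal.ofReal_le_ofReal ?_
    have hm1 : 0 < 1 + min ‖x‖ ‖y‖ := by have := lt_min h₁ h₂; linarith
    have hm : 0 < (1 + min ‖x‖ ‖y‖) ^ (-(1 / 2) : ℝ) := Real.rpow_pos_of_pos hm1 _
    set m := (1 + min ‖x‖ ‖y‖) ^ (-(1 / 2) : ℝ) with hmdef
    have e1 : ‖k ‖x‖ ‖y‖ θ‖ ≤ A * min 1 (m / κ) := by
      rw [mul_min_of_nonneg _ _ hA.le, mul_one]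
      refine le_min (hk.norm_le _ _ _ h₁ h₂) ?_
      rw [← mul_div_assoc, le_div_iff₀ hκ0, mul_comm]
      exact hk.cos_mul_norm_le _ _ _ h₁ h₂
    -- The kernel is at most A min(1, m/κ), hence at most A (m/κ)^(2σ) as 2σ ≤ 1; the exponent 2σ
    -- turns the decay 1/2 of m into σ.
    have e2 : (m / κ) ^ (2 * σ) = (1 + min ‖x‖ ‖y‖) ^ (-σ) * κ ^ (-(2 * σ)) := by
      rw [Real.div_rpow hm.le hκ0.le, hmdef, ← Real.rpow_mul hm1.le, Real.rpow_neg hκ0.le,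
        div_eq_mul_inv]
      congr 2; ring
    calc ‖k ‖x‖ ‖y‖ θ‖ ≤ A * (m / κ) ^ (2 * σ) :=
          e1.trans (mul_le_mul_of_nonneg_left
            (min_one_le_rpow (by positivity) (by linarith) (by linarith)) hA.le)
      _ ≤ A * (((1 + ‖x‖) ^ (-σ) + (1 + ‖y‖) ^ (-σ)) * κ ^ (-(2 * σ))) := by
          rw [e2]
          gcongr
          exact one_add_min_rpow_le h₁ h₂
      _ = _ := by ring

end KernelBound

/-- The bound on `L^p`, `2 ≤ p < ∞`, for kernels decaying like `(1 + min (r₁, r₂))^{-σ}`. -/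
theorem exists_lpNormBound {p : ℝ≥0∞} (hp2 : 2 ≤ p) (hp : p ≠ ⊤) {σ η : ℝ} (h0 : 0 < σ)
    (h1 : σ < 1 / 2) (hη : 0 ≤ η) (hση : 2 < (σ + η) * p.toReal) :
    ∃ C : ℝ, 0 < C ∧ ∀ (k : ℝ → ℝ → ℝ → ℂ) (L A : ℝ), KernelBound k L A →
      LpNormBound (planeKernel k) p
        (C * (A * (L ^ (2 - 2 / p.toReal + η) + L ^ (2 - σ)))) := by
  set P := p.toReal with hP
  have hp0 : p ≠ 0 := fun h => by simp [h] at hp2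
  have hP2 : 2 ≤ P := by
    have := ENNReal.toReal_mono hp hp2
    simpa using this
  have hP0 : 0 < P := by linarith
  set Q := P / (P - 1) with hQ
  have hPQ : P.HolderConjugate Q := Real.HolderConjugate.conjExponent (by linarith)
  have hQ0 : 0 < Q := hPQ.symm.pos
  have hQ2 : Q ≤ 2 := by rw [hQ, div_le_iff₀ (by linarith)]; linarith
  have hsum : 1 / P + 1 / Q = 1 := by simpa [one_div] using hPQ.inv_add_inv_eq_one
  set c₀ := ∫⁻ θ, angularWeight σ θ ∂angularMeasure with hc₀
  set N₀ := ∫⁻ r in Ioi (0 : ℝ), ENNReal.ofReal ((1 + r) ^ (1 - (σ * P + η * P))) with hN₀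
  have hc₀t : c₀ < ⊤ := lintegral_angularWeight_lt_top h0 h1
  have hN₀t : N₀ < ⊤ := lintegral_radial_tail_lt_top (by linarith)
  set c := c₀.toReal + 1 with hc
  set N := N₀.toReal + 1 with hN
  have hcpos : 0 < c := by positivity
  have hNpos : 0 < N := by positivity
  have hc₀c : c₀ ≤ ENNReal.ofReal c := by
    rw [← ENNReal.ofReal_toReal hc₀t.ne]; exact ENNReal.ofReal_le_ofReal (by linarith)
  have hN₀N : N₀ ≤ ENNReal.ofReal N := by
    rw [← ENNReal.ofReal_toReal hN₀t.ne]; exact ENNReal.ofReal_le_ofReal (by linarith)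
  refine ⟨c * N ^ (1 / P) * (3 ^ (2 - 2 / P + η) + 3 ^ (2 - σ)) + c * (3 ^ (2 - 2 / P + η)
    + 3 ^ (2 - σ)), by positivity, fun k L A hk => ?_⟩
  have hA := hk.pos
  have hL := hk.one_le
  have hL0 : 0 < L := by linarith
  refine hk.lpNormBound (le_trans (by norm_num) hp2) fun f hfm hf => ?_
  set e : ℝ → ℝ≥0∞ := (Iic (2 * L)).indicator (fun r => ENNReal.ofReal ((1 + r) ^ (-σ))) with he
  set o : ℝ → ℝ≥0∞ := (Iic (2 * L)).indicator 1 with ho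
  have hem : Measurable e := Measurable.indicator (by fun_prop) measurableSet_Iic
  have hom : Measurable o := Measurable.indicator measurable_one measurableSet_Iic
  have hepow : ∀ s : ℝ, 0 < s → ∀ r, 0 ≤ r → e r ^ s
      = (Iic (2 * L)).indicator (fun r => ENNReal.ofReal ((1 + r) ^ (-(σ * s)))) r := by
    intro s hs r hr
    simp only [he]
    by_cases h : r ∈ Iic (2 * L)
    · rw [indicator_of_mem h, indicator_of_mem h, ENNReal.ofReal_rpow_of_pos
        (Real.rpow_pos_of_pos (by linarith) _), ← Real.rpow_mul (by linarith)]
      congr 2; ring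
    · rw [indicator_of_notMem h, indicator_of_notMem h, ENNReal.zero_rpow_of_pos hs]
  have hopow : ∀ s : ℝ, 0 < s → ∀ r, o r ^ s
      = (Iic (2 * L)).indicator (fun r => ENNReal.ofReal ((1 + r) ^ (-(0 : ℝ)))) r := by
    intro s hs r
    simp only [ho]
    by_cases h : r ∈ Iic (2 * L)
    · rw [indicator_of_mem h, indicator_of_mem h]; simp
    · rw [indicator_of_notMem h, indicator_of_notMem h, ENNReal.zero_rpow_of_pos hs]
  have hea : ∀ s : ℝ, 0 < s → ∫⁻ r, e r ^ s ∂radialMeasure = ∫⁻ r, (Iic (2 * L)).indicator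
      (fun r => ENNReal.ofReal ((1 + r) ^ (-(σ * s)))) r ∂radialMeasure := by
    intro s hs
    refine lintegral_congr_ae ?_
    filter_upwards [ae_radialMeasure_pos] with r hr using hepow s hs r hr.le
  have hIo : ∀ s : ℝ, 0 < s → ∫⁻ r, o r ^ s ∂radialMeasure ≤ ENNReal.ofReal ((3 * L) ^ (2 : ℝ)) := by
    intro s hs
    simp_rw [hopow s hs]
    have := lintegral_radial_rpow_le hL (s := 0) zero_le_one
    rwa [sub_zero] at this
  have hIe : ∫⁻ r, e r ^ Q ∂radialMeasure ≤ ENNReal.ofReal ((3 * L) ^ (2 - σ * Q)) := by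
    rw [hea Q hQ0]
    exact lintegral_radial_rpow_le hL (by nlinarith)
  have hIt : ∫⁻ r, e r ^ P ∂radialMeasure ≤ ENNReal.ofReal ((3 * L) ^ (η * P) * N) := by
    rw [hea P hP0, ENNReal.ofReal_mul (by positivity)]
    exact (lintegral_radial_rpow_le_tail hL (by positivity)).trans (mul_le_mul' le_rfl hN₀N)
  have hwm := measurable_angularWeight σ
  have hpm := measurable_polarAngle
  have hcm : Measurable fun z : Plane × Plane =>
    angularWeight σ (polarAngle z.1 - polarAngle z.2) := by fun_prop
  have hfe : Measurable fun y => ‖f y‖ₑ := hfm.measurable.enorm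
  set a : ℝ≥0∞ := ENNReal.ofReal A with ha
  -- In S₁ the decay sits on x and is integrated to the power P, where it converges up to L^(ηP);
  -- with the cutoff in y this yields L^(2/Q+η) = L^(2-2/P+η). In S₂ it sits on y and is integrated
  -- to the power Q, where σQ ≤ 1; this yields L^(2-σ).
  set S₁ : Plane → ℝ≥0∞ := fun x => (a * e ‖x‖) *
    ∫⁻ y, angularWeight σ (polarAngle x - polarAngle y) * (o ‖y‖ * ‖f y‖ₑ) with hS₁
  set S₂ : Plane → ℝ≥0∞ := fun x => (a * o ‖x‖) *
    ∫⁻ y, angularWeight σ (polarAngle x - polarAngle y) * (e ‖y‖ * ‖f y‖ₑ) with hS₂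
  have hm₁ : Measurable S₁ := by
    have : Measurable fun z : Plane × Plane =>
      angularWeight σ (polarAngle z.1 - polarAngle z.2) * (o ‖z.2‖ * ‖f z.2‖ₑ) := by fun_prop
    have := this.lintegral_prod_right' (ν := (volume : Measure Plane))
    fun_prop
  have hm₂ : Measurable S₂ := by
    have : Measurable fun z : Plane × Plane =>
      angularWeight σ (polarAngle z.1 - polarAngle z.2) * (e ‖z.2‖ * ‖f z.2‖ₑ) := by fun_prop
    have := this.lintegral_prod_right' (ν := (volume : Measure Plane))
    fun_prop
  have hTS : ∀ᵐ x : Plane, ‖integralOperator (planeKernel k) f x‖ₑ ≤ (S₁ + S₂) x := by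
    filter_upwards [ae_ne_zero_plane] with x hx
    refine (enorm_integral_le_lintegral_enorm _).trans ?_
    simp only [Pi.add_apply, hS₁, hS₂]
    rw [← lintegral_const_mul _ (by fun_prop), ← lintegral_const_mul _ (by fun_prop),
      ← lintegral_add_left (by fun_prop)]
    refine lintegral_mono_ae ?_
    filter_upwards [ae_ne_zero_plane] with y hy
    rw [enorm_mul]
    refine (mul_le_mul' (hk.enorm_planeKernel_le h0 h1.le hx hy) le_rfl).trans (le_of_eq ?_)
    ring
  have hschur := fun (g h : ℝ → ℝ≥0∞) (hg : Measurable g) (hh : Measurable h) (I J : ℝ)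
      (hI : ∫⁻ r, h r ^ Q ∂radialMeasure ≤ ENNReal.ofReal I)
      (hJ : ∫⁻ r, g r ^ P ∂radialMeasure ≤ ENNReal.ofReal J) =>
    lintegral_schur_rpow_le (μ := (volume : Measure Plane)) (ν := (volume : Measure Plane)) hPQ
      (c := fun x y => angularWeight σ (polarAngle x - polarAngle y)) (g := fun x => a * g ‖x‖)
      (h := fun y => h ‖y‖) (f := fun y => ‖f y‖ₑ) hcm (by fun_prop) (by fun_prop) hfe
      (H := ENNReal.ofReal (c * I)) (G := ENNReal.ofReal (A ^ P * (c * J)))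
      (fun x => by
        rw [lintegral_angularWeight_mul σ x (hh.pow_const Q), ENNReal.ofReal_mul hcpos.le]
        exact mul_le_mul' hc₀c hI)
      (fun y => by
        have h2 : ∀ x : Plane, angularWeight σ (polarAngle x - polarAngle y) * (a * g ‖x‖) ^ P
            = a ^ P * (angularWeight σ (polarAngle x - polarAngle y) * g ‖x‖ ^ P) := fun x => by
          rw [ENNReal.mul_rpow_of_nonneg _ _ hP0.le]; ring
        simp_rw [h2]
        rw [lintegral_const_mul _ (by fun_prop), lintegral_angularWeight_mul' σ y (hg.pow_const P),
          ENNReal.ofReal_mul (by positivity), ENNReal.ofReal_mul hcpos.le,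
          ← ENNReal.ofReal_rpow_of_nonneg hA.le hP0.le]
        exact mul_le_mul' le_rfl (mul_le_mul' hc₀c hJ))
  have hreal : ∀ I J : ℝ, 0 < I → 0 < J →
      ENNReal.ofReal (c * I) ^ (1 / Q) * ENNReal.ofReal (A ^ P * (c * J)) ^ (1 / P)
        = ENNReal.ofReal (c * A * (I ^ (1 / Q) * J ^ (1 / P))) := by
    intro I J hI hJ
    have hAP : 0 < A ^ P := Real.rpow_pos_of_pos hA _
    rw [ENNReal.ofReal_rpow_of_pos (by positivity), ENNReal.ofReal_rpow_of_pos (by positivity),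
      ← ENNReal.ofReal_mul (by positivity)]
    congr 1
    rw [Real.mul_rpow hcpos.le hI.le, Real.mul_rpow hAP.le (by positivity),
      Real.mul_rpow hcpos.le hJ.le, ← Real.rpow_mul hA.le, mul_one_div_cancel hP0.ne',
      Real.rpow_one]
    have : c ^ (1 / Q) * c ^ (1 / P) = c := by
      rw [← Real.rpow_add hcpos, add_comm, hsum, Real.rpow_one]
    calc c ^ (1 / Q) * I ^ (1 / Q) * (A * (c ^ (1 / P) * J ^ (1 / P)))
        = (c ^ (1 / Q) * c ^ (1 / P)) * A * (I ^ (1 / Q) * J ^ (1 / P)) := by ring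
      _ = _ := by rw [this]
  have h3L : 0 < 3 * L := by positivity
  have b₁ := hschur e o hem hom _ _ (hIo Q hQ0) hIt
  have b₂ := hschur o e hom hem _ _ hIe (hIo P hP0)
  rw [hreal _ _ (by positivity) (by positivity)] at b₁ b₂
  have x₁ : ((3 * L) ^ (2 : ℝ)) ^ (1 / Q) * ((3 * L) ^ (η * P) * N) ^ (1 / P)
      = N ^ (1 / P) * (3 ^ (2 - 2 / P + η) * L ^ (2 - 2 / P + η)) := by
    rw [Real.mul_rpow (by positivity) hNpos.le, ← Real.rpow_mul h3L.le, ← Real.rpow_mul h3L.le,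
      ← mul_assoc, ← Real.rpow_add h3L, ← Real.mul_rpow (by norm_num) hL0.le, mul_comm]
    congr 2
    have : 1 / Q = 1 - 1 / P := by linarith
    rw [this]; field_simp
  have x₂ : ((3 * L) ^ (2 - σ * Q)) ^ (1 / Q) * ((3 * L) ^ (2 : ℝ)) ^ (1 / P)
      = 3 ^ (2 - σ) * L ^ (2 - σ) := by
    rw [← Real.rpow_mul h3L.le, ← Real.rpow_mul h3L.le, ← Real.rpow_add h3L,
      ← Real.mul_rpow (by norm_num) hL0.le]
    congr 1
    have h5 : σ * Q * (1 / Q) = σ := by field_simp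
    have h6 : (2 - σ * Q) * (1 / Q) = 2 * (1 / Q) - σ * Q * (1 / Q) := by ring
    rw [h6, h5]; linarith
  rw [x₁] at b₁
  rw [x₂] at b₂
  rw [eLpNorm_eq_lintegral_rpow_enorm_toReal hp0 hp, eLpNorm_eq_lintegral_rpow_enorm_toReal hp0 hp,
    ← hP]
  have hfin : (∫⁻ x, ‖integralOperator (planeKernel k) f x‖ₑ ^ P) ^ (1 / P)
      ≤ (∫⁻ x, (S₁ + S₂) x ^ P) ^ (1 / P) := by
    refine ENNReal.rpow_le_rpow (lintegral_mono_ae ?_) (by positivity)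
    filter_upwards [hTS] with x hx using ENNReal.rpow_le_rpow hx hP0.le
  refine (hfin.trans (ENNReal.lintegral_Lp_add_le hm₁.aemeasurable hm₂.aemeasurable
    (by linarith))).trans ((add_le_add b₁ b₂).trans ?_)
  rw [← add_mul, ← ENNReal.ofReal_add (by positivity) (by positivity)]
  refine mul_le_mul' (ENNReal.ofReal_le_ofReal ?_) le_rfl
  have l1 : 0 < L ^ (2 - 2 / P + η) := Real.rpow_pos_of_pos hL0 _
  have l2 : 0 < L ^ (2 - σ) := Real.rpow_pos_of_pos hL0 _
  have t1 : 0 < (3 : ℝ) ^ (2 - 2 / P + η) := by positivity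
  have t2 : 0 < (3 : ℝ) ^ (2 - σ) := by positivity
  have n1 : 0 < N ^ (1 / P) := by positivity
  set l₁ := L ^ (2 - 2 / P + η)
  set l₂ := L ^ (2 - σ)
  set t₁ := (3 : ℝ) ^ (2 - 2 / P + η)
  set t₂ := (3 : ℝ) ^ (2 - σ)
  set n₁ := N ^ (1 / P)
  have : (c * n₁ * (t₁ + t₂) + c * (t₁ + t₂)) * (A * (l₁ + l₂))
      = c * A * (n₁ * (t₁ * l₁)) + c * A * (t₂ * l₂)
        + (c * n₁ * t₁ * A * l₂ + c * n₁ * t₂ * A * (l₁ + l₂) + c * t₁ * A * (l₁ + l₂)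
          + c * t₂ * A * l₁) := by ring
  rw [this]
  have : 0 < c * n₁ * t₁ * A * l₂ + c * n₁ * t₂ * A * (l₁ + l₂) + c * t₁ * A * (l₁ + l₂)
          + c * t₂ * A * l₁ := by positivity
  linarith

/-! ### The dyadic cutoffs -/

theorem IsDyadicPartition.eq_zero {β : ℝ → ℝ} (hβ : IsDyadicPartition β) {x : ℝ}
    (hx : x < 3 / 8 ∨ 4 / 3 < x) : β x = 0 := by
  refine image_eq_zero_of_notMem_tsupport fun h => ?_
  have := hβ.support h
  rcases hx with h' | h'
  · linarith [this.1]
  · linarith [this.2]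

theorem IsDyadicPartition.exists_abs_le {β : ℝ → ℝ} (hβ : IsDyadicPartition β) :
    ∃ M, 0 < M ∧ ∀ x, |β x| ≤ M := by
  have hc : HasCompactSupport β := isCompact_Icc.of_isClosed_subset (isClosed_tsupport β) hβ.support
  obtain ⟨M, hM⟩ := hc.exists_bound_of_continuous hβ.smooth.continuous
  exact ⟨M + 1, by linarith [(norm_nonneg _).trans (hM 0)], fun x => (hM x).trans (by linarith)⟩

/-- If r ≤ 4/3, then r/4 < 3/8 and only k = 1 contributes. If r > 4/3, the terms with k ≤ 0 vanish,
so the sum over k ≥ 1 is already the whole partition of unity. -/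
theorem IsDyadicPartition.dyadicCutoff_zero {β : ℝ → ℝ} (hβ : IsDyadicPartition β) {r : ℝ}
    (hr : 0 < r) : dyadicCutoff β 0 r = if r ≤ 4 / 3 then 1 - β (r / 2) else 0 := by
  change 1 - ∑' k : ℕ, β ((2 : ℝ) ^ (-((k : ℤ) + 1)) * r) = _
  split_ifs with h
  · rw [tsum_eq_single 0]
    · norm_num [div_eq_inv_mul]
    · intro k hk
      refine hβ.eq_zero (Or.inl ?_)
      have h2 : (2 : ℝ) ^ (-((k : ℤ) + 1)) ≤ 2 ^ (-2 : ℤ) :=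
        zpow_le_zpow_right₀ (by norm_num) (by omega)
      have h3 : (2 : ℝ) ^ (-2 : ℤ) = 1 / 4 := by norm_num
      rw [h3] at h2
      linarith [mul_le_mul_of_nonneg_right h2 hr.le]
  · push Not at h
    have hinj : Function.Injective fun k : ℕ => (k : ℤ) + 1 := fun x y hxy => by
      simpa using hxy
    have := hinj.tsum_eq (f := fun k : ℤ => β ((2 : ℝ) ^ (-k) * r)) ?_
    · rw [this, hβ.sum_eq_one r hr, sub_self]
    · intro k hk
      by_contra hk'
      have hk0 : k ≤ 0 := by
        by_contra hpos
        exact hk' ⟨(k - 1).toNat, by simp only; omega⟩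
      refine hk (hβ.eq_zero (Or.inr ?_))
      have h2 : (1 : ℝ) ≤ 2 ^ (-k) := one_le_zpow₀ (by norm_num) (by omega)
      nlinarith

/-- χ replaces the series for j = 0 by its closed form, valid only for r > 0, so that measurability
is evident. Writing 1 + r in the lower bound on the support lets j = 0 share the statement with j ≥
1. -/
theorem IsDyadicPartition.exists_cutoff {β : ℝ → ℝ} (hβ : IsDyadicPartition β) :
    ∃ (χ : ℕ → ℝ → ℝ) (M : ℝ), 0 < M ∧ ∀ j, Measurable (χ j) ∧ ∀ r, 0 < r →
      dyadicCutoff β j r = χ j r ∧ |χ j r| ≤ M ∧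
        (χ j r ≠ 0 → r ≤ 2 * 2 ^ j ∧ 2 ^ j ≤ 4 * (1 + r)) := by
  obtain ⟨M, hM0, hM⟩ := hβ.exists_abs_le
  have hβm : Measurable β := hβ.smooth.continuous.measurable
  refine ⟨fun j => match j with
    | 0 => fun r => if r ≤ 4 / 3 then 1 - β (r / 2) else 0
    | j + 1 => dyadicCutoff β (j + 1), 1 + M, by positivity, ?_⟩
  rintro (_ | j)
  · refine ⟨?_, fun r hr => ⟨hβ.dyadicCutoff_zero hr, ?_, ?_⟩⟩
    · exact Measurable.ite measurableSet_Iic (by fun_prop) measurable_const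
    · dsimp only
      split_ifs
      · refine (abs_sub _ _).trans ?_
        rw [abs_one]; linarith [hM (r / 2)]
      · rw [abs_zero]; positivity
    · dsimp only
      split_ifs with h
      · intro _; constructor <;> norm_num <;> linarith
      · simp
  · refine ⟨?_, fun r hr => ⟨rfl, ?_, ?_⟩⟩
    · change Measurable fun r => β ((2 : ℝ) ^ (-((j : ℤ) + 1)) * r)
      fun_prop
    · change |β _| ≤ _
      linarith [hM ((2 : ℝ) ^ (-((j : ℤ) + 1)) * r)]
    · intro h
      have h0 : (0 : ℝ) < 2 ^ (j + 1) := by positivity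
      have hz : (2 : ℝ) ^ (-((j : ℤ) + 1)) * r = r / 2 ^ (j + 1) := by
        rw [zpow_neg, div_eq_inv_mul]; norm_cast
      change β _ ≠ 0 at h
      rw [hz] at h
      have h1 : ¬(r / 2 ^ (j + 1) < 3 / 8 ∨ 4 / 3 < r / 2 ^ (j + 1)) := fun h' => h (hβ.eq_zero h')
      push Not at h1
      rw [le_div_iff₀ h0, div_le_iff₀ h0] at h1
      constructor <;> linarith

/-! ### The localized kernels -/

theorem measurable_diffWeight (α : ℝ) (ℓ : ℕ) :
    Measurable fun p : ℝ × ℝ => diffWeight α p.1 p.2 ℓ := by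
  match ℓ with
  | 0 => exact measurable_const
  | 1 => unfold diffWeight; fun_prop
  | 2 => unfold diffWeight; fun_prop
  | 3 => unfold diffWeight; fun_prop
  | n + 4 => exact measurable_const

theorem measurable_diffKernel (α δ : ℝ) {a : ℝ → ℂ} (ha : Measurable a) (ℓ : ℕ) :
    Measurable fun p : ℝ × ℝ × ℝ => diffKernel α δ a ℓ p.1 p.2.1 p.2.2 := by
  have hd : Measurable fun q : (ℝ × ℝ × ℝ) × ℝ => diffDist q.1.1 q.1.2.1 q.2 := by
    unfold diffDist; fun_prop
  have hw : Measurable fun q : (ℝ × ℝ × ℝ) × ℝ => diffWeight α q.1.2.2 q.2 ℓ :=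
    (measurable_diffWeight α ℓ).comp (g := fun p : ℝ × ℝ => diffWeight α p.1 p.2 ℓ)
      (f := fun q : (ℝ × ℝ × ℝ) × ℝ => (q.1.2.2, q.2)) (by fun_prop)
  have h : Measurable fun q : (ℝ × ℝ × ℝ) × ℝ =>
      diffIntegrand α δ a ℓ q.1.1 q.1.2.1 q.1.2.2 q.2 := by
    unfold diffIntegrand; fun_prop
  exact h.stronglyMeasurable.integral_prod_right'.measurable

theorem periodic_diffKernel (α δ : ℝ) (a : ℝ → ℂ) (ℓ : ℕ) (r₁ r₂ : ℝ) :
    Function.Periodic (diffKernel α δ a ℓ r₁ r₂) (2 * Real.pi) := by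
  intro θ
  have h (s : ℝ) : diffWeight α (θ + 2 * Real.pi) s ℓ = diffWeight α θ s ℓ := by
    have hc : Real.cos (θ + 2 * Real.pi + Real.pi) = Real.cos (θ + Real.pi) := by
      rw [add_right_comm, Real.cos_add_two_pi]
    have hs : Real.sin (θ + 2 * Real.pi + Real.pi) = Real.sin (θ + Real.pi) := by
      rw [add_right_comm, Real.sin_add_two_pi]
    unfold diffWeight
    split <;> simp only [hc, hs]
  simp only [diffKernel, diffIntegrand, h]

/-- As |n_s| > 0, values of the amplitude off (0, ∞) never enter. This allows it to be extended by
zero, hence measurably. -/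
theorem diffKernel_congr {α δ : ℝ} {a b : ℝ → ℂ} (hab : EqOn a b (Ioi 0)) (ℓ : ℕ) {r₁ r₂ : ℝ}
    (h₁ : 0 < r₁) (h₂ : 0 < r₂) (θ : ℝ) :
    diffKernel α δ a ℓ r₁ r₂ θ = diffKernel α δ b ℓ r₁ r₂ θ := by
  unfold diffKernel diffIntegrand
  simp_rw [hab (show diffDist r₁ r₂ _ ∈ Ioi 0 from diffDist_pos h₁ h₂ _)]

theorem norm_integral_mul_exp_le {f : ℝ → ℂ} {M : ℝ} (hf : ∀ θ, ‖f θ‖ ≤ M) (n : ℤ) :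
    ‖∫ θ in (-Real.pi)..Real.pi, f θ * Complex.exp ((n : ℂ) * Complex.I * θ)‖
      ≤ M * (2 * Real.pi) := by
  have := intervalIntegral.norm_integral_le_of_norm_le_const (a := -Real.pi) (b := Real.pi) (C := M)
    (f := fun θ : ℝ => f θ * Complex.exp ((n : ℂ) * Complex.I * θ)) fun θ _ => by
      rw [norm_mul, norm_exp_int_mul, mul_one]; exact hf θ
  rwa [sub_neg_eq_add, ← two_mul, abs_of_pos Real.two_pi_pos] at this

/-- On the support of the cutoff 1 + r₁ + r₂ ≥ 2^j/4, so the amplitude is of size (2^j)^(-3/2-δ).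
The Fourier bound follows from pointwise decay for ℓ = 1, 2 and from the conjugate Poisson
computation for ℓ = 3. -/
theorem exists_kernelBound {α δ : ℝ} {a : ℝ → ℂ} {β : ℝ → ℝ} (hα : |α| < 1) (hα0 : α ≠ 0)
    (hδ : 0 ≤ δ) (ha : IsAmplitude a) (hβ : IsDyadicPartition β) :
    ∃ D : ℝ, 0 < D ∧ ∀ ℓ ∈ Icc (1 : ℕ) 3, ∀ j : ℕ, ∃ k : ℝ → ℝ → ℝ → ℂ,
      KernelBound k (2 ^ j) (D * (2 ^ j) ^ (-(3 / 2) - δ)) ∧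
      ∀ r₁ r₂ θ, 0 < r₁ → 0 < r₂ → k r₁ r₂ θ = diffKernelPiece α δ a β ℓ j r₁ r₂ θ := by
  obtain ⟨χ, M, hM, hχ⟩ := hβ.exists_cutoff
  obtain ⟨C, B', hB⟩ := ha.exists_amplitudeBound hδ
  obtain ⟨A, hA, hbd⟩ := exists_norm_oscIntegral_diffWeight_le hα hα0
  have hπ := Real.pi_gt_three
  have hC := hB.pos
  set A₃ := 36 * Real.pi * (1 + 2 / (1 - |α|)) with hA₃
  have hA₃0 : 0 < A₃ := by
    have : 0 < 2 / (1 - |α|) := div_pos two_pos (by linarith)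
    positivity
  set E := M * (1 / 4) ^ (-(3 / 2) - δ) * C with hE
  have hE0 : 0 < E := by positivity
  -- A · 2π pays for integrating the pointwise bound over the circle when ℓ ≠ 3, and A₃ for the
  -- third kernel.
  refine ⟨E * (A * (2 * Real.pi) + A₃), by positivity, fun ℓ hℓ j => ?_⟩
  set b : ℝ → ℂ := (Ioi 0).indicator a
  have hab : EqOn b a (Ioi 0) := fun x hx => indicator_of_mem hx a
  have hb : Measurable b := by
    classical
    have := ha.smooth.continuousOn.measurable_piecewise (g := 0) continuousOn_const
      measurableSet_Ioi
    rwa [piecewise_eq_indicator] at this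
  set w : ℝ := (2 ^ j) ^ (-(3 / 2) - δ) with hw
  have hw0 : 0 < w := by positivity
  have hker {r₁ r₂ : ℝ} (h₁ : 0 < r₁) (h₂ : 0 < r₂) (θ : ℝ) :
      diffKernel α δ b ℓ r₁ r₂ θ
        = oscIntegral (oscAmplitude δ a) r₁ r₂ (fun s => diffWeight α θ s ℓ) := by
    rw [diffKernel_congr hab ℓ h₁ h₂, diffKernel_eq_oscIntegral]
  have hcut {r₁ r₂ : ℝ} (h₁ : 0 < r₁) (h₂ : 0 < r₂) :
      ‖(χ j (r₁ + r₂) : ℂ)‖ * (C * (1 + (r₁ + r₂)) ^ (-(3 / 2) - δ)) ≤ E * w := by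
    rw [Complex.norm_real, Real.norm_eq_abs]
    have hR : 0 < r₁ + r₂ := add_pos h₁ h₂
    obtain ⟨-, hle, hsupp⟩ := (hχ j).2 _ hR
    by_cases h0 : χ j (r₁ + r₂) = 0
    · rw [h0, abs_zero, zero_mul]; positivity
    · have h1 : (1 + (r₁ + r₂)) ^ (-(3 / 2) - δ) ≤ (1 / 4 * 2 ^ j) ^ (-(3 / 2) - δ) :=
        Real.rpow_le_rpow_of_nonpos (by positivity) (by linarith [(hsupp h0).2]) (by linarith)
      rw [Real.mul_rpow (by norm_num) (by positivity), ← hw] at h1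
      calc _ ≤ M * (C * ((1 / 4) ^ (-(3 / 2) - δ) * w)) := by gcongr
        _ = E * w := by rw [hE]; ring
  have hscale {r₁ r₂ m K : ℝ} (h₁ : 0 < r₁) (h₂ : 0 < r₂) (hm : 0 ≤ m) {z : ℂ} (hK : 0 ≤ K)
      (hKA : K ≤ A * (2 * Real.pi) + A₃)
      (hz : ‖z‖ ≤ C * (1 + (r₁ + r₂)) ^ (-(3 / 2) - δ) * m * K) :
      ‖(χ j (r₁ + r₂) : ℂ) * z‖ ≤ E * (A * (2 * Real.pi) + A₃) * w * m := by
    rw [norm_mul]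
    calc _ ≤ ‖(χ j (r₁ + r₂) : ℂ)‖ * (C * (1 + (r₁ + r₂)) ^ (-(3 / 2) - δ) * m * K) := by gcongr
      _ = ‖(χ j (r₁ + r₂) : ℂ)‖ * (C * (1 + (r₁ + r₂)) ^ (-(3 / 2) - δ)) * (m * K) := by ring
      _ ≤ E * w * (m * (A * (2 * Real.pi) + A₃)) := by
          have := hcut h₁ h₂; gcongr
      _ = _ := by ring
  have hAle : A ≤ A * (2 * Real.pi) + A₃ := by nlinarith
  have hmin {r₁ r₂ : ℝ} (h₁ : 0 < r₁) (h₂ : 0 < r₂) : 0 ≤ (1 + min r₁ r₂) ^ (-(1 / 2) : ℝ) :=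
    Real.rpow_nonneg (by have := lt_min h₁ h₂; linarith) _
  refine ⟨fun r₁ r₂ θ => (χ j (r₁ + r₂) : ℂ) * diffKernel α δ b ℓ r₁ r₂ θ,
    ⟨one_le_pow₀ (by norm_num), by positivity, ?_, ?_, ?_, ?_, ?_, ?_⟩, ?_⟩
  · have := (hχ j).1
    have h2 := measurable_diffKernel α δ hb ℓ
    fun_prop
  · intro r₁ r₂ θ
    simp only [periodic_diffKernel α δ b ℓ r₁ r₂ θ]
  · intro r₁ r₂ θ h₁ h₂
    have := hscale h₁ h₂ zero_le_one hA.le hAle (z := diffKernel α δ b ℓ r₁ r₂ θ) (by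
      rw [hker h₁ h₂, mul_one]
      exact (hbd δ C _ B' hB hδ ℓ hℓ r₁ r₂ θ h₁ h₂).1)
    rwa [mul_one] at this
  · intro r₁ r₂ θ h₁ h₂ hne
    have h0 : χ j (r₁ + r₂) ≠ 0 := fun h => hne (by simp [h])
    have := (((hχ j).2 _ (add_pos h₁ h₂)).2.2 h0).1
    constructor <;> linarith
  · intro r₁ r₂ θ h₁ h₂
    have := hscale h₁ h₂ (hmin h₁ h₂) hA.le hAle
      (z := (|Real.cos (θ / 2)| : ℝ) * diffKernel α δ b ℓ r₁ r₂ θ) (by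
        rw [hker h₁ h₂, norm_mul, Complex.norm_real, Real.norm_eq_abs, abs_abs]
        exact (hbd δ C _ B' hB hδ ℓ hℓ r₁ r₂ θ h₁ h₂).2.1)
    rw [mul_left_comm, norm_mul, Complex.norm_real, Real.norm_eq_abs, abs_abs] at this
    exact this
  · intro r₁ r₂ h₁ h₂ n
    simp_rw [mul_assoc ((χ j (r₁ + r₂) : ℂ)), intervalIntegral.integral_const_mul, hker h₁ h₂]
    by_cases h3 : ℓ = 3
    · subst h3
      exact hscale h₁ h₂ (hmin h₁ h₂) hA₃0.le (by nlinarith)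
        (hB.norm_integral_oscIntegral_three_le hδ hα hα0 h₁ h₂ n)
    · refine hscale h₁ h₂ (hmin h₁ h₂) (K := A * (2 * Real.pi)) (by positivity) (by linarith) ?_
      rw [← mul_assoc]
      exact norm_integral_mul_exp_le
        (fun θ => (hbd δ C _ B' hB hδ ℓ hℓ r₁ r₂ θ h₁ h₂).2.2 h3) (-n)
  · intro r₁ r₂ θ h₁ h₂
    dsimp only
    rw [diffKernel_congr hab ℓ h₁ h₂, diffKernelPiece, ((hχ j).2 _ (add_pos h₁ h₂)).1]

/-! ### Operator bounds -/

theorem LpNormBound.congr_le {k k' : Plane → Plane → ℂ} {p : ℝ≥0∞} {M M' : ℝ}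
    (hb : LpNormBound k p M) (h : ∀ x y, x ≠ 0 → y ≠ 0 → k x y = k' x y) (hM : M ≤ M') :
    LpNormBound k' p M' := by
  intro f hf
  obtain ⟨h1, h2, h3⟩ := hb f hf
  have he (x : Plane) (hx : x ≠ 0) : (fun y => k x y * f y) =ᵐ[volume] fun y => k' x y * f y := by
    filter_upwards [ae_ne_zero_plane] with y hy
    rw [h x y hx hy]
  have hT : integralOperator k f =ᵐ[volume] integralOperator k' f := by
    filter_upwards [ae_ne_zero_plane] with x hx
    exact integral_congr_ae (he x hx)
  refine ⟨?_, (memLp_congr_ae hT).mp h2, ?_⟩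
  · filter_upwards [h1, ae_ne_zero_plane] with x h1x hx
    exact h1x.congr (he x hx)
  · rw [← eLpNorm_congr_ae hT]
    exact h3.trans (by gcongr)

theorem LpNormBound.planeKernel_congr_le {k k' : ℝ → ℝ → ℝ → ℂ} {p : ℝ≥0∞} {M M' : ℝ}
    (hb : LpNormBound (planeKernel k) p M)
    (h : ∀ r₁ r₂ θ, 0 < r₁ → 0 < r₂ → k r₁ r₂ θ = k' r₁ r₂ θ) (hM : M ≤ M') :
    LpNormBound (planeKernel k') p M' :=
  hb.congr_le (fun _ _ hx hy => h _ _ _ (norm_pos_iff.mpr hx) (norm_pos_iff.mpr hy)) hM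

theorem two_pow_rpow (j : ℕ) (x : ℝ) : ((2 : ℝ) ^ j) ^ x = 2 ^ ((j : ℝ) * x) := by
  rw [← Real.rpow_natCast, ← Real.rpow_mul (by norm_num)]

section

variable {α δ : ℝ} {a : ℝ → ℂ} {β : ℝ → ℝ}

theorem exists_diffKernelPiece_lpNormBound_two (hα : |α| < 1) (hα0 : α ≠ 0) (hδ : 0 ≤ δ)
    (ha : IsAmplitude a) (hβ : IsDyadicPartition β) :
    ∃ C : ℝ, 0 < C ∧ ∀ ℓ ∈ Icc (1 : ℕ) 3, ∀ j : ℕ,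
      LpNormBound (planeKernel (diffKernelPiece α δ a β ℓ j)) 2 (C * (2 : ℝ) ^ (-(j : ℝ) * δ)) := by
  obtain ⟨D, hD, h⟩ := exists_kernelBound hα hα0 hδ ha hβ
  refine ⟨D * (2 * 2 ^ (3 / 2 : ℝ)), by positivity, fun ℓ hℓ j => ?_⟩
  obtain ⟨k, hk, hkk⟩ := h ℓ hℓ j
  refine hk.lpNormBound_two.planeKernel_congr_le hkk (le_of_eq ?_)
  rw [Real.mul_rpow (by norm_num) (by positivity), two_pow_rpow, two_pow_rpow,
    show -(j : ℝ) * δ = j * (-(3 / 2) - δ) + j * (3 / 2) by ring, Real.rpow_add two_pos]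
  ring

theorem exists_diffKernelPiece_lpNormBound_top (hα : |α| < 1) (hα0 : α ≠ 0) (hδ : 0 ≤ δ)
    (ha : IsAmplitude a) (hβ : IsDyadicPartition β) :
    ∃ C : ℝ, 0 < C ∧ ∀ ℓ ∈ Icc (1 : ℕ) 3, ∀ j : ℕ,
      LpNormBound (planeKernel (diffKernelPiece α δ a β ℓ j)) ⊤
        (C * (2 : ℝ) ^ ((j : ℝ) * (1 / 2 - δ))) := by
  obtain ⟨D, hD, h⟩ := exists_kernelBound hα hα0 hδ ha hβ
  set V := (volume (Metric.ball (0 : Plane) 1)).toReal with hV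
  have hV0 : 0 < V := ENNReal.toReal_pos (Metric.measure_ball_pos _ _ one_pos).ne'
    measure_ball_lt_top.ne
  refine ⟨4 * V * D, by positivity, fun ℓ hℓ j => ?_⟩
  obtain ⟨k, hk, hkk⟩ := h ℓ hℓ j
  refine hk.lpNormBound_top.planeKernel_congr_le hkk (le_of_eq ?_)
  rw [← hV, ← Real.rpow_two, two_pow_rpow, two_pow_rpow,
    show (j : ℝ) * (1 / 2 - δ) = j * (-(3 / 2) - δ) + j * 2 by ring, Real.rpow_add two_pos]
  ring

/-- With A of order L^(-3/2-δ), the two Schur terms have exponents 1/2 - 2/p + η - δ and 1/2 - σ -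
δ; e is any number dominating both apart from -δ. -/
theorem exists_diffKernelPiece_lpNormBound (hα : |α| < 1) (hα0 : α ≠ 0) (hδ : 0 ≤ δ)
    (ha : IsAmplitude a) (hβ : IsDyadicPartition β) {p : ℝ≥0∞} (hp2 : 2 ≤ p) (hp : p ≠ ⊤)
    {σ η e : ℝ} (h0 : 0 < σ) (h1 : σ < 1 / 2) (hη : 0 ≤ η) (hση : 2 < (σ + η) * p.toReal)
    (he₁ : 1 / 2 - 2 / p.toReal + η ≤ e) (he₂ : 1 / 2 - σ ≤ e) :
    ∃ C : ℝ, 0 < C ∧ ∀ ℓ ∈ Icc (1 : ℕ) 3, ∀ j : ℕ,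
      LpNormBound (planeKernel (diffKernelPiece α δ a β ℓ j)) p
        (C * (2 : ℝ) ^ ((j : ℝ) * (e - δ))) := by
  obtain ⟨D, hD, h⟩ := exists_kernelBound hα hα0 hδ ha hβ
  obtain ⟨C, hC, hCb⟩ := exists_lpNormBound hp2 hp h0 h1 hη hση
  refine ⟨C * D * 2, by positivity, fun ℓ hℓ j => ?_⟩
  obtain ⟨k, hk, hkk⟩ := h ℓ hℓ j
  refine (hCb _ _ _ hk).planeKernel_congr_le hkk ?_
  have hle {u : ℝ} (hu : u - 3 / 2 ≤ e) :
      ((2 : ℝ) ^ j) ^ (-(3 / 2) - δ) * (2 ^ j) ^ u ≤ 2 ^ ((j : ℝ) * (e - δ)) := by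
    rw [← Real.rpow_add (by positivity), two_pow_rpow]
    exact Real.rpow_le_rpow_of_exponent_le (by norm_num)
      (mul_le_mul_of_nonneg_left (by linarith) j.cast_nonneg)
  have h₁ := hle (u := 2 - 2 / p.toReal + η) (by linarith)
  have h₂ := hle (u := 2 - σ) (by linarith)
  calc _ = C * D * (((2 : ℝ) ^ j) ^ (-(3 / 2) - δ) * (2 ^ j) ^ (2 - 2 / p.toReal + η)
        + ((2 : ℝ) ^ j) ^ (-(3 / 2) - δ) * (2 ^ j) ^ (2 - σ)) := by ring
    _ ≤ C * D * (2 ^ ((j : ℝ) * (e - δ)) + 2 ^ ((j : ℝ) * (e - δ))) := by gcongr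
    _ = _ := by ring

theorem criticalIndex_top : criticalIndex ⊤ 2 = 1 / 2 := by
  unfold criticalIndex; norm_num

theorem criticalIndex_of_four_le {p : ℝ≥0∞} (h4 : 4 ≤ p) (hp : p ≠ ⊤) :
    4 ≤ p.toReal ∧ criticalIndex p 2 = 1 / 2 - 2 / p.toReal := by
  have hP : 4 ≤ p.toReal := by
    have := ENNReal.toReal_mono hp h4
    simpa using this
  refine ⟨hP, ?_⟩
  have hinv : p.toReal⁻¹ ≤ 1 / 4 := by
    rw [one_div]; exact inv_anti₀ (by norm_num) hP
  unfold criticalIndex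
  rw [ENNReal.toReal_inv, abs_of_nonneg (by linarith), max_eq_right (by push_cast; linarith)]
  push_cast
  rw [div_eq_mul_inv 2]; ring

/-- For finite p, σ = 1/p + 1/4 is the midpoint of (2/p, 1/2), an interval that is nonempty because
p > 4. The radial integral then converges with η = 0, and there is no loss. -/
theorem exists_diffKernelPiece_lpNormBound_of_four_lt (hα : |α| < 1) (hα0 : α ≠ 0) (hδ : 0 ≤ δ)
    (ha : IsAmplitude a) (hβ : IsDyadicPartition β) {p : ℝ≥0∞} (h4 : 4 < p) :
    ∃ C : ℝ, 0 < C ∧ ∀ ℓ ∈ Icc (1 : ℕ) 3, ∀ j : ℕ,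
      LpNormBound (planeKernel (diffKernelPiece α δ a β ℓ j)) p
        (C * (2 : ℝ) ^ ((j : ℝ) * (criticalIndex p 2 - δ))) := by
  by_cases hp : p = ⊤
  · subst hp
    rw [criticalIndex_top]
    exact exists_diffKernelPiece_lpNormBound_top hα hα0 hδ ha hβ
  · obtain ⟨-, hc⟩ := criticalIndex_of_four_le h4.le hp
    have hP : 4 < p.toReal := by
      have := (ENNReal.toReal_lt_toReal (by norm_num) hp).mpr h4
      simpa using this
    have hPi : 1 / p.toReal < 1 / 4 := one_div_lt_one_div_of_lt (by norm_num) hP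
    have hP1 : 2 / p.toReal = 2 * (1 / p.toReal) := by ring
    refine exists_diffKernelPiece_lpNormBound hα hα0 hδ ha hβ
      ((by norm_num : (2 : ℝ≥0∞) ≤ 4).trans h4.le) hp (σ := 1 / p.toReal + 1 / 4) (η := 0)
      (by positivity) (by linarith) le_rfl ?_ (by rw [hc]; linarith) (by rw [hc]; linarith)
    have : (1 / p.toReal + 1 / 4 + 0) * p.toReal = 1 + p.toReal / 4 := by
      have : p.toReal ≠ 0 := by linarith
      field_simp
      ring
    linarith

/-- At p = 4 convergence would need σ > 1/2. Taking σ = 1/2 - ν and η = 2ν gives 4(σ + η) = 2 + 4ν >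
2, and the two exponents 2ν and ν are at most ε. -/
theorem exists_diffKernelPiece_lpNormBound_four (hα : |α| < 1) (hα0 : α ≠ 0) (hδ : 0 ≤ δ)
    (ha : IsAmplitude a) (hβ : IsDyadicPartition β) {ε : ℝ} (hε : 0 < ε) :
    ∃ C : ℝ, 0 < C ∧ ∀ ℓ ∈ Icc (1 : ℕ) 3, ∀ j : ℕ,
      LpNormBound (planeKernel (diffKernelPiece α δ a β ℓ j)) 4
        (C * (2 : ℝ) ^ ((j : ℝ) * (ε - δ))) := by
  set ν := min ε (1 / 2) / 2 with hν
  have hν0 : 0 < ν := by positivity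
  have h1 : 2 * ν ≤ ε := by rw [hν]; linarith [min_le_left ε (1 / 2)]
  have h2 : 2 * ν ≤ 1 / 2 := by rw [hν]; linarith [min_le_right ε (1 / 2)]
  have h4 : (4 : ℝ≥0∞).toReal = 4 := by norm_num
  exact exists_diffKernelPiece_lpNormBound hα hα0 hδ ha hβ (by norm_num) (by norm_num)
    (σ := 1 / 2 - ν) (η := 2 * ν) (by linarith) (by linarith) (by linarith)
    (by rw [h4]; linarith) (by rw [h4]; linarith) (by linarith)

end

end DiffractiveBR

end

/-! ### Convergence of the kernels and the three ranges of exponents -/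

theorem proposition3p2 (α δ : ℝ) (a : ℝ → ℂ) (β : ℝ → ℝ)
    (hα : |α| < 1) (hα0 : α ≠ 0) (hδ : 0 ≤ δ)
    (ha : DiffractiveBR.IsAmplitude a) (hβ : DiffractiveBR.IsDyadicPartition β) :
    -- the integrals defining the kernels converge absolutely
    (∀ ℓ ∈ Set.Icc (1 : ℕ) 3, ∀ r₁ r₂ θ : ℝ, 0 < r₁ → 0 < r₂ →
      MeasureTheory.IntegrableOn (DiffractiveBR.diffIntegrand α δ a ℓ r₁ r₂ θ) (Set.Ioi 0)) ∧
    -- the bound on L²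
    (∃ C : ℝ, 0 < C ∧ ∀ ℓ ∈ Set.Icc (1 : ℕ) 3, ∀ j : ℕ,
      DiffractiveBR.LpNormBound
        (DiffractiveBR.planeKernel (DiffractiveBR.diffKernelPiece α δ a β ℓ j)) 2
        (C * (2 : ℝ) ^ (-(j : ℝ) * δ))) ∧
    -- the bound on Lᵖ, 6 ≤ p ≤ ∞
    (∀ p : ENNReal, 6 ≤ p → ∃ C : ℝ, 0 < C ∧ ∀ ℓ ∈ Set.Icc (1 : ℕ) 3, ∀ j : ℕ,
      DiffractiveBR.LpNormBound
        (DiffractiveBR.planeKernel (DiffractiveBR.diffKernelPiece α δ a β ℓ j)) p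
        (C * (2 : ℝ) ^ ((j : ℝ) * (DiffractiveBR.criticalIndex p 2 - δ)))) ∧
    -- the bound on Lᵖ, 4 ≤ p < 6, with an arbitrarily small loss
    (∀ p : ENNReal, 4 ≤ p → p < 6 → ∀ ε : ℝ, 0 < ε →
      ∃ C : ℝ, 0 < C ∧ ∀ ℓ ∈ Set.Icc (1 : ℕ) 3, ∀ j : ℕ,
      DiffractiveBR.LpNormBound
        (DiffractiveBR.planeKernel (DiffractiveBR.diffKernelPiece α δ a β ℓ j)) p
        (C * (2 : ℝ) ^ ((j : ℝ) * (DiffractiveBR.criticalIndex p 2 - δ))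
          * (2 : ℝ) ^ ((j : ℝ) * ε))) := by
  open DiffractiveBR in
  refine ⟨fun ℓ hℓ r₁ r₂ θ h₁ h₂ => ?_, exists_diffKernelPiece_lpNormBound_two hα hα0 hδ ha hβ,
    fun p hp => exists_diffKernelPiece_lpNormBound_of_four_lt hα hα0 hδ ha hβ
      (lt_of_lt_of_le (by norm_num) hp), fun p hp _ ε hε => ?_⟩
  · obtain ⟨C, B', hB⟩ := ha.exists_amplitudeBound hδ
    exact (funext (diffIntegrand_eq α δ a ℓ r₁ r₂ θ)).symm ▸
      hB.integrableOn_osc_mul hδ h₁ h₂ (integrableOn_diffWeight hα hα0 θ hℓ)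
  -- Only p = 4, where the critical index is 0, uses the ε loss. For 4 < p < 6 the lossless bound
  -- holds, and 2^(jε) ≥ 1.
  · rcases hp.eq_or_lt with rfl | h4
    · obtain ⟨C, hC, h⟩ := exists_diffKernelPiece_lpNormBound_four hα hα0 hδ ha hβ hε
      refine ⟨C, hC, fun ℓ hℓ j => ?_⟩
      have hc : criticalIndex 4 2 = 0 := by
        rw [(criticalIndex_of_four_le le_rfl (by norm_num)).2]; norm_num
      rw [hc, mul_assoc, ← Real.rpow_add two_pos,
        show (j : ℝ) * (0 - δ) + j * ε = j * (ε - δ) by ring]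
      exact h ℓ hℓ j
    · obtain ⟨C, hC, h⟩ := exists_diffKernelPiece_lpNormBound_of_four_lt hα hα0 hδ ha hβ h4
      refine ⟨C, hC, fun ℓ hℓ j => (h ℓ hℓ j).planeKernel_congr_le (fun _ _ _ _ _ => rfl) ?_⟩
      exact le_mul_of_one_le_right (by positivity)
        (Real.one_le_rpow (by norm_num) (by positivity))
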